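/- Let $\mathbb T=\mathbb R/\mathbb Z$ and write $x=(x_\perp,x_\parallel)\in\mathbb T^3$ with $x_\perp=(x_1,x_2)\in\mathbb T^2$, $x_\parallel\in\mathbb T$; all integrals are with respect to the normalized Haar measure, and $\int\cdot\,dx_\perp$ is the integral over $\mathbb T^2$. For $\delta>1$ let $B_\delta$ be the space of real continuous functions $\phi$ on $\mathbb T^3$ with $$|\phi|_\delta=\sum_{k\in\mathbb Z^3}|\mathcal F\phi(k)|\,\delta^{|k|}<\infty,\qquad \mathcal F\phi(k)=\int_{\mathbb T^3}\phi(x)e^{-2\pi i k\cdot x}\,dx,$$ where $|k|$ is the Euclidean norm. Consider, for $\rho(t,x)$, $v(t,x)=v_\parallel(t,x)$ and a pressure $p(t,x_\parallel)$ on $\mathbb T$, the system $$\begin{cases}\partial_t\rho+\nabla_\perp\cdot(E^\perp\rho)+\partial_\parallel(v\rho)=0,\\ \partial_t v+\nabla_\perp\cdot(E^\perp v)+v\,\partial_\parallel v=-\partial_\parallel p(t,x_\parallel),\\ E^\perp=\nabla^\perp\Delta_\perp^{-1}\left(\rho-\int\rho\,dx_\perp\right),\\ \int\rho\,dx_\perp=1,\end{cases}\tag{S}$$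 where $\nabla^\perp=(\partial_{x_2},-\partial_{x_1})$, and $\Delta_\perp^{-1}f$, for $f$ with $\int f\,dx_\perp=0$, is the solution $\psi$ of $\Delta_\perp\psi=f$ with $\int\psi\,dx_\perp=0$. Let $\delta_0>1$ and let $\rho_0,v_0\in B_{\delta_0}$ satisfy $\rho_0\ge0$, $\int\rho_0\,dx_\perp=1$ and $\partial_\parallel\int\rho_0v_0\,dx_\perp=0$ for every $x_\parallel$. Then there is $\eta>0$, depending only on $\delta_0$ and on $(\rho_0,v_0)$, such that for every $\delta_1\in(1,\delta_0)$, with $T=\eta(\delta_0-\delta_1)$, there is a unique strong solution $(\rho,v,p)$ of (S) on $[0,T)$ with $\rho(0)=\rho_0$, $v(0)=v_0$ and $\rho,v\in C([0,T),B_\delta)$ for all $1<\delta<\delta_1$. Here a strong solution satisfies (S) pointwise at every $t\in[0,T)$ and every $x$ (the time derivative being one-sided at $t=0$), with $p(t,\cdot)$ differentiable on $\mathbb T$; uniqueness means that $\rho$ and $v$ are unique and that $p(t,\cdot)$ is unique up to an additive constant for each $t$. Moreover, on $[0,T)$, $$-\partial_\parallel p=\partial_\parallel\int\rho v^2\,dx_\perp.$$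 -/

import Mathlib

noncomputable section

namespace DriftFluid

open Filter Topology Set MeasureTheory

/-- The torus `𝕋³ = (ℝ/ℤ)³`. The coordinates `0, 1` are the perpendicular ones, the coordinate `2`
is the parallel one. -/
abbrev T3 : Type := UnitAddTorus (Fin 3)

/-- The Fourier coefficient `∫_{𝕋³} φ(x) e^{-2πi k·x} dx` (normalized Haar measure). -/
def fourierC (φ : T3 → ℝ) (k : Fin 3 → ℤ) : ℂ :=
  UnitAddTorus.mFourierCoeff (fun x => (φ x : ℂ)) k

/-- The Euclidean length `|k|` of a frequency. -/
def freqNorm (k : Fin 3 → ℤ) : ℝ := Real.sqrt (∑ i, (k i : ℝ) ^ 2)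

/-- Membership in the analytic space `B_δ`. Continuity selects the continuous representative, and
makes the Fourier coefficients meaningful. -/
def MemB (δ : ℝ) (φ : T3 → ℝ) : Prop :=
  Continuous φ ∧ Summable fun k : Fin 3 → ℤ => ‖fourierC φ k‖ * δ ^ freqNorm k

/-- The norm `|φ|_δ = ∑ₖ |𝓕φ(k)| δ^{|k|}` of `B_δ`. -/
def normB (δ : ℝ) (φ : T3 → ℝ) : ℝ := ∑' k : Fin 3 → ℤ, ‖fourierC φ k‖ * δ ^ freqNorm k

/-- `u ∈ C([0,T), B_δ)`. -/
def ContinuousInB (T δ : ℝ) (u : ℝ → T3 → ℝ) : Prop :=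
  (∀ t ∈ Ico 0 T, MemB δ (u t)) ∧
    ∀ t ∈ Ico 0 T, Tendsto (fun s => normB δ (fun x => u s x - u t x)) (𝓝[Ico 0 T] t) (𝓝 0)

/-- The partial derivative `∂_i f (x)` on `𝕋³`. -/
def pd (i : Fin 3) (f : T3 → ℝ) (x : T3) : ℝ :=
  deriv (fun s : ℝ => f (x + Pi.single i (s : UnitAddCircle))) 0

/-- The derivative `∂_∥ g (z)` of a function of the parallel variable only. -/
def dPar (g : UnitAddCircle → ℝ) (z : UnitAddCircle) : ℝ :=
  deriv (fun s : ℝ => g (z + (s : UnitAddCircle))) 0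

/-- The perpendicular average `∫ φ dx_⊥`, a function of the parallel variable. -/
def perpMean (φ : T3 → ℝ) (z : UnitAddCircle) : ℝ :=
  ∫ a : UnitAddCircle, ∫ b : UnitAddCircle, φ ![a, b, z]
    ∂AddCircle.haarAddCircle ∂AddCircle.haarAddCircle

/-- `Δ_⊥⁻¹ f`, the solution `ψ` of `Δ_⊥ ψ = f` with `∫ ψ dx_⊥ = 0`, for `f` with `∫ f dx_⊥ = 0`:
the Fourier multiplier `-1 / (4π² |k_⊥|²)` on the frequencies with `k_⊥ ≠ 0`. (At `k_⊥ = 0` the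
quotient is `0`. The sum is real since `f` is.) -/
def invLaplacePerp (f : T3 → ℝ) (x : T3) : ℝ :=
  (∑' k : Fin 3 → ℤ,
    (-(fourierC f k) / ((4 * Real.pi ^ 2 * ((k 0 : ℝ) ^ 2 + (k 1 : ℝ) ^ 2) : ℝ) : ℂ)) *
      UnitAddTorus.mFourier k x).re

/-- The potential `Δ_⊥⁻¹ (ρ - ∫ ρ dx_⊥)`. -/
def potential (ρ : T3 → ℝ) : T3 → ℝ :=
  invLaplacePerp fun x => ρ x - perpMean ρ (x 2)

/-- First component of `E^⊥ = ∇^⊥ Δ_⊥⁻¹ (ρ - ∫ ρ dx_⊥)`, where `∇^⊥ = (∂₂, -∂₁)`. -/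
def drift₁ (ρ : T3 → ℝ) (x : T3) : ℝ := pd 1 (potential ρ) x

/-- Second component of `E^⊥`. -/
def drift₂ (ρ : T3 → ℝ) (x : T3) : ℝ := -pd 0 (potential ρ) x

/-- `∇_⊥ · (E^⊥ f)`, where `E^⊥` is the drift created by `ρ`. -/
def driftDiv (ρ f : T3 → ℝ) (x : T3) : ℝ :=
  pd 0 (fun y => drift₁ ρ y * f y) x + pd 1 (fun y => drift₂ ρ y * f y) x

/-- `(ρ, v, p)` is a strong solution on `[0,T)` of the drift-fluid system with initial data
`(ρ₀, v₀)`, with `ρ, v ∈ C([0,T), B_δ)` for all `1 < δ < δ₁`. The pressure `p(t, ·)` is a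
differentiable function on the circle. The time derivative is one-sided at `t = 0`. -/
structure IsStrongSolution (δ₁ T : ℝ) (ρ₀ v₀ : T3 → ℝ)
    (ρ v : ℝ → T3 → ℝ) (p : ℝ → UnitAddCircle → ℝ) : Prop where
  rho_mem : ∀ δ, 1 < δ → δ < δ₁ → ContinuousInB T δ ρ
  v_mem : ∀ δ, 1 < δ → δ < δ₁ → ContinuousInB T δ v
  p_diff : ∀ t ∈ Ico 0 T, Differentiable ℝ fun s : ℝ => p t (s : UnitAddCircle)
  init_rho : ρ 0 = ρ₀
  init_v : v 0 = v₀
  eq_rho : ∀ t ∈ Ico 0 T, ∀ x : T3,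
    HasDerivWithinAt (fun s => ρ s x)
      (-(driftDiv (ρ t) (ρ t) x + pd 2 (fun y => v t y * ρ t y) x)) (Ico 0 T) t
  eq_v : ∀ t ∈ Ico 0 T, ∀ x : T3,
    HasDerivWithinAt (fun s => v s x)
      (-(driftDiv (ρ t) (v t) x + v t x * pd 2 (v t) x) - dPar (p t) (x 2)) (Ico 0 T) t
  constraint : ∀ t ∈ Ico 0 T, ∀ z, perpMean (ρ t) z = 1

end DriftFluid

end

noncomputable section

namespace DriftFluid

open Filter Topology Set MeasureTheory
open scoped ENNReal

/-! On the side of Fourier coefficients the system is an evolution in weighted ℓ¹ spaces, which for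
δ ≥ 1 are algebras under convolution (`wnorm_conv_le`). The drift is a multiplier of order -1
applied to the density, hence bounded on each space. What remains is the loss of one derivative, and
this costs a factor C/(δ' - δ) when the radius drops from δ' to δ. This is the setting of the
abstract Cauchy–Kovalevskaya theorem.

The pressure can be eliminated. If the perpendicular average of ρ is 1, the continuity equation
makes the current ∫ρv dx_⊥ independent of x_∥, so its time derivative -∂_∥∫ρv² dx_⊥ - ∂_∥p is
constant in x_∥. Both terms are derivatives of periodic functions, so the constant is 0
(`RegSol.pressureLaw`). Inserting this law gives a closed system that loses one derivative.

Existence: the closed system is solved by a power series in time. By `dom_taylor` the n-th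
coefficient is at most M (c/(δ₀ - δ))^n/(n+1)². The weight 1/(n+1)² survives Cauchy products up to a
constant, and the factor 1/(n+1) from integration in time pays for a derivative taken across the
fraction 1/(n+2) of the gap δ₀ - δ. The series converges at radius δ₁ as long as ct < δ₀ - δ₁,
whence η = 1/c. The constraint is recovered afterwards: the average of ρ minus 1 and the average
current minus its initial value solve a linear homogeneous system that loses one derivative and
start from zero (`RegSol.perpMean_eq_one`).

Uniqueness: that system and the difference of two solutions are both covered by
`LossSystem.eq_zero`. Iterating the integrated inequality over shrinking radii bounds the unknown by
B(6L(t - t₀)/(δs - δ))^n for every n, so it vanishes for a short time, and the argument restarts.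
Since the equations hold only pointwise in x, they are first passed to the coefficients by dominated
convergence (`hasDerivWithinAt_fourierC`). The a priori unbounded force of the pressure is cancelled
by comparing velocities on a single slice x_∥ = z (`RegSol.deriv_current`). -/

/-- Families of Fourier coefficients on `𝕋³`. -/
abbrev Coeffs : Type := (Fin 3 → ℤ) → ℂ

/-! ### Frequencies and weights -/

lemma freqNorm_eq_norm (k : Fin 3 → ℤ) :
    freqNorm k = ‖(WithLp.toLp 2 fun i => (k i : ℝ) : EuclideanSpace ℝ (Fin 3))‖ := by
  simp [freqNorm, EuclideanSpace.norm_eq]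

lemma freqNorm_nonneg (k : Fin 3 → ℤ) : 0 ≤ freqNorm k := Real.sqrt_nonneg _

lemma freqNorm_add_le (k l : Fin 3 → ℤ) : freqNorm (k + l) ≤ freqNorm k + freqNorm l := by
  simp only [freqNorm_eq_norm]
  refine le_trans (le_of_eq ?_) (norm_add_le _ _)
  congr 1
  ext i
  simp

lemma freqNorm_zero : freqNorm 0 = 0 := by simp [freqNorm]

lemma abs_le_freqNorm (k : Fin 3 → ℤ) (i : Fin 3) : |(k i : ℝ)| ≤ freqNorm k := by
  rw [freqNorm, ← Real.sqrt_sq_eq_abs]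
  exact Real.sqrt_le_sqrt (Finset.single_le_sum (f := fun j => (k j : ℝ) ^ 2)
    (fun j _ => sq_nonneg _) (Finset.mem_univ i))

lemma one_le_freqNorm {k : Fin 3 → ℤ} (hk : k ≠ 0) : 1 ≤ freqNorm k := by
  obtain ⟨i, hi⟩ := Function.ne_iff.mp hk
  refine le_trans ?_ (abs_le_freqNorm k i)
  exact_mod_cast Int.one_le_abs hi

/-- The loss of radius pays for one power of the frequency. -/
lemma freqNorm_mul_rpow_le {δ δ' : ℝ} (hδ : 1 ≤ δ) (h : δ < δ') (k : Fin 3 → ℤ) :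
    freqNorm k * δ ^ freqNorm k ≤ δ / (δ' - δ) * δ' ^ freqNorm k := by
  have hδ0 : 0 < δ := by linarith
  have hs : 0 < (δ' - δ) / δ := div_pos (by linarith) hδ0
  rcases eq_or_ne k 0 with rfl | hk
  · simp only [freqNorm_zero, zero_mul]
    have : 0 ≤ δ / (δ' - δ) := div_nonneg hδ0.le (by linarith)
    simpa using this
  -- Bernoulli's inequality with a real exponent needs |k| ≥ 1, which is why k = 0 is treated apart.
  · have h1 := one_add_mul_self_le_rpow_one_add (s := (δ' - δ) / δ) (by linarith)
      (one_le_freqNorm hk)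
    have h2 : δ' = δ * (1 + (δ' - δ) / δ) := by field_simp; ring
    have h3 : δ' ^ freqNorm k = δ ^ freqNorm k * (1 + (δ' - δ) / δ) ^ freqNorm k := by
      conv_lhs => rw [h2]
      rw [Real.mul_rpow hδ0.le (by linarith)]
    have h4 : freqNorm k ≤ δ / (δ' - δ) * (1 + (δ' - δ) / δ) ^ freqNorm k := by
      have h5 : freqNorm k * ((δ' - δ) / δ) ≤ (1 + (δ' - δ) / δ) ^ freqNorm k := by linarith
      have h6 : δ / (δ' - δ) = ((δ' - δ) / δ)⁻¹ := by rw [inv_div]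
      rw [h6, inv_mul_eq_div, le_div_iff₀ hs]
      exact h5
    rw [h3]
    have := mul_le_mul_of_nonneg_right h4 (Real.rpow_nonneg hδ0.le (freqNorm k))
    linarith

/-- The weight `δ^{|k|}`. -/
def weight (δ : ℝ) (k : Fin 3 → ℤ) : ℝ≥0∞ := ENNReal.ofReal (δ ^ freqNorm k)

lemma weight_add_le {δ : ℝ} (hδ : 1 ≤ δ) (k l : Fin 3 → ℤ) :
    weight δ (k + l) ≤ weight δ k * weight δ l := by
  have h0 : 0 < δ := by linarith
  rw [weight, weight, weight, ← ENNReal.ofReal_mul (Real.rpow_nonneg h0.le _),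
    ← Real.rpow_add h0]
  exact ENNReal.ofReal_le_ofReal (Real.rpow_le_rpow_of_exponent_le hδ (freqNorm_add_le k l))

lemma weight_mono {δ δ' : ℝ} (hδ : 1 ≤ δ) (h : δ ≤ δ') (k : Fin 3 → ℤ) :
    weight δ k ≤ weight δ' k :=
  ENNReal.ofReal_le_ofReal (Real.rpow_le_rpow (by linarith) h (freqNorm_nonneg k))

lemma one_le_weight {δ : ℝ} (hδ : 1 ≤ δ) (k : Fin 3 → ℤ) : 1 ≤ weight δ k := by
  rw [weight, ← ENNReal.ofReal_one]
  exact ENNReal.ofReal_le_ofReal (Real.one_le_rpow hδ (freqNorm_nonneg k))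

/-! ### The weighted norm of a family of coefficients -/

/-- The weighted `ℓ¹` norm, with values in `[0, ∞]`. -/
def wnorm (δ : ℝ) (a : Coeffs) : ℝ≥0∞ := ∑' k, ‖a k‖ₑ * weight δ k

lemma wnorm_mono {δ δ' : ℝ} (hδ : 1 ≤ δ) (h : δ ≤ δ') (a : Coeffs) :
    wnorm δ a ≤ wnorm δ' a :=
  ENNReal.tsum_le_tsum fun k => by gcongr; exact weight_mono hδ h k

lemma wnorm_add_le (δ : ℝ) (a b : Coeffs) : wnorm δ (a + b) ≤ wnorm δ a + wnorm δ b := by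
  rw [wnorm, wnorm, wnorm, ← ENNReal.tsum_add]
  refine ENNReal.tsum_le_tsum fun k => ?_
  rw [← add_mul]
  gcongr
  exact enorm_add_le _ _

lemma wnorm_neg (δ : ℝ) (a : Coeffs) : wnorm δ (-a) = wnorm δ a := by simp [wnorm]

lemma wnorm_zero (δ : ℝ) : wnorm δ 0 = 0 := by simp [wnorm]

/-- Countable subadditivity is Tonelli in [0, ∞], so no summability has to be assumed. -/
lemma wnorm_tsum_le (δ : ℝ) {ι : Type*} (X : ι → Coeffs) :
    wnorm δ (fun k => ∑' n, X n k) ≤ ∑' n, wnorm δ (X n) := by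
  simp only [wnorm]
  rw [ENNReal.tsum_comm]
  refine ENNReal.tsum_le_tsum fun k => ?_
  rw [ENNReal.tsum_mul_right]
  gcongr
  exact enorm_tsum_le_tsum_enorm

/-- The convolution of two families of coefficients. -/
def conv (a b : Coeffs) : Coeffs := fun n => ∑' l, a (n - l) * b l

/-- The weight is submultiplicative because |k| is subadditive and δ ≥ 1. This algebra property lets
every nonlinearity be estimated at a fixed radius. -/
lemma wnorm_conv_le {δ : ℝ} (hδ : 1 ≤ δ) (a b : Coeffs) :
    wnorm δ (conv a b) ≤ wnorm δ a * wnorm δ b := by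
  calc wnorm δ (conv a b)
      ≤ ∑' n, ∑' l, (‖a (n - l)‖ₑ * weight δ (n - l)) * (‖b l‖ₑ * weight δ l) := by
        refine ENNReal.tsum_le_tsum fun n => ?_
        calc ‖conv a b n‖ₑ * weight δ n ≤ (∑' l, ‖a (n - l) * b l‖ₑ) * weight δ n := by
              gcongr; exact enorm_tsum_le_tsum_enorm
          _ = ∑' l, ‖a (n - l) * b l‖ₑ * weight δ n := ENNReal.tsum_mul_right.symm
          _ ≤ _ := by
              refine ENNReal.tsum_le_tsum fun l => ?_
              rw [enorm_mul]
              have h := weight_add_le hδ (n - l) l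
              rw [sub_add_cancel] at h
              calc ‖a (n - l)‖ₑ * ‖b l‖ₑ * weight δ n
                  ≤ ‖a (n - l)‖ₑ * ‖b l‖ₑ * (weight δ (n - l) * weight δ l) := by gcongr
                _ = _ := by ring
    _ = ∑' l, ∑' n, (‖a (n - l)‖ₑ * weight δ (n - l)) * (‖b l‖ₑ * weight δ l) :=
        ENNReal.tsum_comm
    _ = ∑' l, wnorm δ a * (‖b l‖ₑ * weight δ l) := by
        refine tsum_congr fun l => ?_
        rw [ENNReal.tsum_mul_right]
        congr 1
        exact (Equiv.subRight l).tsum_eq fun n => ‖a n‖ₑ * weight δ n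
    _ = wnorm δ a * wnorm δ b := ENNReal.tsum_mul_left

lemma enorm_le_wnorm {δ : ℝ} (hδ : 1 ≤ δ) (a : Coeffs) (k : Fin 3 → ℤ) : ‖a k‖ₑ ≤ wnorm δ a :=
  calc ‖a k‖ₑ ≤ ‖a k‖ₑ * weight δ k := le_mul_of_one_le_right' (one_le_weight hδ k)
    _ ≤ wnorm δ a := ENNReal.le_tsum k

lemma tsum_enorm_le_wnorm {δ : ℝ} (hδ : 1 ≤ δ) (a : Coeffs) : ∑' k, ‖a k‖ₑ ≤ wnorm δ a :=
  ENNReal.tsum_le_tsum fun k => le_mul_of_one_le_right' (one_le_weight hδ k)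

lemma summable_norm_of_tsum_enorm {ι : Type*} {f : ι → ℂ} (h : ∑' i, ‖f i‖ₑ ≠ ⊤) :
    Summable fun i => ‖f i‖ := by
  have := ENNReal.summable_toReal h
  simpa using this

lemma summable_norm_of_wnorm {δ : ℝ} (hδ : 1 ≤ δ) {a : Coeffs} (h : wnorm δ a ≠ ⊤) :
    Summable fun k => ‖a k‖ :=
  summable_norm_of_tsum_enorm (ne_top_of_le_ne_top h (tsum_enorm_le_wnorm hδ a))

/-! ### Quantitative bounds -/

/-- `|a|_δ ≤ β`. -/
def Bd (δ : ℝ) (a : Coeffs) (β : ℝ) : Prop := 0 ≤ β ∧ wnorm δ a ≤ ENNReal.ofReal β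

namespace Bd

variable {δ δ' β γ : ℝ} {a b : Coeffs}

lemma ne_top (h : Bd δ a β) : wnorm δ a ≠ ⊤ := ne_top_of_le_ne_top ENNReal.ofReal_ne_top h.2

lemma of_ne_top (h : wnorm δ a ≠ ⊤) : Bd δ a (wnorm δ a).toReal :=
  ⟨ENNReal.toReal_nonneg, (ENNReal.ofReal_toReal h).ge⟩

lemma mono (h : Bd δ a β) (hβ : β ≤ γ) : Bd δ a γ :=
  ⟨h.1.trans hβ, h.2.trans (ENNReal.ofReal_le_ofReal hβ)⟩

lemma mono_radius (h : Bd δ' a β) (hδ : 1 ≤ δ) (hle : δ ≤ δ') : Bd δ a β :=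
  ⟨h.1, (wnorm_mono hδ hle a).trans h.2⟩

lemma zero (hβ : 0 ≤ β) : Bd δ 0 β := ⟨hβ, by simp [wnorm_zero]⟩

lemma add (ha : Bd δ a β) (hb : Bd δ b γ) : Bd δ (a + b) (β + γ) :=
  ⟨add_nonneg ha.1 hb.1, (wnorm_add_le δ a b).trans <| by
    rw [ENNReal.ofReal_add ha.1 hb.1]; exact add_le_add ha.2 hb.2⟩

lemma neg (ha : Bd δ a β) : Bd δ (-a) β := ⟨ha.1, by rw [wnorm_neg]; exact ha.2⟩

lemma sub (ha : Bd δ a β) (hb : Bd δ b γ) : Bd δ (a - b) (β + γ) := by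
  rw [sub_eq_add_neg]; exact ha.add hb.neg

lemma sum {ι : Type*} {s : Finset ι} {X : ι → Coeffs} {B : ι → ℝ}
    (h : ∀ i ∈ s, Bd δ (X i) (B i)) : Bd δ (∑ i ∈ s, X i) (∑ i ∈ s, B i) := by
  classical
  induction s using Finset.induction_on with
  | empty => simpa using zero le_rfl
  | insert i s hi ih =>
    rw [Finset.sum_insert hi, Finset.sum_insert hi]
    exact (h i (Finset.mem_insert_self i s)).add
      (ih fun j hj => h j (Finset.mem_insert_of_mem hj))

lemma convolve (hδ : 1 ≤ δ) (ha : Bd δ a β) (hb : Bd δ b γ) :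
    Bd δ (conv a b) (β * γ) :=
  ⟨mul_nonneg ha.1 hb.1, (wnorm_conv_le hδ a b).trans <| by
    rw [ENNReal.ofReal_mul ha.1]; exact mul_le_mul' ha.2 hb.2⟩

lemma of_norm_le {C : ℝ} (ha : Bd δ a β) (hC : 0 ≤ C) (h : ∀ k, ‖b k‖ ≤ C * ‖a k‖) :
    Bd δ b (C * β) := by
  refine ⟨mul_nonneg hC ha.1, ?_⟩
  calc wnorm δ b ≤ ∑' k, ENNReal.ofReal C * (‖a k‖ₑ * weight δ k) := by
        refine ENNReal.tsum_le_tsum fun k => ?_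
        rw [← mul_assoc]
        gcongr
        rw [← ofReal_norm, ← ofReal_norm, ← ENNReal.ofReal_mul hC]
        exact ENNReal.ofReal_le_ofReal (h k)
    _ = ENNReal.ofReal C * wnorm δ a := ENNReal.tsum_mul_left
    _ ≤ _ := by rw [ENNReal.ofReal_mul hC]; gcongr; exact ha.2

lemma of_norm_le_one (ha : Bd δ a β) (h : ∀ k, ‖b k‖ ≤ ‖a k‖) : Bd δ b β := by
  simpa using ha.of_norm_le zero_le_one fun k => by simpa using h k

lemma smul (ha : Bd δ a β) (c : ℂ) : Bd δ (c • a) (‖c‖ * β) :=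
  ha.of_norm_le (norm_nonneg c) fun k => by simp

/-- A first order multiplier costs a loss of radius. -/
lemma of_first_order {C : ℝ} (ha : Bd δ' a β) (hδ : 1 ≤ δ) (hlt : δ < δ') (hC : 0 ≤ C)
    (h : ∀ k, ‖b k‖ ≤ C * freqNorm k * ‖a k‖) : Bd δ b (C * δ / (δ' - δ) * β) := by
  have h0 : 0 ≤ C * δ / (δ' - δ) := div_nonneg (by positivity) (by linarith)
  refine ⟨mul_nonneg h0 ha.1, ?_⟩
  calc wnorm δ b ≤ ∑' k, ENNReal.ofReal (C * δ / (δ' - δ)) * (‖a k‖ₑ * weight δ' k) := by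
        refine ENNReal.tsum_le_tsum fun k => ?_
        rw [weight, weight, ← ofReal_norm, ← ofReal_norm,
          ← ENNReal.ofReal_mul (norm_nonneg _), ← ENNReal.ofReal_mul (norm_nonneg _),
          ← ENNReal.ofReal_mul h0]
        refine ENNReal.ofReal_le_ofReal ?_
        have h1 := freqNorm_mul_rpow_le hδ hlt k
        calc ‖b k‖ * δ ^ freqNorm k ≤ C * freqNorm k * ‖a k‖ * δ ^ freqNorm k := by
              gcongr; exact h k
          _ = C * ‖a k‖ * (freqNorm k * δ ^ freqNorm k) := by ring
          _ ≤ C * ‖a k‖ * (δ / (δ' - δ) * δ' ^ freqNorm k) := by gcongr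
          _ = _ := by ring
    _ = ENNReal.ofReal (C * δ / (δ' - δ)) * wnorm δ' a := ENNReal.tsum_mul_left
    _ ≤ _ := by rw [ENNReal.ofReal_mul h0]; gcongr; exact ha.2

lemma norm_le (ha : Bd δ a β) (hδ : 1 ≤ δ) (k : Fin 3 → ℤ) : ‖a k‖ ≤ β := by
  have := (enorm_le_wnorm hδ a k).trans ha.2
  rwa [← ofReal_norm, ENNReal.ofReal_le_ofReal_iff ha.1] at this

lemma tsum_norm_le (ha : Bd δ a β) (hδ : 1 ≤ δ) : ∑' k, ‖a k‖ ≤ β := by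
  have h := (tsum_enorm_le_wnorm hδ a).trans ha.2
  have h2 := ENNReal.toReal_mono ENNReal.ofReal_ne_top h
  rw [ENNReal.toReal_ofReal ha.1, ENNReal.tsum_toReal_eq (fun _ => enorm_ne_top)] at h2
  simpa using h2

lemma sum_weight_eq (hδ : 0 ≤ δ) (s : Finset (Fin 3 → ℤ)) : ∑ k ∈ s, ‖a k‖ₑ * weight δ k
    = ENNReal.ofReal (∑ k ∈ s, ‖a k‖ * δ ^ freqNorm k) := by
  rw [ENNReal.ofReal_sum_of_nonneg fun k _ => by positivity]
  refine Finset.sum_congr rfl fun k _ => ?_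
  rw [weight, ← ofReal_norm, ENNReal.ofReal_mul (norm_nonneg _)]

lemma of_finset (hβ : 0 ≤ β) (h : ∀ s : Finset (Fin 3 → ℤ),
    ∑ k ∈ s, ‖a k‖ * δ ^ freqNorm k ≤ β) (hδ : 0 ≤ δ) : Bd δ a β := by
  refine ⟨hβ, ?_⟩
  rw [wnorm, ENNReal.tsum_eq_iSup_sum]
  refine iSup_le fun s => ?_
  rw [sum_weight_eq hδ]
  exact ENNReal.ofReal_le_ofReal (h s)

lemma sum_le (ha : Bd δ a β) (hδ : 0 ≤ δ) (s : Finset (Fin 3 → ℤ)) :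
    ∑ k ∈ s, ‖a k‖ * δ ^ freqNorm k ≤ β := by
  have h2 := (ENNReal.sum_le_tsum s).trans ha.2
  rwa [sum_weight_eq hδ, ENNReal.ofReal_le_ofReal_iff ha.1] at h2

/-- Superposition of countably many families. -/
lemma tsum {ι : Type*} {X : ι → Coeffs} {B : ι → ℝ} (h : ∀ i, Bd δ (X i) (B i))
    (hB : Summable B) : Bd δ (fun k => ∑' i, X i k) (∑' i, B i) := by
  refine ⟨tsum_nonneg fun i => (h i).1, (wnorm_tsum_le δ X).trans ?_⟩
  rw [ENNReal.ofReal_tsum_of_nonneg (fun i => (h i).1) hB]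
  exact ENNReal.tsum_le_tsum fun i => (h i).2

end Bd

/-! ### Algebra of the convolution -/

lemma summable_norm_conv_term {a b : Coeffs} (ha : Summable fun k => ‖a k‖)
    (hb : Summable fun k => ‖b k‖) (n : Fin 3 → ℤ) : Summable fun l => ‖a (n - l) * b l‖ := by
  refine Summable.of_nonneg_of_le (fun _ => norm_nonneg _) (fun l => ?_)
    (hb.mul_left (∑' k, ‖a k‖))
  rw [norm_mul]
  gcongr
  exact ha.le_tsum (n - l) fun _ _ => norm_nonneg _

section conv

variable {a a' b b' : Coeffs}

lemma conv_sub_left (ha : Summable fun k => ‖a k‖) (ha' : Summable fun k => ‖a' k‖)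
    (hb : Summable fun k => ‖b k‖) : conv (a - a') b = conv a b - conv a' b := by
  ext n
  simp only [conv, Pi.sub_apply, sub_mul]
  exact (summable_norm_conv_term ha hb n).of_norm.tsum_sub
    (summable_norm_conv_term ha' hb n).of_norm

lemma conv_sub_right (ha : Summable fun k => ‖a k‖) (hb : Summable fun k => ‖b k‖)
    (hb' : Summable fun k => ‖b' k‖) : conv a (b - b') = conv a b - conv a b' := by
  ext n
  simp only [conv, Pi.sub_apply, mul_sub]
  exact (summable_norm_conv_term ha hb n).of_norm.tsum_sub
    (summable_norm_conv_term ha hb' n).of_norm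

/-- The Lipschitz estimate for products. -/
lemma Bd.conv_sub_conv {δ A B ε ε' : ℝ} (hδ : 1 ≤ δ) (ha' : Bd δ a' A) (hb : Bd δ b B)
    (ha : Bd δ a A) (hb' : Bd δ b' B) (hda : Bd δ (a - a') ε) (hdb : Bd δ (b - b') ε') :
    Bd δ (conv a b - conv a' b') (ε * B + A * ε') := by
  have sa := summable_norm_of_wnorm hδ ha.ne_top
  have sa' := summable_norm_of_wnorm hδ ha'.ne_top
  have sb := summable_norm_of_wnorm hδ hb.ne_top
  have sb' := summable_norm_of_wnorm hδ hb'.ne_top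
  have h : conv a b - conv a' b'
      = conv (a - a') b + conv a' (b - b') := by
    rw [conv_sub_left sa sa' sb, conv_sub_right sa' sb sb']
    abel
  rw [h]
  exact (hda.convolve hδ hb).add (ha'.convolve hδ hdb)

end conv

/-! ### Symbols of the Fourier multipliers -/

/-- The symbol of `∂_i`. -/
def dSym (i : Fin 3) : Coeffs := fun k => 2 * Real.pi * Complex.I * k i

/-- The symbol of `Δ_⊥⁻¹`. -/
def lapSym : Coeffs := fun k =>
  -1 / ((4 * Real.pi ^ 2 * ((k 0 : ℝ) ^ 2 + (k 1 : ℝ) ^ 2) : ℝ) : ℂ)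

/-- The symbol of the first component of the drift. -/
def driftSym₁ : Coeffs := dSym 1 * lapSym

/-- The symbol of the second component of the drift. -/
def driftSym₂ : Coeffs := -(dSym 0 * lapSym)

/-- The symbol of the perpendicular average. -/
def meanSym : Coeffs := fun k => if k 0 = 0 ∧ k 1 = 0 then 1 else 0

lemma norm_dSym (i : Fin 3) (k : Fin 3 → ℤ) : ‖dSym i k‖ = 2 * Real.pi * |(k i : ℝ)| := by
  simp [dSym, abs_of_pos Real.pi_pos]

lemma norm_dSym_le (i : Fin 3) (k : Fin 3 → ℤ) : ‖dSym i k‖ ≤ 2 * Real.pi * freqNorm k := by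
  rw [norm_dSym]
  have := abs_le_freqNorm k i
  have := Real.pi_pos
  gcongr

lemma norm_meanSym_le (k : Fin 3 → ℤ) : ‖meanSym k‖ ≤ 1 := by
  unfold meanSym
  split_ifs <;> simp

lemma norm_lapSym (k : Fin 3 → ℤ) :
    ‖lapSym k‖ = 1 / (4 * Real.pi ^ 2 * ((k 0 : ℝ) ^ 2 + (k 1 : ℝ) ^ 2)) := by
  rw [lapSym, norm_div, Complex.norm_real, Real.norm_of_nonneg (by positivity)]
  simp

/-- A nonzero integer satisfies |x| ≤ x² ≤ q, so one derivative is absorbed by the inverse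
Laplacian. The case x = 0 includes q = 0. -/
lemma mul_lap_aux {x : ℤ} {q : ℝ} (hq : (x : ℝ) ^ 2 ≤ q) :
    2 * Real.pi * |(x : ℝ)| * (1 / (4 * Real.pi ^ 2 * q)) ≤ 1 := by
  have hpi := Real.pi_gt_three
  rcases eq_or_ne x 0 with rfl | hx
  · simp
  have h1 : (1 : ℝ) ≤ |(x : ℝ)| := by exact_mod_cast Int.one_le_abs hx
  have h2 : (x : ℝ) ^ 2 = |(x : ℝ)| ^ 2 := (sq_abs _).symm
  have hq0 : 0 < q := by nlinarith
  rw [mul_one_div, div_le_one (by positivity)]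
  have h3 : |(x : ℝ)| ≤ q := by nlinarith
  calc 2 * Real.pi * |(x : ℝ)| ≤ 2 * Real.pi * q := by gcongr
    _ ≤ 4 * Real.pi ^ 2 * q := by
      have : 2 * Real.pi ≤ 4 * Real.pi ^ 2 := by nlinarith
      gcongr

lemma norm_driftSym₁_le (k : Fin 3 → ℤ) : ‖driftSym₁ k‖ ≤ 1 := by
  rw [driftSym₁, Pi.mul_apply, norm_mul, norm_dSym, norm_lapSym]
  exact mul_lap_aux (by nlinarith [sq_nonneg (k 0 : ℝ)])

lemma norm_driftSym₂_le (k : Fin 3 → ℤ) : ‖driftSym₂ k‖ ≤ 1 := by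
  rw [driftSym₂, Pi.neg_apply, norm_neg, Pi.mul_apply, norm_mul, norm_dSym, norm_lapSym]
  exact mul_lap_aux (by nlinarith [sq_nonneg (k 1 : ℝ)])

/-- Nonzero perpendicular frequencies have squared length at least 1; at k_⊥ = 0 division by zero
makes the symbol vanish. -/
lemma norm_lapSym_le (k : Fin 3 → ℤ) : ‖lapSym k‖ ≤ 1 := by
  rw [norm_lapSym]
  rcases eq_or_ne ((k 0 : ℝ) ^ 2 + (k 1 : ℝ) ^ 2) 0 with h | h
  · rw [h]; simp
  have h0 : 0 < (k 0) ^ 2 + (k 1) ^ 2 := by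
    have : (0 : ℝ) < (k 0 : ℝ) ^ 2 + (k 1 : ℝ) ^ 2 := lt_of_le_of_ne (by positivity) h.symm
    exact_mod_cast this
  have h1 : (1 : ℝ) ≤ (k 0 : ℝ) ^ 2 + (k 1 : ℝ) ^ 2 := by exact_mod_cast h0
  have hpi := Real.pi_gt_three
  rw [div_le_one (by positivity)]
  nlinarith [mul_le_mul (show (1:ℝ) ≤ 4 * Real.pi ^ 2 by nlinarith) h1 zero_le_one (by positivity)]

lemma Bd.mul_of_le_one {δ β : ℝ} {m a : Coeffs} (hm : ∀ k, ‖m k‖ ≤ 1) (ha : Bd δ a β) :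
    Bd δ (m * a) β :=
  ha.of_norm_le_one fun k => by
    rw [Pi.mul_apply, norm_mul]
    exact mul_le_of_le_one_left (norm_nonneg _) (hm k)

lemma Bd.dSym_mul {δ δ' β : ℝ} {a : Coeffs} (ha : Bd δ' a β) (hδ : 1 ≤ δ) (hlt : δ < δ')
    (i : Fin 3) : Bd δ (dSym i * a) (2 * Real.pi * δ / (δ' - δ) * β) :=
  ha.of_first_order hδ hlt (by positivity) fun k => by
    rw [Pi.mul_apply, norm_mul]
    gcongr
    exact norm_dSym_le i k

lemma meanSym_mul_dSym_zero : meanSym * dSym 0 = 0 := by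
  ext k
  simp only [meanSym, dSym, Pi.mul_apply, Pi.zero_apply]
  split_ifs with h <;> simp [h]

lemma meanSym_mul_dSym_one : meanSym * dSym 1 = 0 := by
  ext k
  simp only [meanSym, dSym, Pi.mul_apply, Pi.zero_apply]
  split_ifs with h <;> simp [h]

/-- A factor that does not depend on the perpendicular variables comes out of the average. -/
lemma meanSym_mul_conv (a b : Coeffs) :
    meanSym * conv a (meanSym * b) = conv (meanSym * a) (meanSym * b) := by
  ext n
  simp only [conv, Pi.mul_apply]
  rw [← tsum_mul_left]
  refine tsum_congr fun l => ?_
  by_cases hl : l 0 = 0 ∧ l 1 = 0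
  · have : meanSym (n - l) = meanSym n := by simp [meanSym, hl.1, hl.2]
    rw [this]; ring
  · simp [meanSym, hl]

/-! ### Hermitian families -/

/-- The symmetry of the coefficients of a real function. -/
def Herm (a : Coeffs) : Prop := ∀ k, a (-k) = (starRingEnd ℂ) (a k)

namespace Herm

variable {a b : Coeffs}

lemma add (ha : Herm a) (hb : Herm b) : Herm (a + b) := fun k => by simp [ha k, hb k]

lemma neg (ha : Herm a) : Herm (-a) := fun k => by simp [ha k]

lemma mul (ha : Herm a) (hb : Herm b) : Herm (a * b) := fun k => by simp [ha k, hb k]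

lemma real_smul (ha : Herm a) (c : ℝ) : Herm ((c : ℂ) • a) := fun k => by simp [ha k]

lemma sum {ι : Type*} {s : Finset ι} {X : ι → Coeffs} (h : ∀ i ∈ s, Herm (X i)) :
    Herm (∑ i ∈ s, X i) := fun k => by
  simp only [Finset.sum_apply, map_sum]
  exact Finset.sum_congr rfl fun i hi => h i hi k

lemma convolve (ha : Herm a) (hb : Herm b) : Herm (conv a b) := fun k => by
  simp only [conv, Complex.conj_tsum, map_mul]
  rw [← (Equiv.neg (Fin 3 → ℤ)).tsum_eq]
  refine tsum_congr fun l => ?_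
  rw [Equiv.neg_apply, ← ha, ← hb]
  congr 2
  abel

end Herm

lemma herm_dSym (i : Fin 3) : Herm (dSym i) := fun k => by
  have h2 : (starRingEnd ℂ) 2 = 2 := map_ofNat _ 2
  simp [dSym, h2]

lemma herm_lapSym : Herm lapSym := fun k => by
  simp only [lapSym, map_div₀, Complex.conj_ofReal, Pi.neg_apply]
  simp

lemma herm_meanSym : Herm meanSym := fun k => by
  simp only [meanSym, Pi.neg_apply, neg_eq_zero]
  split_ifs <;> simp

lemma herm_driftSym₁ : Herm driftSym₁ := (herm_dSym 1).mul herm_lapSym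

lemma herm_driftSym₂ : Herm driftSym₂ := ((herm_dSym 0).mul herm_lapSym).neg

/-! ### Sums of Fourier series -/

/-- The product of the normalized Haar measures on `𝕋³`. -/
def haarT3 : Measure T3 := Measure.pi fun _ : Fin 3 => (AddCircle.haarAddCircle : Measure UnitAddCircle)

instance : IsProbabilityMeasure haarT3 := by unfold haarT3; infer_instance

lemma fourierC_eq_integral (φ : T3 → ℝ) (k : Fin 3 → ℤ) :
    fourierC φ k = ∫ x, UnitAddTorus.mFourier (-k) x * (φ x : ℂ) ∂haarT3 := rfl

lemma norm_fourier_apply (n : ℤ) (x : UnitAddCircle) : ‖(fourier n x : ℂ)‖ = 1 := by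
  rw [fourier_apply, Circle.norm_coe]

lemma norm_mFourier_apply (k : Fin 3 → ℤ) (x : T3) : ‖UnitAddTorus.mFourier k x‖ = 1 := by
  simp only [UnitAddTorus.mFourier, ContinuousMap.coe_mk, norm_prod, norm_fourier_apply,
    Finset.prod_const_one]

lemma integral_fourier_eq (n : ℤ) :
    ∫ x : UnitAddCircle, (fourier n x : ℂ) ∂AddCircle.haarAddCircle = if n = 0 then 1 else 0 := by
  have h := congrFun (fourierCoeff_fourier (T := (1 : ℝ)) n) 0
  simp only [fourierCoeff, neg_zero, fourier_zero, one_smul] at h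
  rw [h, Pi.single_apply]
  simp only [eq_comm]

lemma integral_mFourier (k : Fin 3 → ℤ) :
    ∫ x, UnitAddTorus.mFourier k x ∂haarT3 = if k = 0 then 1 else 0 := by
  have h : ∫ x, UnitAddTorus.mFourier k x ∂haarT3
      = ∏ i, ∫ x : UnitAddCircle, (fourier (k i) x : ℂ) ∂AddCircle.haarAddCircle := by
    rw [haarT3, ← MeasureTheory.integral_fintype_prod_eq_prod]
    rfl
  rw [h]
  simp only [integral_fourier_eq]
  split_ifs with hk
  · subst hk; simp
  · obtain ⟨i, hi⟩ := Function.ne_iff.mp hk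
    exact Finset.prod_eq_zero (Finset.mem_univ i) (by simpa using hi)

/-- The sum of the Fourier series with coefficients `a`. -/
def synth (a : Coeffs) (x : T3) : ℂ := ∑' k, a k * UnitAddTorus.mFourier k x

section synth

variable {a b : Coeffs}

lemma summable_norm_synth_term (ha : Summable fun k => ‖a k‖) (x : T3) :
    Summable fun k => ‖a k * UnitAddTorus.mFourier k x‖ := by
  simpa [norm_mul, norm_mFourier_apply] using ha

lemma continuous_synth (ha : Summable fun k => ‖a k‖) : Continuous (synth a) := by
  refine continuous_tsum (fun k => by fun_prop) ha fun k x => ?_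
  simp [norm_mFourier_apply]

lemma norm_synth_le (ha : Summable fun k => ‖a k‖) (x : T3) : ‖synth a x‖ ≤ ∑' k, ‖a k‖ := by
  refine (norm_tsum_le_tsum_norm (summable_norm_synth_term ha x)).trans (le_of_eq ?_)
  simp [norm_mFourier_apply]

lemma synth_add (ha : Summable fun k => ‖a k‖) (hb : Summable fun k => ‖b k‖) (x : T3) :
    synth (a + b) x = synth a x + synth b x := by
  simp only [synth, Pi.add_apply, add_mul]
  exact (summable_norm_synth_term ha x).of_norm.tsum_add (summable_norm_synth_term hb x).of_norm

lemma synth_smul (c : ℂ) (a : Coeffs) (x : T3) : synth (c • a) x = c * synth a x := by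
  simp only [synth, Pi.smul_apply, smul_eq_mul, mul_assoc]
  exact tsum_mul_left

lemma synth_neg (a : Coeffs) (x : T3) : synth (-a) x = -synth a x := by
  simpa using synth_smul (-1) a x

lemma synth_conv (ha : Summable fun k => ‖a k‖) (hb : Summable fun k => ‖b k‖) (x : T3) :
    synth (conv a b) x = synth a x * synth b x := by
  set e := fun k => UnitAddTorus.mFourier k x with he
  have h1 := summable_norm_synth_term ha x
  have h2 := summable_norm_synth_term hb x
  have hs : Summable fun p : (Fin 3 → ℤ) × (Fin 3 → ℤ) => (a p.1 * e p.1) * (b p.2 * e p.2) :=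
    (h1.mul_norm h2).of_norm
  -- This shear indexes the double series by the total frequency n and by l, so that the inner sum
  -- is a convolution coefficient.
  let E : (Fin 3 → ℤ) × (Fin 3 → ℤ) ≃ (Fin 3 → ℤ) × (Fin 3 → ℤ) :=
    { toFun := fun p => (p.1 - p.2, p.2)
      invFun := fun p => (p.1 + p.2, p.2)
      left_inv := fun p => by simp
      right_inv := fun p => by simp }
  have hs' := E.summable_iff.mpr hs
  have h3 : synth a x * synth b x = ∑' p, ((fun p : (Fin 3 → ℤ) × (Fin 3 → ℤ) =>
      (a p.1 * e p.1) * (b p.2 * e p.2)) ∘ E) p := by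
    rw [synth, synth, tsum_mul_tsum_of_summable_norm h1 h2]
    exact (E.tsum_eq _).symm
  rw [h3, hs'.tsum_prod, synth]
  refine tsum_congr fun n => ?_
  rw [conv, ← tsum_mul_right]
  refine tsum_congr fun l => ?_
  have : UnitAddTorus.mFourier n x = e (n - l) * e l := by
    rw [he, ← UnitAddTorus.mFourier_add, sub_add_cancel]
  simp only [E, Equiv.coe_fn_mk, Function.comp]
  rw [this]
  ring

/-- Absolute summability allows term-by-term integration against a character, and orthogonality
selects one term. Hence a function determines the coefficients of any absolutely convergent series
that represents it. -/
lemma integral_synth (ha : Summable fun k => ‖a k‖) (n : Fin 3 → ℤ) :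
    ∫ x, UnitAddTorus.mFourier (-n) x * synth a x ∂haarT3 = a n := by
  have h := hasSum_integral_of_summable_integral_norm (μ := haarT3)
    (F := fun k x => UnitAddTorus.mFourier (-n) x * (a k * UnitAddTorus.mFourier k x))
    (fun k => Continuous.integrable_of_hasCompactSupport (by fun_prop)
      (HasCompactSupport.of_compactSpace _))
    (by simpa [norm_mFourier_apply] using ha)
  have h2 : ∀ k, ∫ x, UnitAddTorus.mFourier (-n) x * (a k * UnitAddTorus.mFourier k x) ∂haarT3
      = if k = n then a n else 0 := fun k => by
    have : ∀ x : T3, UnitAddTorus.mFourier (-n) x * (a k * UnitAddTorus.mFourier k x)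
        = a k * UnitAddTorus.mFourier (k - n) x := fun x => by
      rw [sub_eq_add_neg, UnitAddTorus.mFourier_add]; ring
    simp only [this]
    rw [integral_const_mul, integral_mFourier]
    by_cases hk : k = n
    · simp [hk]
    · simp [hk, sub_eq_zero]
  simp only [h2] at h
  have h3 := h.unique (hasSum_ite_eq n (a n))
  rw [← h3]
  refine integral_congr_ae (ae_of_all _ fun x => ?_)
  simp only [synth]
  rw [tsum_mul_left]

lemma conj_synth (ha : Herm a) (x : T3) : (starRingEnd ℂ) (synth a x) = synth a x := by
  rw [synth, Complex.conj_tsum, ← (Equiv.neg (Fin 3 → ℤ)).tsum_eq]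
  refine tsum_congr fun k => ?_
  rw [Equiv.neg_apply, map_mul, ← ha, neg_neg, UnitAddTorus.mFourier_neg, Complex.conj_conj]

lemma ofReal_re_synth (ha : Herm a) (x : T3) : ((synth a x).re : ℂ) = synth a x :=
  Complex.conj_eq_iff_re.mp (conj_synth ha x)

lemma mFourier_add_single (k : Fin 3 → ℤ) (x : T3) (i : Fin 3) (s : ℝ) :
    UnitAddTorus.mFourier k (x + Pi.single i (s : UnitAddCircle))
      = UnitAddTorus.mFourier k x * fourier (k i) (s : UnitAddCircle) := by
  have h : ∀ (y : T3) , UnitAddTorus.mFourier k (x + y)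
      = UnitAddTorus.mFourier k x * UnitAddTorus.mFourier k y := fun y => by
    simp [UnitAddTorus.mFourier, fourier_apply, smul_add, AddCircle.toCircle_add,
      Finset.prod_mul_distrib]
  rw [h]
  congr 1
  simp only [UnitAddTorus.mFourier, ContinuousMap.coe_mk]
  rw [Finset.prod_eq_single i]
  · simp
  · intro j _ hj
    simp [Pi.single_eq_of_ne hj]
  · simp

lemma hasDerivAt_synth {i : Fin 3} (ha : Summable fun k => ‖a k‖)
    (hd : Summable fun k => ‖(dSym i * a) k‖) (x : T3) :
    HasDerivAt (fun s : ℝ => synth a (x + Pi.single i (s : UnitAddCircle)))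
      (synth (dSym i * a) x) 0 := by
  have h := hasDerivAt_tsum (𝕜 := ℝ) (F := ℂ)
    (g := fun (k : Fin 3 → ℤ) (s : ℝ) => a k * UnitAddTorus.mFourier k x * fourier (k i) (s : UnitAddCircle))
    (g' := fun (k : Fin 3 → ℤ) (s : ℝ) => a k * UnitAddTorus.mFourier k x *
      (2 * Real.pi * Complex.I * (k i) / (1 : ℝ) * fourier (k i) (s : UnitAddCircle)))
    (y₀ := (0 : ℝ)) hd
    (fun k s => (hasDerivAt_fourier 1 (k i) s).const_mul _)
    (fun k s => by
      rw [Pi.mul_apply, dSym]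
      simp only [norm_mul, norm_mFourier_apply, norm_fourier_apply, Complex.ofReal_one, div_one]
      linarith)
    (by simpa using (summable_norm_synth_term ha x).of_norm) 0
  have h1 : (fun s : ℝ => synth a (x + Pi.single i (s : UnitAddCircle))) = fun s : ℝ =>
      ∑' k, a k * UnitAddTorus.mFourier k x * fourier (k i) (s : UnitAddCircle) := by
    ext s
    simp only [synth, mFourier_add_single]
    exact tsum_congr fun k => by ring
  have h2 : synth (dSym i * a) x = ∑' k : Fin 3 → ℤ, a k * UnitAddTorus.mFourier k x *
      (2 * Real.pi * Complex.I * (k i) / (1 : ℝ) * fourier (k i) ((0 : ℝ) : UnitAddCircle)) := by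
    unfold synth
    refine tsum_congr fun k => ?_
    rw [Pi.mul_apply, dSym]
    simp
    ring
  rw [h1, h2]
  exact h

end synth

/-! ### Functions with prescribed Fourier coefficients -/

/-- `φ` is the sum of the Fourier series with coefficients `a`, and `|a|_δ < ∞`. -/
structure HasCoeff (δ : ℝ) (φ : T3 → ℝ) (a : Coeffs) : Prop where
  one_le : 1 ≤ δ
  ne_top : wnorm δ a ≠ ⊤
  eq : ∀ x, (φ x : ℂ) = synth a x

lemma wnorm_eq_tsum_ofReal (δ : ℝ) (a : Coeffs) :
    wnorm δ a = ∑' k, ENNReal.ofReal (‖a k‖ * δ ^ freqNorm k) := by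
  refine tsum_congr fun k => ?_
  rw [weight, ← ofReal_norm, ENNReal.ofReal_mul (norm_nonneg _)]

lemma summable_iff_wnorm {δ : ℝ} (hδ : 0 ≤ δ) (a : Coeffs) :
    (Summable fun k => ‖a k‖ * δ ^ freqNorm k) ↔ wnorm δ a ≠ ⊤ := by
  have h0 : ∀ k, 0 ≤ ‖a k‖ * δ ^ freqNorm k := fun k => by positivity
  rw [wnorm_eq_tsum_ofReal δ]
  constructor
  · intro h
    rw [← ENNReal.ofReal_tsum_of_nonneg h0 h]
    exact ENNReal.ofReal_ne_top
  · intro h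
    exact (ENNReal.summable_toReal h).congr fun k => ENNReal.toReal_ofReal (h0 k)

lemma normB_eq_toReal {δ : ℝ} (hδ : 0 ≤ δ) (φ : T3 → ℝ) :
    normB δ φ = (wnorm δ (fourierC φ)).toReal := by
  have h0 : ∀ k, 0 ≤ ‖fourierC φ k‖ * δ ^ freqNorm k := fun k => by positivity
  rw [wnorm_eq_tsum_ofReal δ, ENNReal.tsum_toReal_eq (fun _ => ENNReal.ofReal_ne_top), normB]
  exact tsum_congr fun k => (ENNReal.toReal_ofReal (h0 k)).symm

/-- This is where continuity of φ matters: a continuous function with summable Fourier coefficients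
equals its Fourier series at every point, not just almost everywhere. -/
lemma MemB.hasCoeff {δ : ℝ} {φ : T3 → ℝ} (hδ : 1 ≤ δ) (h : MemB δ φ) :
    HasCoeff δ φ (fourierC φ) := by
  have hw := (summable_iff_wnorm (by linarith) _).mp h.2
  refine ⟨hδ, hw, fun x => ?_⟩
  let f : C(T3, ℂ) := ⟨fun x => (φ x : ℂ), Complex.continuous_ofReal.comp h.1⟩
  have hs : Summable (UnitAddTorus.mFourierCoeff f) := (summable_norm_of_wnorm hδ hw).of_norm
  exact (UnitAddTorus.hasSum_mFourier_series_apply_of_summable hs x).tsum_eq.symm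

namespace HasCoeff

variable {δ δ' : ℝ} {φ ψ : T3 → ℝ} {a b : Coeffs}

lemma summable (h : HasCoeff δ φ a) : Summable fun k => ‖a k‖ :=
  summable_norm_of_wnorm h.one_le h.ne_top

lemma continuous (h : HasCoeff δ φ a) : Continuous φ := by
  have h1 : Continuous fun x => ((φ x : ℂ)).re := by
    simp only [h.eq]
    exact Complex.continuous_re.comp (continuous_synth h.summable)
  simpa using h1

lemma fourierC_eq (h : HasCoeff δ φ a) : fourierC φ = a := by
  ext k
  rw [fourierC_eq_integral]
  simp only [h.eq]
  exact integral_synth h.summable k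

lemma memB (h : HasCoeff δ φ a) : MemB δ φ := by
  have := h.one_le
  exact ⟨h.continuous, (summable_iff_wnorm (by linarith) _).mpr (h.fourierC_eq ▸ h.ne_top)⟩

lemma unique (h : HasCoeff δ φ a) (h' : HasCoeff δ' φ b) : a = b := by
  rw [← h.fourierC_eq, h'.fourierC_eq]

lemma congr (h : HasCoeff δ φ a) (hφ : ∀ x, ψ x = φ x) (hb : b = a) : HasCoeff δ ψ b := by
  have : ψ = φ := funext hφ
  subst this; subst hb; exact h

lemma ext (h : HasCoeff δ φ a) (h' : HasCoeff δ' ψ a) : φ = ψ := by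
  ext x
  have := (h.eq x).trans (h'.eq x).symm
  exact_mod_cast this

lemma mono (h : HasCoeff δ' φ a) (hδ : 1 ≤ δ) (hle : δ ≤ δ') : HasCoeff δ φ a :=
  ⟨hδ, ne_top_of_le_ne_top h.ne_top (wnorm_mono hδ hle a), h.eq⟩

lemma herm (h : HasCoeff δ φ a) : Herm a := fun k => by
  rw [← h.fourierC_eq, fourierC_eq_integral, fourierC_eq_integral, ← integral_conj]
  refine integral_congr_ae (ae_of_all _ fun x => ?_)
  simp [UnitAddTorus.mFourier_neg]

lemma add (h : HasCoeff δ φ a) (h' : HasCoeff δ ψ b) :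
    HasCoeff δ (fun x => φ x + ψ x) (a + b) :=
  ⟨h.one_le, ne_top_of_le_ne_top (ENNReal.add_ne_top.mpr ⟨h.ne_top, h'.ne_top⟩)
    (wnorm_add_le δ a b), fun x => by
    rw [synth_add h.summable h'.summable, ← h.eq, ← h'.eq]; push_cast; rfl⟩

lemma neg (h : HasCoeff δ φ a) : HasCoeff δ (fun x => -φ x) (-a) :=
  ⟨h.one_le, by rw [wnorm_neg]; exact h.ne_top, fun x => by
    rw [synth_neg, ← h.eq]; push_cast; rfl⟩

lemma sub (h : HasCoeff δ φ a) (h' : HasCoeff δ ψ b) :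
    HasCoeff δ (fun x => φ x - ψ x) (a - b) :=
  (h.add h'.neg).congr (fun _ => sub_eq_add_neg _ _) (sub_eq_add_neg _ _)

lemma const_mul (h : HasCoeff δ φ a) (c : ℝ) : HasCoeff δ (fun x => c * φ x) ((c : ℂ) • a) :=
  ⟨h.one_le, ((Bd.of_ne_top h.ne_top).smul c).ne_top, fun x => by
    rw [synth_smul, ← h.eq]; push_cast; rfl⟩

lemma mul (h : HasCoeff δ φ a) (h' : HasCoeff δ ψ b) :
    HasCoeff δ (fun x => φ x * ψ x) (conv a b) :=
  ⟨h.one_le, ne_top_of_le_ne_top (ENNReal.mul_ne_top h.ne_top h'.ne_top)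
    (wnorm_conv_le h.one_le a b), fun x => by
    rw [synth_conv h.summable h'.summable, ← h.eq, ← h'.eq]; push_cast; rfl⟩

lemma of_herm (hδ : 1 ≤ δ) (ha : wnorm δ a ≠ ⊤) (hh : Herm a) :
    HasCoeff δ (fun x => (synth a x).re) a :=
  ⟨hδ, ha, fun x => ofReal_re_synth hh x⟩

lemma abs_le {β : ℝ} (h : HasCoeff δ φ a) (hb : Bd δ a β) (x : T3) : |φ x| ≤ β := by
  have h1 := norm_synth_le h.summable x
  rw [← h.eq, Complex.norm_real] at h1
  exact h1.trans (hb.tsum_norm_le h.one_le)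

lemma dSym_ne_top (h : HasCoeff δ φ a) (hδ : 1 ≤ δ') (hlt : δ' < δ) (i : Fin 3) :
    wnorm δ' (dSym i * a) ≠ ⊤ :=
  ((Bd.of_ne_top h.ne_top).dSym_mul hδ hlt i).ne_top

lemma summable_dSym (h : HasCoeff δ φ a) (hδ : 1 < δ) (i : Fin 3) :
    Summable fun k => ‖(dSym i * a) k‖ :=
  summable_norm_of_wnorm le_rfl (h.dSym_ne_top le_rfl hδ i)

lemma hasDerivAt_aux (h : HasCoeff δ φ a) (hδ : 1 < δ) (i : Fin 3) (x : T3) :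
    HasDerivAt (fun s : ℝ => φ (x + Pi.single i (s : UnitAddCircle)))
      (synth (dSym i * a) x).re 0 ∧
    HasDerivAt (fun s : ℝ => (φ (x + Pi.single i (s : UnitAddCircle)) : ℂ))
      (synth (dSym i * a) x) 0 := by
  have h1 := hasDerivAt_synth h.summable (h.summable_dSym hδ i) x
  simp only [← h.eq] at h1
  refine ⟨?_, h1⟩
  have h2 := Complex.reCLM.hasFDerivAt.comp_hasDerivAt (0 : ℝ) h1
  simpa [Function.comp_def] using h2

/-- Partial derivatives exist. -/
lemma hasDerivAt (h : HasCoeff δ φ a) (hδ : 1 < δ) (i : Fin 3) (x : T3) :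
    HasDerivAt (fun s : ℝ => φ (x + Pi.single i (s : UnitAddCircle))) (pd i φ x) 0 := by
  have h1 := (h.hasDerivAt_aux hδ i x).1
  rwa [pd, h1.deriv]

lemma ofReal_pd (h : HasCoeff δ φ a) (hδ : 1 < δ) (i : Fin 3) (x : T3) :
    (pd i φ x : ℂ) = synth (dSym i * a) x :=
  (h.hasDerivAt hδ i x).ofReal_comp.unique (h.hasDerivAt_aux hδ i x).2

lemma pd (h : HasCoeff δ φ a) (hδ : 1 ≤ δ') (hlt : δ' < δ) (i : Fin 3) :
    HasCoeff δ' (DriftFluid.pd i φ) (dSym i * a) :=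
  ⟨hδ, h.dSym_ne_top hδ hlt i, fun x => h.ofReal_pd (hδ.trans_lt hlt) i x⟩

lemma mul_of_le_one {m : Coeffs} (h : HasCoeff δ φ a) (hm : ∀ k, ‖m k‖ ≤ 1)
    (hψ : ∀ x, (ψ x : ℂ) = synth (m * a) x) : HasCoeff δ ψ (m * a) :=
  ⟨h.one_le, ((Bd.of_ne_top h.ne_top).mul_of_le_one hm).ne_top, hψ⟩

end HasCoeff

/-- Leibniz rule. -/
lemma pd_mul {δ : ℝ} (hδ : 1 < δ) {φ ψ : T3 → ℝ} {a b : Coeffs} (h : HasCoeff δ φ a)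
    (h' : HasCoeff δ ψ b) (i : Fin 3) (x : T3) :
    pd i (fun y => φ y * ψ y) x = pd i φ x * ψ x + φ x * pd i ψ x := by
  have := (h.hasDerivAt hδ i x).fun_mul (h'.hasDerivAt hδ i x)
  rw [pd]
  refine HasDerivAt.deriv ?_
  simpa using this

/-! ### The perpendicular average -/

/-- The Haar measure on the perpendicular torus. -/
def haarT2 : Measure (UnitAddCircle × UnitAddCircle) :=
  (AddCircle.haarAddCircle : Measure UnitAddCircle).prod AddCircle.haarAddCircle

instance : IsProbabilityMeasure haarT2 := by unfold haarT2; infer_instance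

lemma continuous_vec (z : UnitAddCircle) :
    Continuous fun q : UnitAddCircle × UnitAddCircle => (![q.1, q.2, z] : T3) := by
  refine continuous_pi fun i => ?_
  fin_cases i
  · exact continuous_fst
  · exact continuous_snd
  · exact continuous_const

lemma integrable_haarT2 {E : Type*} [NormedAddCommGroup E]
    {f : UnitAddCircle × UnitAddCircle → E} (hf : Continuous f) :
    Integrable f haarT2 :=
  hf.integrable_of_hasCompactSupport (HasCompactSupport.of_compactSpace _)

lemma perpMean_eq_integral {φ : T3 → ℝ} (hφ : Continuous φ) (z : UnitAddCircle) :
    perpMean φ z = ∫ q, φ ![q.1, q.2, z] ∂haarT2 := by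
  exact (integral_prod _ (integrable_haarT2 (hφ.comp (continuous_vec z)))).symm

lemma integral_mFourier_perp (k : Fin 3 → ℤ) (z : UnitAddCircle) :
    ∫ q, UnitAddTorus.mFourier k (![q.1, q.2, z] : T3) ∂haarT2 = meanSym k * fourier (k 2) z := by
  have h : ∀ q : UnitAddCircle × UnitAddCircle, UnitAddTorus.mFourier k (![q.1, q.2, z] : T3)
      = (fourier (k 0) q.1 : ℂ) * (fourier (k 1) q.2 * fourier (k 2) z : ℂ) := fun q => by
    simp [UnitAddTorus.mFourier, Fin.prod_univ_three, mul_assoc]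
  simp only [h]
  rw [haarT2, integral_prod_mul (fun x : UnitAddCircle => (fourier (k 0) x : ℂ))
    (fun y : UnitAddCircle => (fourier (k 1) y * fourier (k 2) z : ℂ)),
    integral_mul_const, integral_fourier_eq, integral_fourier_eq, meanSym]
  by_cases h0 : k 0 = 0 <;> by_cases h1 : k 1 = 0 <;> simp [h0, h1]

lemma meanSym_mul_mFourier (k : Fin 3 → ℤ) (x : T3) :
    meanSym k * UnitAddTorus.mFourier k x = meanSym k * fourier (k 2) (x 2) := by
  by_cases h : k 0 = 0 ∧ k 1 = 0
  · simp [UnitAddTorus.mFourier, Fin.prod_univ_three, h.1, h.2]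
  · simp [meanSym, h]

lemma HasCoeff.perpMean {δ : ℝ} {φ : T3 → ℝ} {a : Coeffs} (h : HasCoeff δ φ a) :
    HasCoeff δ (fun x => DriftFluid.perpMean φ (x 2)) (meanSym * a) := by
  refine h.mul_of_le_one norm_meanSym_le fun x => ?_
  rw [perpMean_eq_integral h.continuous, ← integral_complex_ofReal]
  have hs := hasSum_integral_of_summable_integral_norm (μ := haarT2)
    (F := fun k q => a k * UnitAddTorus.mFourier k (![q.1, q.2, x 2] : T3))
    (fun k => integrable_haarT2
      (continuous_const.mul ((UnitAddTorus.mFourier k).continuous.comp (continuous_vec (x 2)))))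
    (by simpa [norm_mFourier_apply] using h.summable)
  simp only [h.eq]
  rw [synth]
  refine Eq.trans hs.tsum_eq.symm (tsum_congr fun k => ?_)
  rw [integral_const_mul, integral_mFourier_perp, ← meanSym_mul_mFourier, Pi.mul_apply]
  ring

lemma pd_two_comp (g : UnitAddCircle → ℝ) (x : T3) :
    pd 2 (fun y => g (y 2)) x = dPar g (x 2) := by
  simp [pd, dPar]

/-! ### The drift -/

/-- Subtracting the perpendicular average changes only the frequencies with k_⊥ = 0, where `lapSym`
is zero anyway. -/
lemma HasCoeff.potential {δ : ℝ} {ρ : T3 → ℝ} {r : Coeffs} (h : HasCoeff δ ρ r) :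
    HasCoeff δ (DriftFluid.potential ρ) (lapSym * r) := by
  refine h.mul_of_le_one norm_lapSym_le fun x => ?_
  have h1 := (h.sub h.perpMean).fourierC_eq
  rw [DriftFluid.potential, invLaplacePerp, h1, ← ofReal_re_synth (herm_lapSym.mul h.herm)]
  congr 2
  refine tsum_congr fun k => ?_
  simp only [Pi.sub_apply, Pi.mul_apply, lapSym, meanSym]
  by_cases hk : k 0 = 0 ∧ k 1 = 0
  · simp [hk.1, hk.2]
  · simp only [hk, if_false]
    ring

/-- The radius δ is kept although a derivative is taken, since the composite symbol with the inverse
Laplacian is bounded by 1. -/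
lemma HasCoeff.drift₁ {δ : ℝ} {ρ : T3 → ℝ} {r : Coeffs} (hδ : 1 < δ) (h : HasCoeff δ ρ r) :
    HasCoeff δ (DriftFluid.drift₁ ρ) (driftSym₁ * r) :=
  h.mul_of_le_one norm_driftSym₁_le fun x => by
    rw [DriftFluid.drift₁, h.potential.ofReal_pd hδ, driftSym₁, mul_assoc]

lemma HasCoeff.drift₂ {δ : ℝ} {ρ : T3 → ℝ} {r : Coeffs} (hδ : 1 < δ) (h : HasCoeff δ ρ r) :
    HasCoeff δ (DriftFluid.drift₂ ρ) (driftSym₂ * r) :=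
  h.mul_of_le_one norm_driftSym₂_le fun x => by
    rw [DriftFluid.drift₂, Complex.ofReal_neg, h.potential.ofReal_pd hδ, driftSym₂, neg_mul,
      mul_assoc, synth_neg]

/-- The drift is divergence free. -/
lemma pd_drift {δ : ℝ} (hδ : 1 < δ) {ρ : T3 → ℝ} {r : Coeffs} (h : HasCoeff δ ρ r) (x : T3) :
    pd 0 (drift₁ ρ) x + pd 1 (drift₂ ρ) x = 0 := by
  have h1 := (h.drift₁ hδ).ofReal_pd hδ 0 x
  have h2 := (h.drift₂ hδ).ofReal_pd hδ 1 x
  have h3 : dSym 1 * (driftSym₂ * r) = -(dSym 0 * (driftSym₁ * r)) := by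
    rw [driftSym₁, driftSym₂]; ring
  rw [h3, synth_neg, ← h1] at h2
  have h4 : pd 1 (drift₂ ρ) x = -pd 0 (drift₁ ρ) x := by exact_mod_cast h2
  rw [h4, add_neg_cancel]

/-- Absence of divergence turns the conservative form into transport along the drift, which acts as
a derivation on products. -/
lemma driftDiv_eq {δ : ℝ} (hδ : 1 < δ) {ρ f : T3 → ℝ} {r a : Coeffs} (h : HasCoeff δ ρ r)
    (hf : HasCoeff δ f a) (x : T3) :
    driftDiv ρ f x = drift₁ ρ x * pd 0 f x + drift₂ ρ x * pd 1 f x := by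
  rw [driftDiv, pd_mul hδ (h.drift₁ hδ) hf, pd_mul hδ (h.drift₂ hδ) hf]
  linear_combination f x * pd_drift hδ h x

/-- The coefficients of `∇_⊥ · (E^⊥ f)`. -/
def driftDivC (r a : Coeffs) : Coeffs :=
  dSym 0 * conv (driftSym₁ * r) a + dSym 1 * conv (driftSym₂ * r) a

lemma HasCoeff.driftDiv {δ δ' : ℝ} {ρ f : T3 → ℝ} {r a : Coeffs} (hδ : 1 ≤ δ') (hlt : δ' < δ)
    (h : HasCoeff δ ρ r) (hf : HasCoeff δ f a) :
    HasCoeff δ' (DriftFluid.driftDiv ρ f) (driftDivC r a) :=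
  (((h.drift₁ (hδ.trans_lt hlt)).mul hf).pd hδ hlt 0).add
    (((h.drift₂ (hδ.trans_lt hlt)).mul hf).pd hδ hlt 1)

/-- A perpendicular divergence averages to zero: ∂₁ and ∂₂ have vanishing symbols where `meanSym` is
supported. -/
lemma meanSym_mul_driftDivC (r a : Coeffs) : meanSym * driftDivC r a = 0 := by
  rw [driftDivC, mul_add, ← mul_assoc, ← mul_assoc, meanSym_mul_dSym_zero, meanSym_mul_dSym_one]
  simp

/-! ### Uniqueness in the scale of weighted spaces -/

/-- The ratio is 1 + 1/(n+1), so the power is below e. It is the price, after n steps, of replacing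
the gap by its fraction (n+1)/(n+2). -/
lemma ratio_pow_le (n : ℕ) : (((n : ℝ) + 2) / (n + 1)) ^ n ≤ 3 := by
  have h0 : ((n : ℝ) + 2) / (n + 1) = 1 / (n + 1) + 1 := by field_simp; ring
  have h1 : ((n : ℝ) + 2) / (n + 1) ≤ Real.exp (1 / (n + 1)) := by
    rw [h0]; exact Real.add_one_le_exp _
  calc (((n : ℝ) + 2) / (n + 1)) ^ n ≤ Real.exp (1 / (n + 1)) ^ n := by gcongr
    _ = Real.exp (n * (1 / (n + 1))) := (Real.exp_nat_mul _ n).symm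
    _ ≤ Real.exp 1 := by
        refine Real.exp_le_exp.mpr ?_
        rw [mul_one_div, div_le_one (by positivity)]
        linarith
    _ ≤ 3 := by linarith [Real.exp_one_lt_d9]

/-- A bound on the time derivative integrates to a bound on the coefficients. -/
lemma Bd.of_deriv {δ t₀ t₁ β : ℝ} {n : ℕ} {d G : ℝ → Coeffs} (hδ : 0 ≤ δ) (hβ : 0 ≤ β)
    (hd : ∀ t ∈ Icc t₀ t₁, ∀ k, HasDerivWithinAt (fun s => d s k) (G t k) (Icc t₀ t₁) t)
    (h0 : d t₀ = 0) (hG : ∀ t ∈ Icc t₀ t₁, Bd δ (G t) (β * (t - t₀) ^ n)) {t : ℝ}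
    (ht : t ∈ Icc t₀ t₁) : Bd δ (d t) (β * (t - t₀) ^ (n + 1) / (n + 1)) := by
  have htt : 0 ≤ t - t₀ := by linarith [ht.1]
  refine Bd.of_finset (by positivity) (fun s => ?_) hδ
  -- The phases of the coefficients at the final time t are frozen. The weighted norm at t then
  -- becomes the value of a fixed linear functional of d, to which the scalar mean value inequality
  -- applies.
  let θ : (Fin 3 → ℤ) → ℂ := fun k => (starRingEnd ℂ) (d t k) / ‖d t k‖
  have hθ : ∀ k, ‖θ k‖ ≤ 1 := fun k => by
    simp only [θ, norm_div, RCLike.norm_conj, Complex.norm_real, norm_norm]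
    exact div_self_le_one _
  have hθd : ∀ k, θ k * d t k = ‖d t k‖ := fun k => by
    rcases eq_or_ne (d t k) 0 with h | h
    · simp [h]
    · have : (‖d t k‖ : ℂ) ≠ 0 := by exact_mod_cast norm_ne_zero_iff.mpr h
      simp only [θ]
      rw [div_mul_eq_mul_div, Complex.conj_mul', pow_two, mul_div_assoc, div_self this, mul_one]
  let c : (Fin 3 → ℤ) → ℂ := fun k => θ k * ((δ ^ freqNorm k : ℝ) : ℂ)
  have hc : ∀ k, ‖c k‖ ≤ δ ^ freqNorm k := fun k => by
    have h1 : 0 ≤ δ ^ freqNorm k := by positivity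
    simp only [c, norm_mul, Complex.norm_real, Real.norm_of_nonneg h1]
    exact mul_le_of_le_one_left h1 (hθ k)
  have hf : ∀ τ ∈ Icc t₀ t₁, HasDerivWithinAt (fun τ => ∑ k ∈ s, c k * d τ k)
      (∑ k ∈ s, c k * G τ k) (Icc t₀ t₁) τ := fun τ hτ =>
    HasDerivWithinAt.fun_sum fun k _ => (hd τ hτ k).const_mul _
  have key := image_norm_le_of_norm_deriv_right_le_deriv_boundary'
    (f := fun τ => ∑ k ∈ s, c k * d τ k) (f' := fun τ => ∑ k ∈ s, c k * G τ k) (a := t₀) (b := t₁)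
    (fun τ hτ => (hf τ hτ).continuousWithinAt)
    (fun τ hτ => (hf τ (Ico_subset_Icc_self hτ)).mono_of_mem_nhdsWithin (Icc_mem_nhdsGE_of_mem hτ))
    (B := fun τ => β * (τ - t₀) ^ (n + 1) / (n + 1)) (B' := fun τ => β * (τ - t₀) ^ n)
    (by simp [h0]) (by fun_prop)
    (fun τ _ => by
      have h1 : HasDerivAt (fun τ : ℝ => β * (τ - t₀) ^ (n + 1) / (n + 1))
          (β * (((n + 1 : ℕ) : ℝ) * (τ - t₀) ^ n * 1) / (n + 1)) τ :=
        ((((hasDerivAt_id τ).sub_const t₀).pow (n + 1)).const_mul β).div_const _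
      have h2 : β * (((n + 1 : ℕ) : ℝ) * (τ - t₀) ^ n * 1) / (n + 1) = β * (τ - t₀) ^ n := by
        push_cast; field_simp
      rw [h2] at h1
      exact h1.hasDerivWithinAt)
    (fun τ hτ => by
      refine (norm_sum_le _ _).trans (le_trans ?_
        ((hG τ (Ico_subset_Icc_self hτ)).sum_le hδ s))
      refine Finset.sum_le_sum fun k _ => ?_
      rw [norm_mul, mul_comm]
      gcongr
      exact hc k)
    ht
  have h2 : ∑ k ∈ s, c k * d t k = ((∑ k ∈ s, ‖d t k‖ * δ ^ freqNorm k : ℝ) : ℂ) := by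
    push_cast
    refine Finset.sum_congr rfl fun k _ => ?_
    simp only [c]
    rw [← hθd]; ring
  simp only [h2, Complex.norm_real] at key
  exact (le_abs_self _).trans key

/-- The data of a pair of families of coefficients that solves a linear system
with a loss of one derivative. -/
structure LossSystem (δs L B t₀ t₁ : ℝ) (d₁ d₂ G₁ G₂ : ℝ → Coeffs) : Prop where
  one_lt : 1 < δs
  L_nonneg : 0 ≤ L
  deriv₁ : ∀ t ∈ Icc t₀ t₁, ∀ k, HasDerivWithinAt (fun s => d₁ s k) (G₁ t k) (Icc t₀ t₁) t
  deriv₂ : ∀ t ∈ Icc t₀ t₁, ∀ k, HasDerivWithinAt (fun s => d₂ s k) (G₂ t k) (Icc t₀ t₁) t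
  bound₁ : ∀ t ∈ Icc t₀ t₁, ∀ δ, 1 ≤ δ → δ < δs → Bd δ (d₁ t) B
  bound₂ : ∀ t ∈ Icc t₀ t₁, ∀ δ, 1 ≤ δ → δ < δs → Bd δ (d₂ t) B
  loss : ∀ t ∈ Icc t₀ t₁, ∀ δ δ' β, 1 ≤ δ → δ < δ' → δ' < δs → Bd δ' (d₁ t) β → Bd δ' (d₂ t) β →
    Bd δ (G₁ t) (L / (δ' - δ) * β) ∧ Bd δ (G₂ t) (L / (δ' - δ) * β)

namespace LossSystem

variable {δs L B t₀ t₁ : ℝ} {d₁ d₂ G₁ G₂ : ℝ → Coeffs}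

lemma mono (h : LossSystem δs L B t₀ t₁ d₁ d₂ G₁ G₂) {s₀ s₁ : ℝ} (hs : Icc s₀ s₁ ⊆ Icc t₀ t₁) :
    LossSystem δs L B s₀ s₁ d₁ d₂ G₁ G₂ where
  one_lt := h.one_lt
  L_nonneg := h.L_nonneg
  deriv₁ t ht k := (h.deriv₁ t (hs ht) k).mono hs
  deriv₂ t ht k := (h.deriv₂ t (hs ht) k).mono hs
  bound₁ t ht := h.bound₁ t (hs ht)
  bound₂ t ht := h.bound₂ t (hs ht)
  loss t ht := h.loss t (hs ht)

/-- Each round inserts the previous bound at a larger radius and integrates in time. The loss factor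
L(n+2)/(δs - δ) meets the 1/(n+1) gained by integrating t^n; their ratio is at most 2, and
`ratio_pow_le` gives 3, hence the 6. -/
lemma iterate (h : LossSystem δs L B t₀ t₁ d₁ d₂ G₁ G₂) (h₁ : d₁ t₀ = 0) (h₂ : d₂ t₀ = 0) (n : ℕ) :
    ∀ t ∈ Icc t₀ t₁, ∀ δ, 1 ≤ δ → δ < δs →
      Bd δ (d₁ t) (B * (6 * L * (t - t₀) / (δs - δ)) ^ n) ∧
      Bd δ (d₂ t) (B * (6 * L * (t - t₀) / (δs - δ)) ^ n) := by
  induction n with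
  | zero =>
    intro t ht δ hδ hlt
    simpa using ⟨h.bound₁ t ht δ hδ hlt, h.bound₂ t ht δ hδ hlt⟩
  | succ n ih =>
    intro t ht δ hδ hlt
    have hL := h.L_nonneg
    have hB : 0 ≤ B := (h.bound₁ t ht δ hδ hlt).1
    have hgap : 0 < δs - δ := by linarith
    have htt : 0 ≤ t - t₀ := by linarith [ht.1]
    -- Spending 1/(n+2) of the gap makes the loss grow only linearly in n, while the remaining gap
    -- raised to the power n changes by a bounded factor.
    set δ' := δ + (δs - δ) / (n + 2) with hδ'
    have h1 : δ' - δ = (δs - δ) / (n + 2) := by rw [hδ']; ring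
    have h2 : δs - δ' = (δs - δ) * ((n + 1) / (n + 2)) := by rw [hδ']; field_simp; ring
    have hlt1 : δ < δ' := by
      have : 0 < (δs - δ) / ((n : ℝ) + 2) := by positivity
      linarith
    have hlt2 : δ' < δs := by
      have : 0 < (δs - δ) * (((n : ℝ) + 1) / (n + 2)) := by positivity
      linarith
    set β := L * (n + 2) / (δs - δ) * (B * (6 * L / (δs - δ)) ^ n * 3) with hβ
    have hβ0 : 0 ≤ β := by positivity
    have hG : ∀ τ ∈ Icc t₀ t₁, Bd δ (G₁ τ) (β * (τ - t₀) ^ n) ∧ Bd δ (G₂ τ) (β * (τ - t₀) ^ n) := by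
      intro τ hτ
      have hττ : 0 ≤ τ - t₀ := by linarith [hτ.1]
      obtain ⟨i1, i2⟩ := ih τ hτ δ' (by linarith) hlt2
      obtain ⟨g1, g2⟩ := h.loss τ hτ δ δ' _ hδ hlt1 hlt2 i1 i2
      have hle : L / (δ' - δ) * (B * (6 * L * (τ - t₀) / (δs - δ')) ^ n) ≤ β * (τ - t₀) ^ n := by
        have e1 : L / (δ' - δ) = L * (n + 2) / (δs - δ) := by rw [h1]; field_simp
        have e2 : 6 * L * (τ - t₀) / (δs - δ')
            = 6 * L / (δs - δ) * (((n : ℝ) + 2) / (n + 1)) * (τ - t₀) := by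
          rw [h2]; field_simp
        rw [e1, e2, mul_pow, mul_pow, hβ]
        have := ratio_pow_le n
        calc L * (n + 2) / (δs - δ) * (B * ((6 * L / (δs - δ)) ^ n * (((n : ℝ) + 2) / (n + 1)) ^ n
              * (τ - t₀) ^ n))
            = L * (n + 2) / (δs - δ) * (B * (6 * L / (δs - δ)) ^ n * (((n : ℝ) + 2) / (n + 1)) ^ n)
              * (τ - t₀) ^ n := by ring
          _ ≤ _ := by gcongr
      exact ⟨g1.mono hle, g2.mono hle⟩
    have hfin : β * (t - t₀) ^ (n + 1) / (n + 1)
        ≤ B * (6 * L * (t - t₀) / (δs - δ)) ^ (n + 1) := by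
      have hr : ((n : ℝ) + 2) / (n + 1) ≤ 2 := by rw [div_le_iff₀ (by positivity)]; linarith
      have e1 : β * (t - t₀) ^ (n + 1) / (n + 1)
          = (((n : ℝ) + 2) / (n + 1)) * (3 * L / (δs - δ) * (B * (6 * L / (δs - δ)) ^ n)
            * (t - t₀) ^ (n + 1)) := by rw [hβ]; field_simp
      have e2 : B * (6 * L * (t - t₀) / (δs - δ)) ^ (n + 1)
          = 2 * (3 * L / (δs - δ) * (B * (6 * L / (δs - δ)) ^ n) * (t - t₀) ^ (n + 1)) := by
        rw [mul_div_right_comm, mul_pow, pow_succ (6 * L / (δs - δ))]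
        ring
      rw [e1, e2]
      gcongr
    exact ⟨(Bd.of_deriv (by linarith) hβ0 h.deriv₁ h₁ (fun τ hτ => (hG τ hτ).1) ht).mono hfin,
      (Bd.of_deriv (by linarith) hβ0 h.deriv₂ h₂ (fun τ hτ => (hG τ hτ).2) ht).mono hfin⟩

/-- The constant 12 makes the ratio in `iterate` at most 1/2 at radius 1, so letting n tend to
infinity kills every coefficient. -/
lemma eq_zero_of_short (h : LossSystem δs L B t₀ t₁ d₁ d₂ G₁ G₂) (h₁ : d₁ t₀ = 0) (h₂ : d₂ t₀ = 0)
    (hshort : 12 * L * (t₁ - t₀) ≤ δs - 1) : ∀ t ∈ Icc t₀ t₁, d₁ t = 0 ∧ d₂ t = 0 := by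
  intro t ht
  have hgap : 0 < δs - 1 := by linarith [h.one_lt]
  have hL := h.L_nonneg
  have htt : 0 ≤ t - t₀ := by linarith [ht.1]
  have hB : 0 ≤ B := (h.bound₁ t ht 1 le_rfl h.one_lt).1
  have hq : 6 * L * (t - t₀) / (δs - 1) ≤ 1 / 2 := by
    rw [div_le_iff₀ hgap]
    have : 12 * L * (t - t₀) ≤ 12 * L * (t₁ - t₀) := by gcongr; exact ht.2
    linarith
  have hlim : Tendsto (fun n : ℕ => B * (1 / 2 : ℝ) ^ n) atTop (𝓝 0) := by
    simpa using (tendsto_pow_atTop_nhds_zero_of_lt_one (by norm_num : (0:ℝ) ≤ 1/2)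
      (by norm_num)).const_mul B
  have hle : ∀ n : ℕ, B * (6 * L * (t - t₀) / (δs - 1)) ^ n ≤ B * (1 / 2) ^ n := fun n => by
    gcongr
  constructor
  · ext k
    have := ge_of_tendsto' hlim fun n =>
      (((h.iterate h₁ h₂ n t ht 1 le_rfl h.one_lt).1.mono (hle n)).norm_le le_rfl k)
    simpa using this
  · ext k
    have := ge_of_tendsto' hlim fun n =>
      (((h.iterate h₁ h₂ n t ht 1 le_rfl h.one_lt).2.mono (hle n)).norm_le le_rfl k)
    simpa using this

/-- A solution that vanishes initially vanishes identically. -/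
theorem eq_zero (h : LossSystem δs L B t₀ t₁ d₁ d₂ G₁ G₂) (h₁ : d₁ t₀ = 0) (h₂ : d₂ t₀ = 0) :
    ∀ t ∈ Icc t₀ t₁, d₁ t = 0 ∧ d₂ t = 0 := by
  have hgap : 0 < δs - 1 := by linarith [h.one_lt]
  have hL := h.L_nonneg
  -- Using L + 1 avoids a separate case L = 0.
  set τ := (δs - 1) / (12 * (L + 1)) with hτ
  have hτ0 : 0 < τ := by positivity
  have hLτ : 12 * L * τ ≤ δs - 1 := by
    have : 12 * (L + 1) * τ = δs - 1 := by rw [hτ]; field_simp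
    nlinarith
  -- The bound B holds for all radii below δs at every time, so restarting at t₀ + mτ consumes no
  -- radius and the step length stays τ.
  have key : ∀ m : ℕ, ∀ t ∈ Icc t₀ t₁, t ≤ t₀ + m * τ → d₁ t = 0 ∧ d₂ t = 0 := by
    intro m
    induction m with
    | zero =>
      intro t ht hm
      have : t = t₀ := le_antisymm (by simpa using hm) ht.1
      subst this
      exact ⟨h₁, h₂⟩
    | succ m ih =>
      intro t ht hm
      by_cases hc : t ≤ t₀ + m * τ
      · exact ih t ht hc
      push Not at hc
      have hs0 : t₀ + m * τ ∈ Icc t₀ t₁ := ⟨by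
        have : 0 ≤ m * τ := by positivity
        linarith, hc.le.trans ht.2⟩
      obtain ⟨z1, z2⟩ := ih _ hs0 le_rfl
      refine (h.mono (s₀ := t₀ + m * τ) (s₁ := t) (Icc_subset_Icc hs0.1 ht.2)).eq_zero_of_short
        z1 z2 ?_ t ⟨hc.le, le_rfl⟩
      refine le_trans ?_ hLτ
      gcongr
      push_cast at hm
      linarith
  intro t ht
  obtain ⟨m, hm⟩ := exists_nat_ge ((t - t₀) / τ)
  rw [div_le_iff₀ hτ0] at hm
  exact key m t ht (by linarith)

end LossSystem

/-! ### Differentiation under the integral sign -/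

/-- The mean value inequality on the convex set S bounds the difference quotients by C, and
dominated convergence applies to them. Neither continuity in time nor measurability of f' is
assumed, as suits equations that hold pointwise. -/
lemma hasDerivWithinAt_integral_of_bounded {X E : Type*} [MeasurableSpace X]
    [NormedAddCommGroup E] [NormedSpace ℝ E] {μ : Measure X} [IsFiniteMeasure μ] {S : Set ℝ}
    (hS : Convex ℝ S) {f f' : ℝ → X → E} {C : ℝ}
    (hf_int : ∀ s ∈ S, Integrable (f s) μ)
    (hd : ∀ s ∈ S, ∀ x, HasDerivWithinAt (fun s => f s x) (f' s x) S s)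
    (hb : ∀ s ∈ S, ∀ x, ‖f' s x‖ ≤ C) {t : ℝ} (ht : t ∈ S) :
    HasDerivWithinAt (fun s => ∫ x, f s x ∂μ) (∫ x, f' t x ∂μ) S t := by
  rw [hasDerivWithinAt_iff_tendsto_slope]
  have hmem : ∀ᶠ s in 𝓝[S \ {t}] t, s ∈ S \ {t} := self_mem_nhdsWithin
  have h1 : Tendsto (fun s => ∫ x, slope (fun s => f s x) t s ∂μ) (𝓝[S \ {t}] t)
      (𝓝 (∫ x, f' t x ∂μ)) := by
    refine tendsto_integral_filter_of_dominated_convergence (fun _ => C) ?_ ?_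
      (integrable_const C) (ae_of_all _ fun x => hasDerivWithinAt_iff_tendsto_slope.mp (hd t ht x))
    · filter_upwards [hmem] with s hs
      simp only [slope, vsub_eq_sub]
      exact (((hf_int s hs.1).sub (hf_int t ht)).smul ((s - t)⁻¹)).aestronglyMeasurable
    · filter_upwards [hmem] with s hs
      refine ae_of_all _ fun x => ?_
      have h2 := hS.norm_image_sub_le_of_norm_hasDerivWithin_le (fun s hs => hd s hs x)
        (fun s hs => hb s hs x) ht hs.1
      have h3 : 0 < ‖s - t‖ := norm_pos_iff.mpr (sub_ne_zero.mpr hs.2)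
      rw [slope, vsub_eq_sub, norm_smul, norm_inv, inv_mul_le_iff₀ h3, mul_comm]
      exact h2
  refine h1.congr' ?_
  filter_upwards [hmem] with s hs
  simp only [slope, vsub_eq_sub]
  rw [integral_smul, integral_sub (hf_int s hs.1) (hf_int t ht)]

lemma integrable_haarT3 {E : Type*} [NormedAddCommGroup E] {f : T3 → E} (hf : Continuous f) :
    Integrable f haarT3 :=
  hf.integrable_of_hasCompactSupport (HasCompactSupport.of_compactSpace _)

lemma hasDerivWithinAt_fourierC {S : Set ℝ} (hS : Convex ℝ S) {φ F : ℝ → T3 → ℝ} {C : ℝ}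
    (hφ : ∀ s ∈ S, Continuous (φ s))
    (hd : ∀ s ∈ S, ∀ x, HasDerivWithinAt (fun s => φ s x) (F s x) S s)
    (hb : ∀ s ∈ S, ∀ x, |F s x| ≤ C) {t : ℝ} (ht : t ∈ S) (k : Fin 3 → ℤ) :
    HasDerivWithinAt (fun s => fourierC (φ s) k) (fourierC (F t) k) S t := by
  simp only [fourierC_eq_integral]
  refine hasDerivWithinAt_integral_of_bounded (E := ℂ) (μ := haarT3) (C := C)
    (f := fun s x => UnitAddTorus.mFourier (-k) x * (φ s x : ℂ))
    (f' := fun s x => UnitAddTorus.mFourier (-k) x * (F s x : ℂ)) hS (fun s hs => ?_) (fun s hs x => ?_)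
    (fun s hs x => ?_) ht
  · have := hφ s hs
    exact integrable_haarT3 (by fun_prop)
  · exact ((hd s hs x).ofReal_comp).const_mul _
  · rw [norm_mul, norm_mFourier_apply, one_mul, Complex.norm_real]
    exact hb s hs x

/-! ### Averages of the nonlinear terms -/

section average

variable {δ : ℝ} {ρ v f g φ : T3 → ℝ} {r w a b : Coeffs}

lemma hasDerivAt_perpMean (hδ : 1 < δ) (h : HasCoeff δ φ a) (y : ℝ) :
    HasDerivAt (fun s : ℝ => perpMean φ (s : UnitAddCircle))
      (dPar (perpMean φ) (y : UnitAddCircle)) y := by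
  have h1 := h.perpMean.hasDerivAt hδ 2 ![0, 0, (y : UnitAddCircle)]
  rw [pd_two_comp] at h1
  have h2 : HasDerivAt (fun s : ℝ => perpMean φ ((y : UnitAddCircle) + (s : UnitAddCircle)))
      (dPar (perpMean φ) (y : UnitAddCircle)) (y - y) := by
    simpa using h1
  have h3 := h2.comp_sub_const y y
  refine h3.congr_of_eventuallyEq (Eventually.of_forall fun s => ?_)
  simp only
  rw [← AddCircle.coe_add]
  congr 2
  ring

lemma HasCoeff.dPar_perpMean {δ' : ℝ} (hδ : 1 ≤ δ') (hlt : δ' < δ) (h : HasCoeff δ φ a) :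
    HasCoeff δ' (fun x => dPar (DriftFluid.perpMean φ) (x 2)) (dSym 2 * (meanSym * a)) :=
  (h.perpMean.pd hδ hlt 2).congr (fun x => (pd_two_comp _ x).symm) rfl

/-- The perpendicular average of a divergence. -/
lemma perpMean_div (hδ : 1 < δ) (hρ : HasCoeff δ ρ r) (hf : HasCoeff δ f a) (hg : HasCoeff δ g b)
    (z : UnitAddCircle) :
    perpMean (fun x => -(driftDiv ρ f x + pd 2 g x)) z = -dPar (perpMean g) z := by
  have h1 := (((hρ.driftDiv le_rfl hδ hf).add (hg.pd le_rfl hδ 2)).neg).perpMean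
  have h2 := (hg.dPar_perpMean le_rfl hδ).neg
  have h3 : meanSym * -(driftDivC r a + dSym 2 * b) = -(dSym 2 * (meanSym * b)) := by
    linear_combination -meanSym_mul_driftDivC r a
  rw [h3] at h1
  simpa using congrFun (h1.ext h2) ![0, 0, z]

/-- The flux of momentum. -/
lemma momentum_flux (hδ : 1 < δ) (hρ : HasCoeff δ ρ r) (hv : HasCoeff δ v w) (x : T3) :
    -(driftDiv ρ ρ x + pd 2 (fun y => v y * ρ y) x) * v x
        + ρ x * -(driftDiv ρ v x + v x * pd 2 v x)
      = -(driftDiv ρ (fun y => ρ y * v y) x + pd 2 (fun y => ρ y * v y ^ 2) x) := by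
  have e1 : (fun y => ρ y * v y ^ 2) = fun y => ρ y * (v y * v y) := by ext y; ring
  rw [e1, driftDiv_eq hδ hρ hρ, driftDiv_eq hδ hρ hv, driftDiv_eq hδ hρ (hρ.mul hv),
    pd_mul hδ hv hρ, pd_mul hδ hρ hv, pd_mul hδ hρ hv, pd_mul hδ hρ (hv.mul hv), pd_mul hδ hv hv]
  ring

lemma HasCoeff.flux (hρ : HasCoeff δ ρ r) (hv : HasCoeff δ v w) :
    HasCoeff δ (fun y => ρ y * v y ^ 2) (conv r (conv w w)) :=
  (hρ.mul (hv.mul hv)).congr (fun y => by ring) rfl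

end average

/-! ### The coefficients of the right hand sides -/

/-- The coefficients of the right hand side of the continuity equation. -/
def rhsRho (r w : Coeffs) : Coeffs := -(driftDivC r r + dSym 2 * conv w r)

/-- The coefficients of `∇_⊥ · (E^⊥ v) + v ∂_∥ v`, with the opposite sign. -/
def rhsAdv (r w : Coeffs) : Coeffs := -(driftDivC r w + dSym 2 * ((1 / 2 : ℝ) : ℂ) • conv w w)

/-- The coefficients of `∂_∥ ∫ ρ v² dx_⊥`. -/
def rhsPress (r w : Coeffs) : Coeffs := dSym 2 * (meanSym * conv r (conv w w))

section rhs

variable {δ δ' : ℝ} {ρ v : T3 → ℝ} {r w : Coeffs}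

lemma HasCoeff.rhsRho (hδ : 1 ≤ δ') (hlt : δ' < δ) (hρ : HasCoeff δ ρ r) (hv : HasCoeff δ v w) :
    HasCoeff δ' (fun x => -(DriftFluid.driftDiv ρ ρ x + DriftFluid.pd 2 (fun y => v y * ρ y) x))
      (DriftFluid.rhsRho r w) :=
  ((hρ.driftDiv hδ hlt hρ).add ((hv.mul hρ).pd hδ hlt 2)).neg

lemma HasCoeff.rhsAdv (hδ : 1 ≤ δ') (hlt : δ' < δ) (hρ : HasCoeff δ ρ r) (hv : HasCoeff δ v w) :
    HasCoeff δ' (fun x => -(DriftFluid.driftDiv ρ v x + v x * DriftFluid.pd 2 v x))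
      (DriftFluid.rhsAdv r w) := by
  have h1 : 1 < δ := hδ.trans_lt hlt
  refine ((hρ.driftDiv hδ hlt hv).add (((hv.mul hv).const_mul (1 / 2)).pd hδ hlt 2)).neg.congr
    (fun x => ?_) rfl
  -- The identity v ∂_∥v = ½ ∂_∥(v²) puts the term in divergence form, so that a derivative acts on
  -- one convolution.
  have h2 : DriftFluid.pd 2 (fun y => 1 / 2 * (v y * v y)) x = v x * DriftFluid.pd 2 v x := by
    have h3 := ((hv.mul hv).hasDerivAt h1 2 x).const_mul (1 / 2 : ℝ)
    rw [pd_mul h1 hv hv] at h3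
    rw [DriftFluid.pd, h3.deriv]
    ring
  rw [h2]

lemma HasCoeff.rhsPress (hδ : 1 ≤ δ') (hlt : δ' < δ) (hρ : HasCoeff δ ρ r) (hv : HasCoeff δ v w) :
    HasCoeff δ' (fun x => dPar (DriftFluid.perpMean fun y => ρ y * v y ^ 2) (x 2))
      (DriftFluid.rhsPress r w) :=
  (hρ.flux hv).dPar_perpMean hδ hlt

end rhs

/-! ### Lipschitz estimates for the right hand sides, with loss of radius -/

section bounds

variable {δ δ' δs R β : ℝ} {r w r' w' a a' : Coeffs}

/-- Replacing δ by the fixed δs in the numerator makes the constant independent of the running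
radius, as `LossSystem` demands. -/
lemma Bd.dSym_mul' (ha : Bd δ' a β) (hδ : 1 ≤ δ) (hlt : δ < δ') (hs : δ ≤ δs) (i : Fin 3) :
    Bd δ (dSym i * a) (2 * Real.pi * δs / (δ' - δ) * β) := by
  refine (ha.dSym_mul hδ hlt i).mono ?_
  have := ha.1
  have : 0 < δ' - δ := by linarith
  have := Real.pi_pos
  gcongr

/-- Each of the two drift components contributes βR + Rβ by the product estimate, which gives 4Rβ in
total. -/
lemma Bd.driftDivC_sub (hδ : 1 ≤ δ) (hlt : δ < δ') (hs : δ ≤ δs)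
    (hr : Bd δ' r R) (ha : Bd δ' a R) (hr' : Bd δ' r' R) (ha' : Bd δ' a' R)
    (hdr : Bd δ' (r - r') β) (hda : Bd δ' (a - a') β) :
    Bd δ (driftDivC r a - driftDivC r' a') (2 * Real.pi * δs / (δ' - δ) * (4 * R * β)) := by
  have hδ' : 1 ≤ δ' := by linarith
  have key : ∀ m : Coeffs, (∀ k, ‖m k‖ ≤ 1) → Bd δ' (conv (m * r) a - conv (m * r') a')
      (β * R + R * β) := fun m hm =>
    Bd.conv_sub_conv hδ' (hr'.mul_of_le_one hm) ha (hr.mul_of_le_one hm) ha'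
      (by rw [← mul_sub]; exact hdr.mul_of_le_one hm) hda
  have h1 := (key _ norm_driftSym₁_le).dSym_mul' hδ hlt hs 0
  have h2 := (key _ norm_driftSym₂_le).dSym_mul' hδ hlt hs 1
  have h3 : driftDivC r a - driftDivC r' a'
      = dSym 0 * (conv (driftSym₁ * r) a - conv (driftSym₁ * r') a')
        + dSym 1 * (conv (driftSym₂ * r) a - conv (driftSym₂ * r') a') := by
    rw [driftDivC, driftDivC]; ring
  rw [h3]
  exact (h1.add h2).mono (le_of_eq (by ring))

lemma Bd.rhsRho_sub (hδ : 1 ≤ δ) (hlt : δ < δ') (hs : δ ≤ δs)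
    (hr : Bd δ' r R) (hw : Bd δ' w R) (hr' : Bd δ' r' R) (hw' : Bd δ' w' R)
    (hdr : Bd δ' (r - r') β) (hdw : Bd δ' (w - w') β) :
    Bd δ (rhsRho r w - rhsRho r' w') (2 * Real.pi * δs / (δ' - δ) * (6 * R * β)) := by
  have hδ' : 1 ≤ δ' := by linarith
  have h1 := Bd.driftDivC_sub hδ hlt hs hr hr hr' hr' hdr hdr
  have h2 := (Bd.conv_sub_conv hδ' hw' hr hw hr' hdw hdr).dSym_mul' hδ hlt hs 2
  have h3 : rhsRho r w - rhsRho r' w' = -((driftDivC r r - driftDivC r' r')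
      + dSym 2 * (conv w r - conv w' r')) := by
    rw [rhsRho, rhsRho]; ring
  rw [h3]
  exact (h1.add h2).neg.mono (le_of_eq (by ring))

lemma Bd.rhsAdv_sub (hδ : 1 ≤ δ) (hlt : δ < δ') (hs : δ ≤ δs)
    (hr : Bd δ' r R) (hw : Bd δ' w R) (hr' : Bd δ' r' R) (hw' : Bd δ' w' R)
    (hdr : Bd δ' (r - r') β) (hdw : Bd δ' (w - w') β) :
    Bd δ (rhsAdv r w - rhsAdv r' w') (2 * Real.pi * δs / (δ' - δ) * (5 * R * β)) := by
  have hδ' : 1 ≤ δ' := by linarith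
  have h1 := Bd.driftDivC_sub hδ hlt hs hr hw hr' hw' hdr hdw
  have h2 := ((Bd.conv_sub_conv hδ' hw' hw hw hw' hdw hdw).smul ((1 / 2 : ℝ) : ℂ)).dSym_mul'
    hδ hlt hs 2
  have h3 : rhsAdv r w - rhsAdv r' w' = -((driftDivC r w - driftDivC r' w')
      + dSym 2 * ((1 / 2 : ℝ) : ℂ) • (conv w w - conv w' w')) := by
    rw [rhsAdv, rhsAdv, smul_sub]; ring
  rw [h3]
  refine (h1.add h2).neg.mono (le_of_eq ?_)
  rw [Complex.norm_real, Real.norm_of_nonneg (by norm_num)]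
  ring

lemma Bd.rhsPress_sub (hδ : 1 ≤ δ) (hlt : δ < δ') (hs : δ ≤ δs)
    (hr : Bd δ' r R) (hw : Bd δ' w R) (hr' : Bd δ' r' R) (hw' : Bd δ' w' R)
    (hdr : Bd δ' (r - r') β) (hdw : Bd δ' (w - w') β) :
    Bd δ (rhsPress r w - rhsPress r' w') (2 * Real.pi * δs / (δ' - δ) * (3 * R ^ 2 * β)) := by
  have hδ' : 1 ≤ δ' := by linarith
  have h1 := Bd.conv_sub_conv hδ' hw' hw hw hw' hdw hdw
  have h2 : Bd δ' (conv r (conv w w) - conv r' (conv w' w')) (3 * R ^ 2 * β) := by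
    -- Telescoping the cubic term changes one factor at a time: R²β from the density and 2R²β from
    -- the two velocities.
    have e : conv r (conv w w) - conv r' (conv w' w')
        = conv (r - r') (conv w w)
          + conv r' (conv w w - conv w' w') := by
      have sr := summable_norm_of_wnorm hδ' hr.ne_top
      have sr' := summable_norm_of_wnorm hδ' hr'.ne_top
      have sw := summable_norm_of_wnorm hδ' (hw.convolve hδ' hw).ne_top
      have sw' := summable_norm_of_wnorm hδ' (hw'.convolve hδ' hw').ne_top
      rw [conv_sub_left sr sr' sw, conv_sub_right sr' sw sw']
      abel
    rw [e]
    exact ((hdr.convolve hδ' (hw.convolve hδ' hw)).add (hr'.convolve hδ' h1)).mono (le_of_eq (by ring))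
  have h3 := (h2.mul_of_le_one norm_meanSym_le).dSym_mul' hδ hlt hs 2
  have h4 : rhsPress r w - rhsPress r' w'
      = dSym 2 * (meanSym * (conv r (conv w w) - conv r' (conv w' w'))) := by
    rw [rhsPress, rhsPress]; ring
  rw [h4]
  exact h3

lemma conv_zero_right (a : Coeffs) : conv a 0 = 0 := by ext n; simp [conv]

/-- This is the Lipschitz estimate against the zero state, with β = R. -/
lemma Bd.rhsRho_bound (hδ : 1 ≤ δ) (hlt : δ < δ') (hr : Bd δ' r R) (hw : Bd δ' w R) :
    Bd δ (rhsRho r w) (2 * Real.pi * δ / (δ' - δ) * (6 * R * R)) := by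
  have h0 : Bd δ' 0 R := Bd.zero hr.1
  have := Bd.rhsRho_sub hδ hlt le_rfl hr hw h0 h0 (β := R) (by simpa using hr) (by simpa using hw)
  simpa [rhsRho, driftDivC, conv_zero_right] using this

lemma Bd.rhsAdv_bound (hδ : 1 ≤ δ) (hlt : δ < δ') (hr : Bd δ' r R) (hw : Bd δ' w R) :
    Bd δ (rhsAdv r w) (2 * Real.pi * δ / (δ' - δ) * (5 * R * R)) := by
  have h0 : Bd δ' 0 R := Bd.zero hr.1
  have := Bd.rhsAdv_sub hδ hlt le_rfl hr hw h0 h0 (β := R) (by simpa using hr) (by simpa using hw)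
  simpa [rhsAdv, driftDivC, conv_zero_right] using this

lemma Bd.rhsPress_bound (hδ : 1 ≤ δ) (hlt : δ < δ') (hr : Bd δ' r R) (hw : Bd δ' w R) :
    Bd δ (rhsPress r w) (2 * Real.pi * δ / (δ' - δ) * (3 * R ^ 2 * R)) := by
  have h0 : Bd δ' 0 R := Bd.zero hr.1
  have := Bd.rhsPress_sub hδ hlt le_rfl hr hw h0 h0 (β := R) (by simpa using hr) (by simpa using hw)
  simpa [rhsPress, conv_zero_right] using this

end bounds

/-! ### Solutions on a compact time interval -/

/-- A solution on `[0, T]` of the equations for `ρ` and `v` with force `-q(t, x_∥)`, bounded by `R`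
in `B_δ`; `r` and `w` are the coefficients of `ρ` and `v`. -/
structure RegSol (δ R T : ℝ) (ρ v : ℝ → T3 → ℝ) (r w : ℝ → Coeffs)
    (q : ℝ → UnitAddCircle → ℝ) : Prop where
  one_lt : 1 < δ
  rho : ∀ t ∈ Icc 0 T, HasCoeff δ (ρ t) (r t)
  vel : ∀ t ∈ Icc 0 T, HasCoeff δ (v t) (w t)
  bd_rho : ∀ t ∈ Icc 0 T, Bd δ (r t) R
  bd_vel : ∀ t ∈ Icc 0 T, Bd δ (w t) R
  eq_rho : ∀ t ∈ Icc 0 T, ∀ x : T3, HasDerivWithinAt (fun s => ρ s x)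
    (-(driftDiv (ρ t) (ρ t) x + pd 2 (fun y => v t y * ρ t y) x)) (Icc 0 T) t
  eq_vel : ∀ t ∈ Icc 0 T, ∀ x : T3, HasDerivWithinAt (fun s => v s x)
    (-(driftDiv (ρ t) (v t) x + v t x * pd 2 (v t) x) - q t (x 2)) (Icc 0 T) t

/-- The pressure law `-∂_∥ p = ∂_∥ ∫ ρ v² dx_⊥`, with `q = ∂_∥ p`. -/
def PressureLaw (T : ℝ) (ρ v : ℝ → T3 → ℝ) (q : ℝ → UnitAddCircle → ℝ) : Prop :=
  ∀ t ∈ Icc 0 T, ∀ z, -q t z = dPar (perpMean fun x => ρ t x * v t x ^ 2) z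

namespace RegSol

variable {δ R T : ℝ} {ρ v ρ' v' : ℝ → T3 → ℝ} {r w r' w' : ℝ → Coeffs}
  {q q' : ℝ → UnitAddCircle → ℝ}

lemma exists_bound_rho (h : RegSol δ R T ρ v r w q) : ∃ C, ∀ t ∈ Icc 0 T, ∀ x,
    |-(driftDiv (ρ t) (ρ t) x + pd 2 (fun y => v t y * ρ t y) x)| ≤ C :=
  ⟨_, fun t ht x => ((h.rho t ht).rhsRho le_rfl h.one_lt (h.vel t ht)).abs_le
    (Bd.rhsRho_bound le_rfl h.one_lt (h.bd_rho t ht) (h.bd_vel t ht)) x⟩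

lemma exists_bound_adv (h : RegSol δ R T ρ v r w q) : ∃ C, ∀ t ∈ Icc 0 T, ∀ x,
    |-(driftDiv (ρ t) (v t) x + v t x * pd 2 (v t) x)| ≤ C :=
  ⟨_, fun t ht x => ((h.rho t ht).rhsAdv le_rfl h.one_lt (h.vel t ht)).abs_le
    (Bd.rhsAdv_bound le_rfl h.one_lt (h.bd_rho t ht) (h.bd_vel t ht)) x⟩

/-- `RegSol` imposes no bound on q. The pressure law supplies one that is uniform in time, and it
dominates the force when coefficients are differentiated. -/
lemma exists_bound_press (h : RegSol δ R T ρ v r w q) (hq : PressureLaw T ρ v q) :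
    ∃ C, ∀ t ∈ Icc 0 T, ∀ z, |q t z| ≤ C :=
  ⟨_, fun t ht z => by
    have := ((h.rho t ht).rhsPress le_rfl h.one_lt (h.vel t ht)).abs_le
      (Bd.rhsPress_bound le_rfl h.one_lt (h.bd_rho t ht) (h.bd_vel t ht)) ![0, 0, z]
    simp only [Matrix.cons_val] at this
    rwa [← hq t ht z, abs_neg] at this⟩

lemma deriv_coeff_rho (h : RegSol δ R T ρ v r w q) :
    ∀ t ∈ Icc 0 T, ∀ k, HasDerivWithinAt (fun s => r s k) (rhsRho (r t) (w t) k) (Icc 0 T) t := by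
  intro t ht k
  obtain ⟨C, hC⟩ := h.exists_bound_rho
  have h1 := hasDerivWithinAt_fourierC (convex_Icc 0 T) (fun s hs => (h.rho s hs).continuous)
    h.eq_rho hC ht k
  rw [((h.rho t ht).rhsRho le_rfl h.one_lt (h.vel t ht)).fourierC_eq] at h1
  exact h1.congr_of_mem (fun s hs => by rw [(h.rho s hs).fourierC_eq]) ht

lemma rhs_vel_hasCoeff (h : RegSol δ R T ρ v r w q) (hq : PressureLaw T ρ v q) {t : ℝ}
    (ht : t ∈ Icc 0 T) :
    HasCoeff 1 (fun x => -(driftDiv (ρ t) (v t) x + v t x * pd 2 (v t) x) - q t (x 2))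
      (rhsAdv (r t) (w t) + rhsPress (r t) (w t)) :=
  (((h.rho t ht).rhsAdv le_rfl h.one_lt (h.vel t ht)).add
    ((h.rho t ht).rhsPress le_rfl h.one_lt (h.vel t ht))).congr
      (fun x => by rw [← hq t ht]; ring) rfl

lemma deriv_coeff_vel (h : RegSol δ R T ρ v r w q) (hq : PressureLaw T ρ v q) :
    ∀ t ∈ Icc 0 T, ∀ k, HasDerivWithinAt (fun s => w s k)
      ((rhsAdv (r t) (w t) + rhsPress (r t) (w t)) k) (Icc 0 T) t := by
  intro t ht k
  obtain ⟨C, hC⟩ := h.exists_bound_adv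
  obtain ⟨C', hC'⟩ := h.exists_bound_press hq
  have h1 := hasDerivWithinAt_fourierC (convex_Icc 0 T) (fun s hs => (h.vel s hs).continuous)
    h.eq_vel (C := C + C')
    (fun s hs x => (abs_sub _ _).trans (add_le_add (hC s hs x) (hC' s hs (x 2)))) ht k
  rw [(h.rhs_vel_hasCoeff hq ht).fourierC_eq] at h1
  exact h1.congr_of_mem (fun s hs => by rw [(h.vel s hs).fourierC_eq]) ht

/-- Uniqueness for the system with the pressure law. -/
theorem unique (h : RegSol δ R T ρ v r w q) (hq : PressureLaw T ρ v q)
    (h' : RegSol δ R T ρ' v' r' w' q') (hq' : PressureLaw T ρ' v' q')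
    (hρ : ρ 0 = ρ' 0) (hv : v 0 = v' 0) :
    ∀ t ∈ Icc 0 T, ρ t = ρ' t ∧ v t = v' t := by
  intro t ht
  have h0 : (0 : ℝ) ∈ Icc 0 T := ⟨le_rfl, ht.1.trans ht.2⟩
  have hδ := h.one_lt
  have hR : 0 ≤ R := (h.bd_rho 0 h0).1
  have hpi := Real.pi_pos
  -- The density equation has Lipschitz factor 6R and the velocity equation 5R + 3R²; the constant
  -- dominates both.
  have sys : LossSystem δ (2 * Real.pi * δ * (6 * R + 3 * R ^ 2)) (R + R) 0 T
      (fun t => r t - r' t) (fun t => w t - w' t)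
      (fun t => rhsRho (r t) (w t) - rhsRho (r' t) (w' t))
      (fun t => (rhsAdv (r t) (w t) + rhsPress (r t) (w t))
        - (rhsAdv (r' t) (w' t) + rhsPress (r' t) (w' t))) :=
    { one_lt := hδ
      L_nonneg := by positivity
      deriv₁ := fun t ht k => (h.deriv_coeff_rho t ht k).sub (h'.deriv_coeff_rho t ht k)
      deriv₂ := fun t ht k => (h.deriv_coeff_vel hq t ht k).sub (h'.deriv_coeff_vel hq' t ht k)
      bound₁ := fun t ht δ' h1 hlt =>
        ((h.bd_rho t ht).sub (h'.bd_rho t ht)).mono_radius h1 hlt.le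
      bound₂ := fun t ht δ' h1 hlt =>
        ((h.bd_vel t ht).sub (h'.bd_vel t ht)).mono_radius h1 hlt.le
      loss := fun t ht δ₁ δ₂ β h1 h12 h2 b1 b2 => by
        have m2 : 1 ≤ δ₂ := by linarith
        have hr := (h.bd_rho t ht).mono_radius m2 h2.le
        have hw := (h.bd_vel t ht).mono_radius m2 h2.le
        have hr' := (h'.bd_rho t ht).mono_radius m2 h2.le
        have hw' := (h'.bd_vel t ht).mono_radius m2 h2.le
        have hs : δ₁ ≤ δ := by linarith
        have e1 := Bd.rhsRho_sub h1 h12 hs hr hw hr' hw' b1 b2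
        have e2 := Bd.rhsAdv_sub h1 h12 hs hr hw hr' hw' b1 b2
        have e3 := Bd.rhsPress_sub h1 h12 hs hr hw hr' hw' b1 b2
        have hβ := b1.1
        have hgap : 0 < δ₂ - δ₁ := by linarith
        have hK : 0 ≤ 2 * Real.pi * δ / (δ₂ - δ₁) := by positivity
        have eK : ∀ c : ℝ, 2 * Real.pi * δ * c / (δ₂ - δ₁) * β
            = 2 * Real.pi * δ / (δ₂ - δ₁) * (c * β) := fun c => by ring
        refine ⟨e1.mono ?_, ?_⟩
        · rw [eK]
          refine mul_le_mul_of_nonneg_left ?_ hK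
          nlinarith [mul_nonneg (sq_nonneg R) hβ]
        · rw [add_sub_add_comm]
          refine (e2.add e3).mono ?_
          rw [eK, ← mul_add]
          refine mul_le_mul_of_nonneg_left ?_ hK
          nlinarith [mul_nonneg hR hβ] }
  have init : ∀ {f f' : ℝ → T3 → ℝ} {a a' : ℝ → Coeffs}, HasCoeff δ (f 0) (a 0) →
      HasCoeff δ (f' 0) (a' 0) → f 0 = f' 0 → a 0 - a' 0 = 0 := fun hf hf' e => by
    rw [← e] at hf'
    rw [hf.unique hf', sub_self]
  obtain ⟨z1, z2⟩ := sys.eq_zero (init (h.rho 0 h0) (h'.rho 0 h0) hρ)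
    (init (h.vel 0 h0) (h'.vel 0 h0) hv) t ht
  refine ⟨(h.rho t ht).ext (sub_eq_zero.mp z1 ▸ h'.rho t ht),
    (h.vel t ht).ext (sub_eq_zero.mp z2 ▸ h'.vel t ht)⟩

end RegSol

/-! ### Propagation of the constraint -/

/-- The coefficients of the constant function `1`. -/
def oneC : Coeffs := Pi.single 0 1

lemma hasCoeff_one {δ : ℝ} (hδ : 1 ≤ δ) : HasCoeff δ (fun _ => 1) oneC := by
  refine ⟨hδ, ?_, fun x => ?_⟩
  · rw [wnorm, tsum_eq_single 0 fun k hk => by simp [oneC, hk]]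
    simp [oneC, weight]
  · rw [synth, tsum_eq_single 0 fun k hk => by simp [oneC, hk]]
    simp [oneC, UnitAddTorus.mFourier_zero]

lemma conv_oneC (a : Coeffs) : conv oneC a = a := by
  ext n
  rw [conv, tsum_eq_single n fun l hl => by
    simp [oneC, sub_eq_zero, hl.symm]]
  simp [oneC]

namespace RegSol

variable {δ R T : ℝ} {ρ v : ℝ → T3 → ℝ} {r w : ℝ → Coeffs} {q : ℝ → UnitAddCircle → ℝ}

/-- The product rule and `momentum_flux` give the balance of ρv. The force stays multiplied by ρ,
because the constraint is not available yet. -/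
lemma deriv_coeff_momentum (h : RegSol δ R T ρ v r w q) (hq : PressureLaw T ρ v q) :
    ∀ t ∈ Icc 0 T, ∀ k, HasDerivWithinAt (fun s => conv (w s) (r s) k)
      ((-(driftDivC (r t) (conv (r t) (w t)) + dSym 2 * conv (r t) (conv (w t) (w t)))
        + conv (r t) (rhsPress (r t) (w t))) k) (Icc 0 T) t := by
  intro t ht k
  have hδ := h.one_lt
  obtain ⟨C₁, hC₁⟩ := h.exists_bound_rho
  obtain ⟨C₂, hC₂⟩ := h.exists_bound_adv
  obtain ⟨C₃, hC₃⟩ := h.exists_bound_press hq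
  have hR : 0 ≤ R := (h.bd_rho t ht).1
  have h1 := hasDerivWithinAt_fourierC (convex_Icc 0 T) (φ := fun s x => v s x * ρ s x)
    (fun s hs => ((h.vel s hs).mul (h.rho s hs)).continuous)
    (fun s hs x => (h.eq_vel s hs x).fun_mul (h.eq_rho s hs x)) (C := (C₂ + C₃) * R + R * C₁)
    (fun s hs x => by
      have a1 := (h.rho s hs).abs_le (h.bd_rho s hs) x
      have a2 := (h.vel s hs).abs_le (h.bd_vel s hs) x
      refine (abs_add_le _ _).trans (add_le_add ?_ ?_)
      · rw [abs_mul]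
        exact mul_le_mul ((abs_sub _ _).trans (add_le_add (hC₂ s hs x) (hC₃ s hs (x 2)))) a1
          (abs_nonneg _) (add_nonneg ((abs_nonneg _).trans (hC₂ s hs x))
            ((abs_nonneg _).trans (hC₃ s hs (x 2))))
      · rw [abs_mul]
        exact mul_le_mul a2 (hC₁ s hs x) (abs_nonneg _) hR) ht k
  have hρ := h.rho t ht
  have hv := h.vel t ht
  have h2 : HasCoeff 1 (fun x => (-(driftDiv (ρ t) (v t) x + v t x * pd 2 (v t) x) - q t (x 2))
      * ρ t x + v t x * -(driftDiv (ρ t) (ρ t) x + pd 2 (fun y => v t y * ρ t y) x))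
      (-(driftDivC (r t) (conv (r t) (w t)) + dSym 2 * conv (r t) (conv (w t) (w t)))
        + conv (r t) (rhsPress (r t) (w t))) :=
    ((((hρ.driftDiv le_rfl hδ (hρ.mul hv)).add ((hρ.flux hv).pd le_rfl hδ 2)).neg).add
      ((hρ.mono le_rfl hδ.le).mul (hρ.rhsPress le_rfl hδ hv))).congr (fun x => by
        rw [← momentum_flux hδ hρ hv x, ← hq t ht]
        ring) rfl
  rw [h2.fourierC_eq] at h1
  exact h1.congr_of_mem (fun s hs => by rw [((h.vel s hs).mul (h.rho s hs)).fourierC_eq]) ht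

/-- The pressure law preserves the constraint. -/
theorem perpMean_eq_one (h : RegSol δ R T ρ v r w q) (hq : PressureLaw T ρ v q)
    (hmean : ∀ z, perpMean (ρ 0) z = 1)
    (hcurrent : ∀ z, dPar (perpMean fun x => ρ 0 x * v 0 x) z = 0) :
    ∀ t ∈ Icc 0 T, ∀ z, perpMean (ρ t) z = 1 := by
  intro t ht z
  have h0 : (0 : ℝ) ∈ Icc 0 T := ⟨le_rfl, ht.1.trans ht.2⟩
  have hδ := h.one_lt
  have hR : 0 ≤ R := (h.bd_rho 0 h0).1
  have hpi := Real.pi_pos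
  have hone := hasCoeff_one hδ.le
  have hcur : dSym 2 * (meanSym * conv (w 0) (r 0)) = 0 := by
    have h1 := ((h.vel 0 h0).mul (h.rho 0 h0)).dPar_perpMean le_rfl hδ
    have h2 : HasCoeff 1 (fun _ : T3 => (0 : ℝ)) 0 :=
      ⟨le_rfl, by simp [wnorm_zero], fun x => by simp [synth]⟩
    refine h1.unique (h2.congr (fun x => ?_) rfl)
    simpa only [mul_comm] using hcurrent (x 2)
  -- After averaging, the pair closes linearly: the average density is driven by -∂_∥ of the average
  -- current, from which the initial current may be subtracted as its ∂_∥ vanishes, and the average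
  -- current is driven by the density defect times the known ∂_∥∫ρv² dx_⊥.
  have sys : LossSystem δ (2 * Real.pi * δ * (1 + R ^ 3))
      (R + (wnorm δ oneC).toReal + (R * R + R * R)) 0 T
      (fun t => meanSym * r t - oneC)
      (fun t => meanSym * conv (w t) (r t) - meanSym * conv (w 0) (r 0))
      (fun t => -(dSym 2 * (meanSym * conv (w t) (r t) - meanSym * conv (w 0) (r 0))))
      (fun t => conv (meanSym * r t - oneC) (rhsPress (r t) (w t))) :=
    { one_lt := hδ
      L_nonneg := by positivity
      deriv₁ := fun t ht k => by
        have h1 := ((h.deriv_coeff_rho t ht k).const_mul (meanSym k)).sub_const (oneC k)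
        have h2 : meanSym * rhsRho (r t) (w t)
            = -(dSym 2 * (meanSym * conv (w t) (r t) - meanSym * conv (w 0) (r 0))) := by
          rw [rhsRho]
          linear_combination -meanSym_mul_driftDivC (r t) (r t) - hcur
        have h3 := congrFun h2 k
        rw [← h3]
        exact h1
      deriv₂ := fun t ht k => by
        have h1 := ((h.deriv_coeff_momentum hq t ht k).const_mul (meanSym k)).sub_const
          (meanSym k * conv (w 0) (r 0) k)
        -- The force depends on x_∥ alone. Written as an average it fits `meanSym_mul_conv`, so
        -- averaging ρ times the force only averages ρ.
        have hb : rhsPress (r t) (w t)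
            = meanSym * (dSym 2 * conv (r t) (conv (w t) (w t))) := by rw [rhsPress]; ring
        have h2 : meanSym * (-(driftDivC (r t) (conv (r t) (w t))
              + dSym 2 * conv (r t) (conv (w t) (w t))) + conv (r t) (rhsPress (r t) (w t)))
            = conv (meanSym * r t - oneC) (rhsPress (r t) (w t)) := by
          have s1 := ((h.rho t ht).perpMean).summable
          have s3 := ((h.rho t ht).rhsPress le_rfl hδ (h.vel t ht)).summable
          rw [conv_sub_left s1 hone.summable s3, conv_oneC]
          have e := meanSym_mul_conv (r t) (dSym 2 * conv (r t) (conv (w t) (w t)))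
          rw [← hb] at e
          linear_combination e - meanSym_mul_driftDivC (r t) (conv (r t) (w t)) + hb
        have h3 := congrFun h2 k
        rw [← h3]
        exact h1
      bound₁ := fun t ht δ' h1 hlt => by
        refine ((((h.bd_rho t ht).mul_of_le_one norm_meanSym_le).sub
          (Bd.of_ne_top hone.ne_top)).mono_radius h1 hlt.le).mono ?_
        nlinarith
      bound₂ := fun t ht δ' h1 hlt => by
        refine (((((h.bd_vel t ht).convolve hδ.le (h.bd_rho t ht)).mul_of_le_one
          norm_meanSym_le).sub (((h.bd_vel 0 h0).convolve hδ.le (h.bd_rho 0 h0)).mul_of_le_one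
          norm_meanSym_le)).mono_radius h1 hlt.le).mono ?_
        have : 0 ≤ (wnorm δ oneC).toReal := ENNReal.toReal_nonneg
        linarith
      loss := fun t ht δ₁ δ₂ β h1 h12 h2 b1 b2 => by
        have m2 : 1 ≤ δ₂ := by linarith
        have hs : δ₁ ≤ δ := by linarith
        have hr := (h.bd_rho t ht).mono_radius m2 h2.le
        have hw := (h.bd_vel t ht).mono_radius m2 h2.le
        have hβ := b1.1
        have hgap : 0 < δ₂ - δ₁ := by linarith
        have hK : 0 ≤ 2 * Real.pi * δ / (δ₂ - δ₁) := by positivity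
        have eK : ∀ c : ℝ, 2 * Real.pi * δ * c / (δ₂ - δ₁) * β
            = 2 * Real.pi * δ / (δ₂ - δ₁) * (c * β) := fun c => by ring
        constructor
        · refine (b2.dSym_mul' h1 h12 hs 2).neg.mono ?_
          rw [eK]
          refine mul_le_mul_of_nonneg_left ?_ hK
          nlinarith [mul_nonneg (pow_nonneg hR 3) hβ]
        -- The unknown carries no derivative here; the factor 1/(δ₂ - δ₁) comes from the derivative
        -- in the known force.
        · have e := ((hr.convolve m2 (hw.convolve m2 hw)).mul_of_le_one
            norm_meanSym_le).dSym_mul' h1 h12 hs 2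
          refine ((b1.mono_radius h1 h12.le).convolve h1 e).mono ?_
          have : β * (2 * Real.pi * δ / (δ₂ - δ₁) * (R * (R * R)))
              = 2 * Real.pi * δ / (δ₂ - δ₁) * (R ^ 3 * β) := by ring
          rw [this, eK]
          refine mul_le_mul_of_nonneg_left ?_ hK
          nlinarith }
  have z1 := (sys.eq_zero (by
    have := ((h.rho 0 h0).perpMean).congr (ψ := fun _ => 1) (fun x => (hmean (x 2)).symm) rfl
    rw [sub_eq_zero]
    exact this.unique hone) (by simp) t ht).1
  have h2 := ((h.rho t ht).perpMean).ext (sub_eq_zero.mp z1 ▸ hone)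
  simpa using congrFun h2 ![0, 0, z]

end RegSol

/-! ### Determination of the pressure -/

/-- Derivatives and bounds are required only on the slice x_∥ = z. This permits integrands built
with a reference point that depends on z. -/
lemma deriv_perpMean_eq {S : Set ℝ} (hS : Convex ℝ S) {f f' : ℝ → T3 → ℝ} {C : ℝ}
    (hf : ∀ s ∈ S, Continuous (f s))
    {z : UnitAddCircle}
    (hd : ∀ s ∈ S, ∀ x : T3, x 2 = z → HasDerivWithinAt (fun s => f s x) (f' s x) S s)
    (hb : ∀ s ∈ S, ∀ x : T3, x 2 = z → |f' s x| ≤ C) {t : ℝ} (ht : t ∈ S)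
    (hf' : Continuous (f' t)) :
    HasDerivWithinAt (fun s => perpMean (f s) z) (perpMean (f' t) z) S t := by
  have h1 := hasDerivWithinAt_integral_of_bounded (E := ℝ) (μ := haarT2) (C := C)
    (f := fun s q => f s ![q.1, q.2, z]) (f' := fun s q => f' s ![q.1, q.2, z]) hS
    (fun s hs => integrable_haarT2 ((hf s hs).comp (continuous_vec z)))
    (fun s hs q => hd s hs _ rfl) (fun s hs q => hb s hs _ rfl) ht
  rw [perpMean_eq_integral hf' z]
  exact h1.congr_of_mem (fun s hs => perpMean_eq_integral (hf s hs) z) ht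

lemma perpMean_add {f g : T3 → ℝ} (hf : Continuous f) (hg : Continuous g) (z : UnitAddCircle) :
    perpMean (fun x => f x + g x) z = perpMean f z + perpMean g z := by
  rw [perpMean_eq_integral hf, perpMean_eq_integral hg, perpMean_eq_integral (φ := fun x => f x + g x) (by fun_prop)]
  exact integral_add (integrable_haarT2 (hf.comp (continuous_vec z)))
    (integrable_haarT2 (hg.comp (continuous_vec z)))

lemma perpMean_mul_const (f : T3 → ℝ) (c : ℝ) (z : UnitAddCircle) :
    perpMean (fun x => f x * c) z = perpMean f z * c := by
  simp only [perpMean, integral_mul_const]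

/-- The derivative of a differentiable function on the circle. -/
lemma hasDerivAt_dPar {g : UnitAddCircle → ℝ}
    (hg : Differentiable ℝ fun s : ℝ => g (s : UnitAddCircle)) (y : ℝ) :
    HasDerivAt (fun s : ℝ => g (s : UnitAddCircle)) (dPar g (y : UnitAddCircle)) y := by
  have h : dPar g (y : UnitAddCircle) = deriv (fun s : ℝ => g (s : UnitAddCircle)) y := by
    have := deriv_comp_const_add (fun s : ℝ => g (s : UnitAddCircle)) y 0
    simp only [add_zero] at this
    rw [← this, dPar]
    simp only [AddCircle.coe_add]
  rw [h]
  exact (hg y).hasDerivAt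

namespace RegSol

variable {δ R T : ℝ} {ρ v : ℝ → T3 → ℝ} {r w : ℝ → Coeffs} {q : ℝ → UnitAddCircle → ℝ}

/-- The constraint makes the current constant along the parallel direction. -/
lemma dPar_current (h : RegSol δ R T ρ v r w q) (hT : 0 < T)
    (hc : ∀ t ∈ Icc 0 T, ∀ z, perpMean (ρ t) z = 1) {t : ℝ} (ht : t ∈ Icc 0 T)
    (z : UnitAddCircle) : dPar (perpMean fun y => v t y * ρ t y) z = 0 := by
  obtain ⟨C, hC⟩ := h.exists_bound_rho
  have h1 := deriv_perpMean_eq (convex_Icc 0 T) (fun s hs => (h.rho s hs).continuous) (z := z)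
    (fun s hs x _ => h.eq_rho s hs x) (fun s hs x _ => hC s hs x) ht
    ((h.rho t ht).rhsRho le_rfl h.one_lt (h.vel t ht)).continuous
  have h2 : HasDerivWithinAt (fun s => perpMean (ρ s) z) 0 (Icc 0 T) t :=
    (hasDerivWithinAt_const t (Icc 0 T) (1 : ℝ)).congr_of_mem (fun s hs => hc s hs z) ht
  have h3 := (uniqueDiffOn_Icc hT t ht).eq_deriv _ h1 h2
  rw [perpMean_div h.one_lt (h.rho t ht) (h.rho t ht) ((h.vel t ht).mul (h.rho t ht))] at h3
  linarith

lemma current_eq (h : RegSol δ R T ρ v r w q) (hT : 0 < T)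
    (hc : ∀ t ∈ Icc 0 T, ∀ z, perpMean (ρ t) z = 1) {t : ℝ} (ht : t ∈ Icc 0 T)
    (z : UnitAddCircle) :
    perpMean (fun y => v t y * ρ t y) z = perpMean (fun y => v t y * ρ t y) 0 := by
  have h1 := hasDerivAt_perpMean h.one_lt ((h.vel t ht).mul (h.rho t ht))
  obtain ⟨y, rfl⟩ := QuotientAddGroup.mk_surjective z
  exact is_const_of_deriv_eq_zero (fun y => (h1 y).differentiableAt)
    (fun y => (h1 y).deriv.trans (h.dPar_current hT hc ht _)) y 0

/-- The balance of momentum under the constraint. -/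
lemma deriv_current (h : RegSol δ R T ρ v r w q) (hT : 0 < T)
    (hc : ∀ t ∈ Icc 0 T, ∀ z, perpMean (ρ t) z = 1) {t : ℝ} (ht : t ∈ Icc 0 T)
    (z : UnitAddCircle) :
    HasDerivWithinAt (fun s => perpMean (fun y => v s y * ρ s y) z)
      (-dPar (perpMean fun x => ρ t x * v t x ^ 2) z - q t z) (Icc 0 T) t := by
  have hδ := h.one_lt
  have hρ := h.rho t ht
  have hv := h.vel t ht
  obtain ⟨C₁, hC₁⟩ := h.exists_bound_rho
  obtain ⟨C₂, hC₂⟩ := h.exists_bound_adv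
  set F : ℝ → T3 → ℝ := fun t x =>
    -(driftDiv (ρ t) (ρ t) x + pd 2 (fun y => v t y * ρ t y) x) with hF
  set A : ℝ → T3 → ℝ := fun t x => -(driftDiv (ρ t) (v t) x + v t x * pd 2 (v t) x) with hA
  have cF : Continuous (F t) := (hρ.rhsRho le_rfl hδ hv).continuous
  have cA : Continuous (A t) := (hρ.rhsAdv le_rfl hδ hv).continuous
  have cρ := hρ.continuous
  have cv := hv.continuous
  have hR : 0 ≤ R := (h.bd_rho t ht).1
  -- No bound in time is known for q, so v itself cannot be differentiated under the integral. On
  -- the slice of e the force is the same at all points and cancels in v - v(e).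
  let e : T3 := ![0, 0, z]
  have h1 := deriv_perpMean_eq (convex_Icc 0 T) (z := z)
    (f := fun s x => ρ s x * (v s x - v s e))
    (f' := fun s x => F s x * (v s x - v s e) + ρ s x * (A s x - A s e))
    (C := C₁ * (R + R) + R * (C₂ + C₂))
    (fun s hs => (h.rho s hs).continuous.mul ((h.vel s hs).continuous.sub continuous_const))
    (fun s hs x hx => by
      have d2 := (h.eq_vel s hs x).sub (h.eq_vel s hs e)
      have e2 : e 2 = x 2 := hx.symm
      rw [e2, sub_sub_sub_cancel_right] at d2
      exact (h.eq_rho s hs x).fun_mul d2)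
    (fun s hs x _ => by
      have a1 := (h.rho s hs).abs_le (h.bd_rho s hs) x
      have a2 := (h.vel s hs).abs_le (h.bd_vel s hs)
      refine (abs_add_le _ _).trans (add_le_add ?_ ?_)
      · rw [abs_mul]
        exact mul_le_mul (hC₁ s hs x) ((abs_sub _ _).trans (add_le_add (a2 x) (a2 e)))
          (abs_nonneg _) ((abs_nonneg _).trans (hC₁ s hs x))
      · rw [abs_mul]
        exact mul_le_mul a1 ((abs_sub _ _).trans (add_le_add (hC₂ s hs x) (hC₂ s hs e)))
          (abs_nonneg _) hR)
    ht (by fun_prop)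
  have h2 := h1.fun_add (h.eq_vel t ht e)
  -- Since ρ has average 1, the subtracted velocity is restored outside the integral, where its
  -- equation is used at the single point e.
  have hJ : ∀ s ∈ Icc 0 T, perpMean (fun y => v s y * ρ s y) z
      = perpMean (fun x => ρ s x * (v s x - v s e)) z + v s e := fun s hs => by
    have c1 := (h.rho s hs).continuous
    have c2 := (h.vel s hs).continuous
    have e1 : (fun y => v s y * ρ s y) = fun y => ρ s y * (v s y - v s e) + ρ s y * v s e := by
      ext y; ring
    rw [e1, perpMean_add (by fun_prop) (by fun_prop), perpMean_mul_const, hc s hs z, one_mul]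
  have hF0 : perpMean (F t) z = 0 := by
    rw [hF, perpMean_div hδ hρ hρ (hv.mul hρ), h.dPar_current hT hc ht, neg_zero]
  have hval : perpMean (fun x => F t x * (v t x - v t e) + ρ t x * (A t x - A t e)) z + A t e
      = -dPar (perpMean fun x => ρ t x * v t x ^ 2) z := by
    have e1 : (fun x => F t x * (v t x - v t e) + ρ t x * (A t x - A t e))
        = fun x => (F t x * v t x + ρ t x * A t x) + (F t x * (-v t e) + ρ t x * (-A t e)) := by
      ext x; ring
    rw [e1, perpMean_add (by fun_prop) (by fun_prop),
      perpMean_add (f := fun x => F t x * (-v t e)) (by fun_prop) (by fun_prop),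
      perpMean_mul_const, perpMean_mul_const, hF0, hc t ht z]
    have e2 : (fun x => F t x * v t x + ρ t x * A t x) = fun x =>
        -(driftDiv (ρ t) (fun y => ρ t y * v t y) x + pd 2 (fun y => ρ t y * v t y ^ 2) x) :=
      funext fun x => momentum_flux hδ hρ hv x
    rw [e2, perpMean_div hδ hρ (hρ.mul hv) (hρ.flux hv)]
    ring
  have h3 := h2.congr_of_mem hJ ht
  have e3 : e 2 = z := rfl
  rw [e3] at h3
  refine h3.congr_deriv ?_
  rw [← hval]
  ring

/-- Under the constraint, the force of a differentiable pressure obeys the pressure law. -/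
theorem pressureLaw (h : RegSol δ R T ρ v r w q) (hT : 0 < T)
    (hc : ∀ t ∈ Icc 0 T, ∀ z, perpMean (ρ t) z = 1) {p : ℝ → UnitAddCircle → ℝ}
    (hp : ∀ t ∈ Icc 0 T, Differentiable ℝ fun s : ℝ => p t (s : UnitAddCircle))
    (hq : ∀ t ∈ Icc 0 T, ∀ z, q t z = dPar (p t) z) : PressureLaw T ρ v q := by
  intro t ht
  have hδ := h.one_lt
  -- The time derivative of the current is the same at every z because the current is; j is its
  -- value, computed at z = 0.
  set j := -dPar (perpMean fun x => ρ t x * v t x ^ 2) 0 - q t 0 with hj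
  have h1 : ∀ z, -dPar (perpMean fun x => ρ t x * v t x ^ 2) z - q t z = j := fun z => by
    have h2 := h.deriv_current hT hc ht z
    have h3 := (h.deriv_current hT hc ht 0).congr_of_mem
      (fun s hs => h.current_eq hT hc hs z) ht
    exact (uniqueDiffOn_Icc hT t ht).eq_deriv _ h2 h3
  have h4 := hasDerivAt_dPar (hp t ht)
  -- The sum of p, the flux and j·s is constant on the line. The first two are periodic, so
  -- comparing s = 1 with s = 0 forces j = 0.
  have h7 : ∀ y : ℝ, HasDerivAt (fun s : ℝ => p t (s : UnitAddCircle)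
      + perpMean (fun x => ρ t x * v t x ^ 2) (s : UnitAddCircle) + j * s) 0 y := fun y => by
    have h8 := ((h4 y).fun_add (hasDerivAt_perpMean hδ ((h.rho t ht).flux (h.vel t ht)) y)).fun_add
      ((hasDerivAt_id y).const_mul j)
    refine h8.congr_deriv ?_
    rw [← h1 (y : UnitAddCircle), hq t ht]
    ring
  have h9 := is_const_of_deriv_eq_zero (fun y => (h7 y).differentiableAt) (fun y => (h7 y).deriv)
    1 0
  have h10 : ((1 : ℝ) : UnitAddCircle) = ((0 : ℝ) : UnitAddCircle) := by
    simp
  have hj0 : j = 0 := by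
    simp only [h10] at h9
    linarith
  intro z
  have := h1 z
  linarith

end RegSol

/-! ### Power series in time -/

/-- The sum of a power series in time with values in families of coefficients. -/
def series (t : ℝ) (X : ℕ → Coeffs) : Coeffs := fun k => ∑' n, (t : ℂ) ^ n * X n k

/-- The coefficients of the product of two power series. -/
def cauchy (X Y : ℕ → Coeffs) : ℕ → Coeffs := fun n =>
  ∑ p ∈ Finset.HasAntidiagonal.antidiagonal n, conv (X p.1) (Y p.2)

/-- The power series `X` converges absolutely at `t` in `B_δ`. -/
def Conv (δ t : ℝ) (X : ℕ → Coeffs) : Prop :=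
  1 ≤ δ ∧ ∃ B : ℕ → ℝ, (∀ n, Bd δ (X n) (B n)) ∧ Summable fun n => |t| ^ n * B n

namespace Conv

variable {δ t : ℝ} {X Y : ℕ → Coeffs}

/-- Absolute summability jointly in the degree and the frequency justifies the interchange of the
time series with the Fourier series. -/
lemma summable_prod (hX : Conv δ t X) :
    Summable fun p : ℕ × (Fin 3 → ℤ) => ‖(t : ℂ) ^ p.1 * X p.1 p.2‖ := by
  obtain ⟨hδ, B, hB, hs⟩ := hX
  have e : ∀ n k, ‖(t : ℂ) ^ n * X n k‖ = |t| ^ n * ‖X n k‖ := fun n k => by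
    rw [norm_mul, norm_pow, Complex.norm_real, Real.norm_eq_abs]
  simp only [e]
  refine (summable_prod_of_nonneg fun p => by positivity).mpr ⟨fun n => ?_, ?_⟩
  · simpa only using (summable_norm_of_wnorm hδ (hB n).ne_top).mul_left (|t| ^ n)
  · refine Summable.of_nonneg_of_le (fun n => tsum_nonneg fun k => by positivity) (fun n => ?_) hs
    simp only
    rw [tsum_mul_left]
    gcongr
    exact (hB n).tsum_norm_le hδ

lemma summable_apply (hX : Conv δ t X) (k : Fin 3 → ℤ) :
    Summable fun n => ‖(t : ℂ) ^ n * X n k‖ :=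
  (hX.summable_prod.prod_symm).prod_factor k

lemma ne_top (hX : Conv δ t X) : wnorm δ (series t X) ≠ ⊤ := by
  obtain ⟨hδ, B, hB, hs⟩ := hX
  have h := Bd.tsum (X := fun n => (t : ℂ) ^ n • X n) (B := fun n => |t| ^ n * B n)
    (fun n => by simpa using (hB n).smul ((t : ℂ) ^ n)) hs
  exact h.ne_top

lemma synth_series (hX : Conv δ t X) (x : T3) :
    synth (series t X) x = ∑' n, (t : ℂ) ^ n * synth (X n) x := by
  have hs : Summable (Function.uncurry fun (n : ℕ) (k : Fin 3 → ℤ) =>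
      (t : ℂ) ^ n * X n k * UnitAddTorus.mFourier k x) := by
    refine Summable.of_norm ?_
    refine hX.summable_prod.congr fun p => ?_
    simp [Function.uncurry, norm_mFourier_apply]
  have h1 := hs.tsum_comm
  simp only [synth, series, ← tsum_mul_right, ← tsum_mul_left]
  rw [h1]
  exact tsum_congr fun n => tsum_congr fun k => by ring

/-- The product of two time series at frequency k is a triple sum over two degrees and one
frequency. It converges absolutely and may be regrouped by total degree. -/
lemma series_cauchy_apply (hX : Conv δ t X) (hY : Conv δ t Y) (k : Fin 3 → ℤ) :
    HasSum (fun n => (t : ℂ) ^ n * cauchy X Y n k) (conv (series t X) (series t Y) k) := by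
  obtain ⟨hδ, B, hB, hs⟩ := id hX
  have hY1 := hY.summable_prod
  have hbig : Summable fun p : (Fin 3 → ℤ) × (ℕ × ℕ) =>
      ‖((t : ℂ) ^ p.2.1 * X p.2.1 (k - p.1)) * ((t : ℂ) ^ p.2.2 * Y p.2.2 p.1)‖ := by
    have h0 : Summable fun p : ℕ × (ℕ × (Fin 3 → ℤ)) =>
        (|t| ^ p.1 * B p.1) * ‖(t : ℂ) ^ p.2.1 * Y p.2.1 p.2.2‖ :=
      hs.mul_of_nonneg hY1 (fun n => mul_nonneg (by positivity) (hB n).1) fun _ => norm_nonneg _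
    let E : (Fin 3 → ℤ) × (ℕ × ℕ) ≃ ℕ × (ℕ × (Fin 3 → ℤ)) :=
      { toFun := fun p => (p.2.1, (p.2.2, p.1))
        invFun := fun p => (p.2.2, (p.1, p.2.1))
        left_inv := fun p => rfl
        right_inv := fun p => rfl }
    refine Summable.of_nonneg_of_le (fun _ => norm_nonneg _) (fun p => ?_)
      (E.summable_iff.mpr h0)
    simp only [Function.comp, E, Equiv.coe_fn_mk]
    rw [norm_mul]
    gcongr
    rw [norm_mul, norm_pow, Complex.norm_real, Real.norm_eq_abs]
    gcongr
    exact (hB _).norm_le hδ _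
  have hbig' : Summable (Function.uncurry fun (l : Fin 3 → ℤ) (p : ℕ × ℕ) =>
      ((t : ℂ) ^ p.1 * X p.1 (k - l)) * ((t : ℂ) ^ p.2 * Y p.2 l)) := hbig.of_norm
  have h1 : conv (series t X) (series t Y) k
      = ∑' p : ℕ × ℕ, ∑' l, ((t : ℂ) ^ p.1 * X p.1 (k - l)) * ((t : ℂ) ^ p.2 * Y p.2 l) := by
    rw [hbig'.tsum_comm, conv]
    refine tsum_congr fun l => ?_
    exact tsum_mul_tsum_of_summable_norm (hX.summable_apply (k - l)) (hY.summable_apply l)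
  have h2 : ∀ p : ℕ × ℕ, ∑' l, ((t : ℂ) ^ p.1 * X p.1 (k - l)) * ((t : ℂ) ^ p.2 * Y p.2 l)
      = (t : ℂ) ^ (p.1 + p.2) * conv (X p.1) (Y p.2) k := fun p => by
    rw [conv, ← tsum_mul_left]
    exact tsum_congr fun l => by rw [pow_add]; ring
  have hsum : HasSum (fun p : ℕ × ℕ => (t : ℂ) ^ (p.1 + p.2) * conv (X p.1) (Y p.2) k)
      (conv (series t X) (series t Y) k) := by
    rw [h1]
    simp only [← h2]
    exact (hbig'.prod_symm.prod).hasSum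
  -- The pairs of degrees are now fibred over their sum.
  have h3 := (Finset.HasAntidiagonal.sigmaAntidiagonalEquivProd (A := ℕ)).hasSum_iff.mpr hsum
  have h4 := h3.sigma fun n => hasSum_fintype _
  refine h4.congr_fun ?_
  intro n
  rw [cauchy, Finset.sum_apply, Finset.mul_sum, ← Finset.sum_coe_sort]
  refine Finset.sum_congr rfl fun p _ => ?_
  have := Finset.HasAntidiagonal.mem_antidiagonal.mp p.2
  simp only [Function.comp, Finset.HasAntidiagonal.sigmaAntidiagonalEquivProd_apply]
  rw [this]

end Conv

/-- The power series `X` has the sum `s` at time `t`, coefficient by coefficient. -/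
def SeriesAt (t : ℝ) (X : ℕ → Coeffs) (s : Coeffs) : Prop :=
  ∀ k, HasSum (fun n => (t : ℂ) ^ n * X n k) (s k)

namespace SeriesAt

variable {t : ℝ} {X Y : ℕ → Coeffs} {a b : Coeffs}

lemma series_eq (h : SeriesAt t X a) : series t X = a := funext fun k => (h k).tsum_eq

lemma add (hX : SeriesAt t X a) (hY : SeriesAt t Y b) :
    SeriesAt t (fun n => X n + Y n) (a + b) := fun k => by
  simpa [mul_add] using (hX k).add (hY k)

lemma neg (hX : SeriesAt t X a) : SeriesAt t (fun n => -X n) (-a) := fun k => by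
  simpa using (hX k).neg

lemma symbol_mul (hX : SeriesAt t X a) (m : Coeffs) :
    SeriesAt t (fun n => m * X n) (m * a) := fun k => by
  simpa [mul_left_comm] using (hX k).mul_left (m k)

lemma smul (hX : SeriesAt t X a) (c : ℂ) : SeriesAt t (fun n => c • X n) (c • a) := fun k => by
  simpa [mul_left_comm] using (hX k).mul_left c

end SeriesAt

namespace Conv

variable {δ t : ℝ} {X Y : ℕ → Coeffs}

lemma seriesAt (h : Conv δ t X) : SeriesAt t X (series t X) :=
  fun k => (h.summable_apply k).of_norm.hasSum

lemma symbol_mul (h : Conv δ t X) {m : Coeffs} (hm : ∀ k, ‖m k‖ ≤ 1) :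
    Conv δ t (fun n => m * X n) := by
  obtain ⟨hδ, B, hB, hs⟩ := h
  exact ⟨hδ, B, fun n => (hB n).mul_of_le_one hm, hs⟩

lemma seriesAt_cauchy (hX : Conv δ t X) (hY : Conv δ t Y) :
    SeriesAt t (cauchy X Y) (conv (series t X) (series t Y)) :=
  fun k => hX.series_cauchy_apply hY k

end Conv

/-! ### The recursion for the Taylor coefficients -/

/-- The Taylor coefficients of `∇_⊥ · (E^⊥ f)`. -/
def driftDivT (X Y : ℕ → Coeffs) (n : ℕ) : Coeffs :=
  dSym 0 * cauchy (fun m => driftSym₁ * X m) Y n + dSym 1 * cauchy (fun m => driftSym₂ * X m) Y n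

/-- The Taylor coefficients of the right hand side of the continuity equation. -/
def stepRho (X W : ℕ → Coeffs) (n : ℕ) : Coeffs := -(driftDivT X X n + dSym 2 * cauchy W X n)

/-- The Taylor coefficients of the right hand side of the equation for the velocity. -/
def stepVel (X W : ℕ → Coeffs) (n : ℕ) : Coeffs :=
  -(driftDivT X W n + dSym 2 * ((1 / 2 : ℝ) : ℂ) • cauchy W W n)
    + dSym 2 * (meanSym * cauchy X (cauchy W W) n)

/-! ### Summation, causality and reality of the recursion -/

section step

variable {δ t : ℝ} {X W X' W' : ℕ → Coeffs}

lemma seriesAt_driftDivT (hX : Conv δ t X) (hW : Conv δ t W) :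
    SeriesAt t (driftDivT X W) (driftDivC (series t X) (series t W)) := by
  have h1 := ((hX.symbol_mul norm_driftSym₁_le).seriesAt_cauchy hW).symbol_mul (dSym 0)
  have h2 := ((hX.symbol_mul norm_driftSym₂_le).seriesAt_cauchy hW).symbol_mul (dSym 1)
  rw [(hX.seriesAt.symbol_mul driftSym₁).series_eq] at h1
  rw [(hX.seriesAt.symbol_mul driftSym₂).series_eq] at h2
  exact h1.add h2

lemma seriesAt_stepRho (hX : Conv δ t X) (hW : Conv δ t W) :
    SeriesAt t (stepRho X W) (rhsRho (series t X) (series t W)) :=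
  ((seriesAt_driftDivT hX hX).add ((hW.seriesAt_cauchy hX).symbol_mul (dSym 2))).neg

/-- The cubic pressure term is a nested Cauchy product, so the inner product series must itself
converge absolutely. -/
lemma seriesAt_stepVel (hX : Conv δ t X) (hW : Conv δ t W) (hWW : Conv δ t (cauchy W W)) :
    SeriesAt t (stepVel X W) (rhsAdv (series t X) (series t W)
      + rhsPress (series t X) (series t W)) := by
  have h3 := hX.seriesAt_cauchy hWW
  rw [(hW.seriesAt_cauchy hW).series_eq] at h3
  exact (((seriesAt_driftDivT hX hW).add
    (((hW.seriesAt_cauchy hW).smul ((1 / 2 : ℝ) : ℂ)).symbol_mul (dSym 2))).neg).add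
      ((h3.symbol_mul meanSym).symbol_mul (dSym 2))

/-- The recursion is causal: degree n of a product sees only degrees up to n. Hence the truncation
inside `taylor` is harmless. -/
lemma cauchy_congr {n : ℕ} (hX : ∀ m ≤ n, X m = X' m) (hW : ∀ m ≤ n, W m = W' m) :
    cauchy X W n = cauchy X' W' n := by
  refine Finset.sum_congr rfl fun p hp => ?_
  have := Finset.HasAntidiagonal.mem_antidiagonal.mp hp
  rw [hX p.1 (by omega), hW p.2 (by omega)]

lemma driftDivT_congr {n : ℕ} (hX : ∀ m ≤ n, X m = X' m) (hW : ∀ m ≤ n, W m = W' m) :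
    driftDivT X W n = driftDivT X' W' n := by
  rw [driftDivT, driftDivT, cauchy_congr (fun m hm => by rw [hX m hm]) hW,
    cauchy_congr (X := fun m => driftSym₂ * X m) (fun m hm => by rw [hX m hm]) hW]

lemma stepRho_congr {n : ℕ} (hX : ∀ m ≤ n, X m = X' m) (hW : ∀ m ≤ n, W m = W' m) :
    stepRho X W n = stepRho X' W' n := by
  rw [stepRho, stepRho, driftDivT_congr hX hX, cauchy_congr hW hX]

lemma stepVel_congr {n : ℕ} (hX : ∀ m ≤ n, X m = X' m) (hW : ∀ m ≤ n, W m = W' m) :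
    stepVel X W n = stepVel X' W' n := by
  rw [stepVel, stepVel, driftDivT_congr hX hW, cauchy_congr hW hW,
    cauchy_congr hX fun m hm => cauchy_congr (fun l hl => hW l (hl.trans hm))
      fun l hl => hW l (hl.trans hm)]

lemma herm_cauchy {n : ℕ} (hX : ∀ m ≤ n, Herm (X m)) (hW : ∀ m ≤ n, Herm (W m)) :
    Herm (cauchy X W n) :=
  Herm.sum fun p hp => by
    have := Finset.HasAntidiagonal.mem_antidiagonal.mp hp
    exact (hX p.1 (by omega)).convolve (hW p.2 (by omega))

lemma herm_driftDivT {n : ℕ} (hX : ∀ m ≤ n, Herm (X m)) (hW : ∀ m ≤ n, Herm (W m)) :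
    Herm (driftDivT X W n) :=
  ((herm_dSym 0).mul (herm_cauchy (fun m hm => herm_driftSym₁.mul (hX m hm)) hW)).add
    ((herm_dSym 1).mul (herm_cauchy (fun m hm => herm_driftSym₂.mul (hX m hm)) hW))

lemma herm_stepRho {n : ℕ} (hX : ∀ m ≤ n, Herm (X m)) (hW : ∀ m ≤ n, Herm (W m)) :
    Herm (stepRho X W n) :=
  ((herm_driftDivT hX hX).add ((herm_dSym 2).mul (herm_cauchy hW hX))).neg

lemma herm_stepVel {n : ℕ} (hX : ∀ m ≤ n, Herm (X m)) (hW : ∀ m ≤ n, Herm (W m)) :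
    Herm (stepVel X W n) :=
  (((herm_driftDivT hX hW).add ((herm_dSym 2).mul ((herm_cauchy hW hW).real_smul _))).neg).add
    ((herm_dSym 2).mul (herm_meanSym.mul (herm_cauchy hX fun _ hm =>
      herm_cauchy (fun l hl => hW l (hl.trans hm)) fun l hl => hW l (hl.trans hm))))

end step

/-- The Taylor coefficients of the solution. -/
def taylor (a b : Coeffs) : ℕ → Coeffs × Coeffs
  | 0 => (a, b)
  | n + 1 =>
    -- The guards make the recursive calls well-founded; the default 0 beyond n is never read.
    (((1 / (n + 1) : ℝ) : ℂ) • stepRho (fun m => if _ : m ≤ n then (taylor a b m).1 else 0)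
        (fun m => if _ : m ≤ n then (taylor a b m).2 else 0) n,
      ((1 / (n + 1) : ℝ) : ℂ) • stepVel (fun m => if _ : m ≤ n then (taylor a b m).1 else 0)
        (fun m => if _ : m ≤ n then (taylor a b m).2 else 0) n)

/-- The Taylor coefficients of the density. -/
def taylorRho (a b : Coeffs) (n : ℕ) : Coeffs := (taylor a b n).1

/-- The Taylor coefficients of the velocity. -/
def taylorVel (a b : Coeffs) (n : ℕ) : Coeffs := (taylor a b n).2

section taylor

variable (a b : Coeffs)

lemma taylorRho_zero : taylorRho a b 0 = a := by rw [taylorRho, taylor]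

lemma taylorVel_zero : taylorVel a b 0 = b := by rw [taylorVel, taylor]

lemma taylorRho_succ (n : ℕ) : taylorRho a b (n + 1)
    = ((1 / (n + 1) : ℝ) : ℂ) • stepRho (taylorRho a b) (taylorVel a b) n := by
  rw [taylorRho, taylor]
  dsimp only
  congr 1
  exact stepRho_congr (fun m hm => by simp [hm, taylorRho]) fun m hm => by simp [hm, taylorVel]

lemma taylorVel_succ (n : ℕ) : taylorVel a b (n + 1)
    = ((1 / (n + 1) : ℝ) : ℂ) • stepVel (taylorRho a b) (taylorVel a b) n := by
  rw [taylorVel, taylor]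
  dsimp only
  congr 1
  exact stepVel_congr (fun m hm => by simp [hm, taylorRho]) fun m hm => by simp [hm, taylorVel]

lemma herm_taylor {a b : Coeffs} (ha : Herm a) (hb : Herm b) (n : ℕ) :
    Herm (taylorRho a b n) ∧ Herm (taylorVel a b n) := by
  induction n using Nat.strong_induction_on with
  | _ n ih =>
    cases n with
    | zero => rw [taylorRho_zero, taylorVel_zero]; exact ⟨ha, hb⟩
    | succ n =>
      rw [taylorRho_succ, taylorVel_succ]
      have h1 : ∀ m ≤ n, Herm (taylorRho a b m) := fun m hm => (ih m (by omega)).1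
      have h2 : ∀ m ≤ n, Herm (taylorVel a b m) := fun m hm => (ih m (by omega)).2
      exact ⟨(herm_stepRho h1 h2).real_smul _, (herm_stepVel h1 h2).real_smul _⟩

end taylor

/-! ### Growth of the Taylor coefficients -/

lemma sum_inv_sq_le (n : ℕ) :
    ∑ i ∈ Finset.range (n + 1), 1 / ((i : ℝ) + 1) ^ 2 ≤ 2 - 1 / ((n : ℝ) + 1) := by
  induction n with
  | zero => norm_num
  | succ n ih =>
    rw [Finset.sum_range_succ]
    push_cast
    have h : 1 / ((n : ℝ) + 1 + 1) ^ 2 ≤ 1 / (n + 1) - 1 / (n + 1 + 1) := by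
      rw [div_sub_div _ _ (by positivity) (by positivity), div_le_div_iff₀ (by positivity)
        (by positivity)]
      nlinarith
    linarith

/-- The weight 1/(n+1)² reproduces itself under discrete convolution: 8 is the factor 2 of the
pointwise splitting times two sums, each at most 2. -/
lemma sum_antidiagonal_inv_sq_le (n : ℕ) :
    ∑ p ∈ Finset.HasAntidiagonal.antidiagonal n,
      1 / ((p.1 : ℝ) + 1) ^ 2 * (1 / ((p.2 : ℝ) + 1) ^ 2) ≤ 8 / ((n : ℝ) + 1) ^ 2 := by
  have h1 : ∀ p ∈ Finset.HasAntidiagonal.antidiagonal n,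
      1 / ((p.1 : ℝ) + 1) ^ 2 * (1 / ((p.2 : ℝ) + 1) ^ 2)
        ≤ 2 / ((n : ℝ) + 1) ^ 2 * (1 / ((p.1 : ℝ) + 1) ^ 2 + 1 / ((p.2 : ℝ) + 1) ^ 2) := by
    intro p hp
    have h : ((p.1 : ℝ)) + p.2 = n := by
      exact_mod_cast Finset.HasAntidiagonal.mem_antidiagonal.mp hp
    rw [← h]
    have hx : (0 : ℝ) ≤ p.1 := Nat.cast_nonneg _
    have hy : (0 : ℝ) ≤ p.2 := Nat.cast_nonneg _
    generalize (p.1 : ℝ) = x at *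
    generalize (p.2 : ℝ) = y at *
    rw [div_add_div _ _ (by positivity) (by positivity), div_mul_div_comm, div_mul_div_comm,
      div_le_div_iff₀ (by positivity) (by positivity)]
    have h3 : (x + y + 1) ^ 2 ≤ 2 * ((x + 1) ^ 2 + (y + 1) ^ 2) := by nlinarith [sq_nonneg (x - y)]
    have h4 : 0 ≤ (x + 1) ^ 2 * (y + 1) ^ 2 := by positivity
    nlinarith [mul_le_mul_of_nonneg_right h3 h4]
  refine (Finset.sum_le_sum h1).trans ?_
  rw [← Finset.mul_sum, Finset.sum_add_distrib]
  have e1 : ∑ p ∈ Finset.HasAntidiagonal.antidiagonal n, 1 / ((p.1 : ℝ) + 1) ^ 2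
      = ∑ i ∈ Finset.range (n + 1), 1 / ((i : ℝ) + 1) ^ 2 :=
    Finset.Nat.sum_antidiagonal_eq_sum_range_succ_mk (fun p : ℕ × ℕ => 1 / ((p.1 : ℝ) + 1) ^ 2) n
  have e2 : ∑ p ∈ Finset.HasAntidiagonal.antidiagonal n, 1 / ((p.2 : ℝ) + 1) ^ 2
      = ∑ i ∈ Finset.range (n + 1), 1 / ((i : ℝ) + 1) ^ 2 := by
    rw [← e1, ← Finset.Nat.sum_antidiagonal_swap]
    rfl
  rw [e1, e2]
  have h5 := sum_inv_sq_le n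
  have h6 : (0 : ℝ) ≤ 1 / (n + 1) := by positivity
  rw [div_mul_eq_mul_div]
  gcongr
  linarith

/-- The growth condition on the first `N` Taylor coefficients. -/
def Dom (δ₀ c : ℝ) (N : ℕ) (X : ℕ → Coeffs) (A : ℝ) : Prop :=
  ∀ n ≤ N, ∀ δ, 1 ≤ δ → δ < δ₀ →
    Bd δ (X n) (A * (c / (δ₀ - δ)) ^ n * (1 / ((n : ℝ) + 1) ^ 2))

namespace Dom

variable {δ₀ c A B : ℝ} {N : ℕ} {X Y : ℕ → Coeffs}

lemma symbol_mul (h : Dom δ₀ c N X A) {m : Coeffs} (hm : ∀ k, ‖m k‖ ≤ 1) :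
    Dom δ₀ c N (fun n => m * X n) A :=
  fun n hn δ h1 h2 => (h n hn δ h1 h2).mul_of_le_one hm

lemma cauchy (hA : 0 ≤ A) (hB : 0 ≤ B) (hc : 0 ≤ c) (hX : Dom δ₀ c N X A) (hY : Dom δ₀ c N Y B) :
    Dom δ₀ c N (cauchy X Y) (8 * A * B) := by
  intro n hn δ h1 h2
  have hκ : 0 ≤ c / (δ₀ - δ) := div_nonneg hc (by linarith)
  have h3 : Bd δ (DriftFluid.cauchy X Y n) (∑ p ∈ Finset.HasAntidiagonal.antidiagonal n,
      (A * (c / (δ₀ - δ)) ^ p.1 * (1 / ((p.1 : ℝ) + 1) ^ 2)) *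
        (B * (c / (δ₀ - δ)) ^ p.2 * (1 / ((p.2 : ℝ) + 1) ^ 2))) := by
    refine Bd.sum fun p hp => ?_
    have := Finset.HasAntidiagonal.mem_antidiagonal.mp hp
    exact (hX p.1 (by omega) δ h1 h2).convolve h1 (hY p.2 (by omega) δ h1 h2)
  refine h3.mono ?_
  have h4 : ∀ p ∈ Finset.HasAntidiagonal.antidiagonal n,
      (A * (c / (δ₀ - δ)) ^ p.1 * (1 / ((p.1 : ℝ) + 1) ^ 2)) *
        (B * (c / (δ₀ - δ)) ^ p.2 * (1 / ((p.2 : ℝ) + 1) ^ 2))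
      = A * B * (c / (δ₀ - δ)) ^ n * (1 / ((p.1 : ℝ) + 1) ^ 2 * (1 / ((p.2 : ℝ) + 1) ^ 2)) := by
    intro p hp
    rw [← Finset.HasAntidiagonal.mem_antidiagonal.mp hp, pow_add]
    ring
  rw [Finset.sum_congr rfl h4, ← Finset.mul_sum]
  calc _ ≤ A * B * (c / (δ₀ - δ)) ^ n * (8 / ((n : ℝ) + 1) ^ 2) := by
        gcongr
        exact sum_antidiagonal_inv_sq_le n
    _ = _ := by ring

/-- Integration in time compensates the loss of one derivative. -/
lemma dSym_mul (hA : 0 ≤ A) (hc : 0 < c) (hδ₀ : 1 < δ₀) {n : ℕ} (hX : Dom δ₀ c n X A) (i : Fin 3)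
    {δ : ℝ} (h1 : 1 ≤ δ) (h2 : δ < δ₀) :
    Bd δ (((1 / (n + 1) : ℝ) : ℂ) • (dSym i * X n))
      (48 * Real.pi * δ₀ * A / c * ((c / (δ₀ - δ)) ^ (n + 1) * (1 / ((n : ℝ) + 1 + 1) ^ 2))) := by
  have hgap : 0 < δ₀ - δ := by linarith
  have hpi := Real.pi_pos
  set δ' := δ + (δ₀ - δ) / (n + 2) with hδ'
  have e1 : δ' - δ = (δ₀ - δ) / (n + 2) := by rw [hδ']; ring
  have e2 : δ₀ - δ' = (δ₀ - δ) * ((n + 1) / (n + 2)) := by rw [hδ']; field_simp; ring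
  have hlt1 : δ < δ' := by
    have : 0 < (δ₀ - δ) / ((n : ℝ) + 2) := by positivity
    linarith
  have hlt2 : δ' < δ₀ := by
    have : 0 < (δ₀ - δ) * (((n : ℝ) + 1) / (n + 2)) := by positivity
    linarith
  have h3 := ((hX n le_rfl δ' (by linarith) hlt2).dSym_mul' h1 hlt1 h2.le i).smul
    ((1 / (n + 1) : ℝ) : ℂ)
  refine h3.mono ?_
  rw [Complex.norm_real, Real.norm_of_nonneg (by positivity)]
  have e3 : c / (δ₀ - δ') = c / (δ₀ - δ) * (((n : ℝ) + 2) / (n + 1)) := by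
    rw [e2]; field_simp
  rw [e1, e3, mul_pow]
  have hr := ratio_pow_le n
  have hr2 : ((n : ℝ) + 2) / (n + 1) ≤ 2 := by rw [div_le_iff₀ (by positivity)]; linarith
  -- The ratio (n+2)/(n+1) occurs n times from the shrunken gap and three times from exchanging
  -- (n+2)/(n+1)³ for 1/(n+2)². With 3 and 2³ this gives 2π·24 = 48π.
  calc 1 / ((n : ℝ) + 1) * (2 * Real.pi * δ₀ / ((δ₀ - δ) / (n + 2)) *
        (A * ((c / (δ₀ - δ)) ^ n * (((n : ℝ) + 2) / (n + 1)) ^ n) * (1 / ((n : ℝ) + 1) ^ 2)))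
      = 2 * Real.pi * δ₀ * A / c * (c / (δ₀ - δ)) ^ (n + 1) * (1 / ((n : ℝ) + 1 + 1) ^ 2)
          * ((((n : ℝ) + 2) / (n + 1)) ^ n * ((((n : ℝ) + 2) / (n + 1))) ^ 3) := by
        rw [pow_succ (c / (δ₀ - δ)) n]
        have hg : δ₀ - δ ≠ 0 := hgap.ne'
        generalize (c / (δ₀ - δ)) ^ n = P
        generalize (((n : ℝ) + 2) / (n + 1)) ^ n = Q
        generalize δ₀ - δ = g at hg
        field_simp
        ring
    _ ≤ 2 * Real.pi * δ₀ * A / c * (c / (δ₀ - δ)) ^ (n + 1) * (1 / ((n : ℝ) + 1 + 1) ^ 2)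
          * (3 * 2 ^ 3) := by gcongr
    _ = _ := by ring

end Dom

/-- A quadratic term obeys the growth condition with 8M², the cubic one with 64M³. There are at most
three quadratic terms, so the choice of c makes the step reproduce the same M. -/
lemma dom_taylor {δ₀ c M : ℝ} (hδ₀ : 1 < δ₀) (hM : 0 ≤ M) (hc : 0 < c)
    (hcM : 48 * Real.pi * δ₀ * (24 * M + 64 * M ^ 2) ≤ c) {a b : Coeffs} (ha : Bd δ₀ a M)
    (hb : Bd δ₀ b M) (N : ℕ) :
    Dom δ₀ c N (taylorRho a b) M ∧ Dom δ₀ c N (taylorVel a b) M := by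
  have hpi := Real.pi_pos
  induction N with
  | zero =>
    constructor
    · intro n hn δ h1 h2
      obtain rfl : n = 0 := by omega
      rw [taylorRho_zero]
      simpa using ha.mono_radius h1 h2.le
    · intro n hn δ h1 h2
      obtain rfl : n = 0 := by omega
      rw [taylorVel_zero]
      simpa using hb.mono_radius h1 h2.le
  | succ n ih =>
    obtain ⟨hX, hW⟩ := ih
    set X := taylorRho a b with hXdef
    set W := taylorVel a b with hWdef
    have fin : ∀ {q K : ℝ}, 0 ≤ K → q ≤ 48 * Real.pi * δ₀ * (24 * M + 64 * M ^ 2) * M / c * K →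
        q ≤ M * K := fun {q K} hK h => by
      refine h.trans ?_
      have : 48 * Real.pi * δ₀ * (24 * M + 64 * M ^ 2) * M / c ≤ M := by
        rw [div_le_iff₀ hc]
        nlinarith
      gcongr
    have dE : ∀ {m Y : _} , (∀ k, ‖(m : Coeffs) k‖ ≤ 1) → Dom δ₀ c n Y M →
        Dom δ₀ c n (cauchy (fun l => m * X l) Y) (8 * M * M) := fun hm hY =>
      Dom.cauchy hM hM hc.le (hX.symbol_mul hm) hY
    have hWW := Dom.cauchy hM hM hc.le hW hW
    have h8 : 0 ≤ 8 * M * M := by positivity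
    constructor
    · intro m hm δ h1 h2
      rcases Nat.lt_or_ge n m with hlt | hle
      swap
      · exact hX m hle δ h1 h2
      obtain rfl : m = n + 1 := by omega
      have hgap : 0 < δ₀ - δ := by linarith
      have b1 := (dE norm_driftSym₁_le hX).dSym_mul h8 hc hδ₀ 0 h1 h2
      have b2 := (dE norm_driftSym₂_le hX).dSym_mul h8 hc hδ₀ 1 h1 h2
      have b3 := (Dom.cauchy hM hM hc.le hW hX).dSym_mul h8 hc hδ₀ 2 h1 h2
      have e : X (n + 1) = -((((1 / (n + 1) : ℝ) : ℂ) • (dSym 0 * cauchy (fun l => driftSym₁ * X l) X n)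
          + ((1 / (n + 1) : ℝ) : ℂ) • (dSym 1 * cauchy (fun l => driftSym₂ * X l) X n))
          + ((1 / (n + 1) : ℝ) : ℂ) • (dSym 2 * cauchy W X n)) := by
        rw [hXdef, taylorRho_succ, stepRho, driftDivT, smul_neg, smul_add, smul_add]
      rw [e]
      refine ((b1.add b2).add b3).neg.mono ?_
      push_cast
      rw [mul_assoc M]
      refine fin (by positivity) ?_
      set K := (c / (δ₀ - δ)) ^ (n + 1) * (1 / ((n : ℝ) + 1 + 1) ^ 2) with hK
      have hK0 : 0 ≤ K := by positivity
      have e1 : 48 * Real.pi * δ₀ * (8 * M * M) / c * K + 48 * Real.pi * δ₀ * (8 * M * M) / c * K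
          + 48 * Real.pi * δ₀ * (8 * M * M) / c * K
          = 48 * Real.pi * δ₀ * (24 * M * M) / c * K := by ring
      rw [e1, mul_assoc (48 * Real.pi * δ₀) (24 * M + 64 * M ^ 2) M]
      have : 24 * M * M ≤ (24 * M + 64 * M ^ 2) * M := by nlinarith [pow_nonneg hM 3]
      gcongr
    · intro m hm δ h1 h2
      rcases Nat.lt_or_ge n m with hlt | hle
      swap
      · exact hW m hle δ h1 h2
      obtain rfl : m = n + 1 := by omega
      have hgap : 0 < δ₀ - δ := by linarith
      have b1 := (dE norm_driftSym₁_le hW).dSym_mul h8 hc hδ₀ 0 h1 h2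
      have b2 := (dE norm_driftSym₂_le hW).dSym_mul h8 hc hδ₀ 1 h1 h2
      have b3 := (hWW.dSym_mul h8 hc hδ₀ 2 h1 h2).smul ((1 / 2 : ℝ) : ℂ)
      have b4 := ((Dom.cauchy hM h8 hc.le hX hWW).symbol_mul norm_meanSym_le).dSym_mul
        (by positivity) hc hδ₀ 2 h1 h2
      have e : W (n + 1) = -((((1 / (n + 1) : ℝ) : ℂ) • (dSym 0 * cauchy (fun l => driftSym₁ * X l) W n)
          + ((1 / (n + 1) : ℝ) : ℂ) • (dSym 1 * cauchy (fun l => driftSym₂ * X l) W n))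
          + ((1 / 2 : ℝ) : ℂ) • ((1 / (n + 1) : ℝ) : ℂ) • (dSym 2 * cauchy W W n))
          + ((1 / (n + 1) : ℝ) : ℂ) • (dSym 2 * (meanSym * cauchy X (cauchy W W) n)) := by
        rw [hWdef, taylorVel_succ, stepVel, driftDivT, smul_add, smul_neg, smul_add, smul_add,
          mul_smul_comm, smul_comm ((1 / 2 : ℝ) : ℂ)]
      rw [e]
      refine (((b1.add b2).add b3).neg.add b4).mono ?_
      push_cast
      rw [mul_assoc M]
      refine fin (by positivity) ?_
      set K := (c / (δ₀ - δ)) ^ (n + 1) * (1 / ((n : ℝ) + 1 + 1) ^ 2) with hK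
      have hK0 : 0 ≤ K := by positivity
      have e0 : ‖(1 / 2 : ℂ)‖ = 1 / 2 := by norm_num
      have e1 : 48 * Real.pi * δ₀ * (8 * M * M) / c * K + 48 * Real.pi * δ₀ * (8 * M * M) / c * K
          + 1 / 2 * (48 * Real.pi * δ₀ * (8 * M * M) / c * K)
          + 48 * Real.pi * δ₀ * (8 * M * (8 * M * M)) / c * K
          = 48 * Real.pi * δ₀ * (20 * M * M + 64 * M ^ 3) / c * K := by ring
      rw [e0, e1, mul_assoc (48 * Real.pi * δ₀) (24 * M + 64 * M ^ 2) M]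
      have : 20 * M * M + 64 * M ^ 3 ≤ (24 * M + 64 * M ^ 2) * M := by nlinarith
      gcongr

/-! ### The sum of the Taylor series -/

section geometric

variable {δ M κ : ℝ} {X : ℕ → Coeffs}

/-- The room between |t| and b provides a geometric majorant that is uniform near t. -/
lemma exists_larger_radius (hκ : 0 ≤ κ) {t : ℝ} (ht : κ * |t| < 1) :
    ∃ b, |t| < b ∧ κ * b < 1 := by
  rcases hκ.eq_or_lt with rfl | hpos
  · exact ⟨|t| + 1, by linarith, by simp⟩
  · have h1 : |t| < 1 / κ := by rw [lt_div_iff₀ hpos]; linarith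
    obtain ⟨b, hb⟩ := exists_between h1
    refine ⟨b, hb.1, ?_⟩
    have := (lt_div_iff₀ hpos).mp hb.2
    linarith

lemma conv_of_geometric (hδ : 1 ≤ δ) (hκ : 0 ≤ κ) (hX : ∀ n, Bd δ (X n) (M * κ ^ n)) {t : ℝ}
    (ht : κ * |t| < 1) : Conv δ t X := by
  refine ⟨hδ, fun n => M * κ ^ n, hX, ?_⟩
  have h := (summable_geometric_of_lt_one (mul_nonneg hκ (abs_nonneg t)) ht).mul_left M
  exact h.congr fun n => by rw [mul_pow]; ring

lemma norm_synth_le_of_bd {a : Coeffs} {β : ℝ} (hδ : 1 ≤ δ) (h : Bd δ a β) (x : T3) :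
    ‖synth a x‖ ≤ β :=
  (norm_synth_le (summable_norm_of_wnorm hδ h.ne_top) x).trans (h.tsum_norm_le hδ)

/-- Term by term differentiation in time. -/
lemma hasDerivAt_synth_series (hδ : 1 ≤ δ) (hκ : 0 ≤ κ) (hX : ∀ n, Bd δ (X n) (M * κ ^ n))
    {Z : ℕ → Coeffs} (hZ : ∀ n, Z n = ((n : ℂ) + 1) • X (n + 1)) {t : ℝ} (ht : κ * |t| < 1)
    (x : T3) : HasDerivAt (fun s => synth (series s X) x) (synth (series t Z) x) t := by
  obtain ⟨b, hb1, hb2⟩ := exists_larger_radius hκ ht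
  have hb0 : 0 ≤ b := (abs_nonneg t).trans hb1.le
  have hM : ∀ n, 0 ≤ M * κ ^ n := fun n => (hX n).1
  have hκb : ‖κ * b‖ < 1 := by rwa [Real.norm_of_nonneg (mul_nonneg hκ hb0)]
  have hgeo : Summable fun n : ℕ => ((n : ℝ) + 1) * (κ * b) ^ n := by
    have h1 := summable_pow_mul_geometric_of_norm_lt_one 1 hκb
    have h2 := summable_geometric_of_norm_lt_one hκb
    exact (h1.add h2).congr fun n => by ring
  have hu : Summable fun n : ℕ => (n : ℝ) * b ^ (n - 1) * (M * κ ^ n) := by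
    rw [← summable_nat_add_iff 1]
    refine (hgeo.mul_left (M * κ)).congr fun n => ?_
    rw [Nat.add_sub_cancel, mul_pow, pow_succ]
    push_cast
    ring
  have hder := hasDerivAt_tsum_of_isPreconnected (𝕜 := ℝ) (F := ℂ)
    (g := fun n (s : ℝ) => (s : ℂ) ^ n * synth (X n) x)
    (g' := fun n (s : ℝ) => (n * (s : ℂ) ^ (n - 1)) * synth (X n) x)
    (t := Metric.ball 0 b) (y₀ := (0 : ℝ)) hu Metric.isOpen_ball
    (convex_ball (0 : ℝ) b).isPreconnected
    (fun n s _ => by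
      have h1 : HasDerivAt (fun s : ℝ => (s : ℂ) ^ n) (n * (s : ℂ) ^ (n - 1)) s :=
        (hasDerivAt_pow n (s : ℂ)).comp_ofReal
      exact h1.mul_const _)
    (fun n s hs => by
      rw [mem_ball_zero_iff, Real.norm_eq_abs] at hs
      rw [norm_mul, norm_mul, norm_pow, Complex.norm_real, Complex.norm_natCast, Real.norm_eq_abs]
      have := norm_synth_le_of_bd hδ (hX n) x
      gcongr)
    (Metric.mem_ball_self ((abs_nonneg t).trans_lt hb1))
    (summable_of_ne_finset_zero (s := {0}) fun n hn => by
      have : n ≠ 0 := by simpa using hn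
      simp [this])
    (by rw [mem_ball_zero_iff, Real.norm_eq_abs]; exact hb1)
  have hZc : Conv δ t Z := by
    refine ⟨hδ, fun n => ((n : ℝ) + 1) * (M * κ ^ (n + 1)), fun n => ?_, ?_⟩
    · rw [hZ]
      have := (hX (n + 1)).smul ((n : ℂ) + 1)
      have e : ‖(n : ℂ) + 1‖ = (n : ℝ) + 1 := by
        have := Complex.norm_natCast (n + 1)
        push_cast at this
        exact this
      rwa [e] at this
    · refine Summable.of_nonneg_of_le (fun n => ?_) (fun n => ?_) (hgeo.mul_left (M * κ))
      · exact mul_nonneg (by positivity) (mul_nonneg (by positivity) (hM _))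
      · have h1 : |t| ^ n ≤ b ^ n := by gcongr
        have h2 := hM (n + 1)
        calc |t| ^ n * (((n : ℝ) + 1) * (M * κ ^ (n + 1)))
            ≤ b ^ n * (((n : ℝ) + 1) * (M * κ ^ (n + 1))) := by gcongr
          _ = _ := by rw [mul_pow, pow_succ]; ring
  have hval : ∑' n : ℕ, ((n : ℂ) * (t : ℂ) ^ (n - 1)) * synth (X n) x = synth (series t Z) x := by
    rw [hZc.synth_series, Summable.tsum_eq_zero_add]
    · simp only [Nat.cast_zero, zero_mul, zero_add]
      refine tsum_congr fun n => ?_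
      rw [hZ, synth_smul, Nat.add_sub_cancel]
      push_cast
      ring
    · refine Summable.of_norm_bounded hu fun n => ?_
      rw [norm_mul, norm_mul, norm_pow, Complex.norm_real, Complex.norm_natCast, Real.norm_eq_abs]
      have := norm_synth_le_of_bd hδ (hX n) x
      gcongr
  rw [hval] at hder
  refine hder.congr_of_eventuallyEq ?_
  have hnhds : Metric.ball (0 : ℝ) b ∈ 𝓝 t :=
    Metric.isOpen_ball.mem_nhds (by rw [mem_ball_zero_iff, Real.norm_eq_abs]; exact hb1)
  filter_upwards [hnhds] with s hs
  rw [mem_ball_zero_iff, Real.norm_eq_abs] at hs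
  have : κ * |s| < 1 := lt_of_le_of_lt (by gcongr) hb2
  exact (conv_of_geometric hδ hκ hX this).synth_series x

/-- This majorant tends to 0 as s → t by `tendsto_series_bound`, which yields continuity in time
with values in B_δ. -/
lemma bd_series_sub (hδ : 1 ≤ δ) (hκ : 0 ≤ κ) (hX : ∀ n, Bd δ (X n) (M * κ ^ n)) {s t : ℝ}
    (hs : κ * |s| < 1) (ht : κ * |t| < 1) :
    Bd δ (series s X - series t X) (∑' n, |s ^ n - t ^ n| * (M * κ ^ n)) := by
  have cs := conv_of_geometric hδ hκ hX hs
  have ct := conv_of_geometric hδ hκ hX ht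
  have e : series s X - series t X = fun k => ∑' n, (((s ^ n - t ^ n : ℝ) : ℂ) • X n) k := by
    ext k
    simp only [Pi.sub_apply, series, Pi.smul_apply, smul_eq_mul]
    rw [← (cs.summable_apply k).of_norm.tsum_sub (ct.summable_apply k).of_norm]
    refine tsum_congr fun n => ?_
    push_cast
    ring
  rw [e]
  refine Bd.tsum (fun n => ?_) ?_
  · have := (hX n).smul ((s ^ n - t ^ n : ℝ) : ℂ)
    rwa [Complex.norm_real, Real.norm_eq_abs] at this
  · have g1 := (summable_geometric_of_lt_one (mul_nonneg hκ (abs_nonneg s)) hs).mul_left M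
    have g2 := (summable_geometric_of_lt_one (mul_nonneg hκ (abs_nonneg t)) ht).mul_left M
    refine Summable.of_nonneg_of_le (fun n => mul_nonneg (abs_nonneg _) (hX n).1) (fun n => ?_)
      (g1.add g2)
    have h1 : |s ^ n - t ^ n| ≤ |s| ^ n + |t| ^ n := by
      rw [← abs_pow, ← abs_pow]; exact abs_sub _ _
    calc |s ^ n - t ^ n| * (M * κ ^ n) ≤ (|s| ^ n + |t| ^ n) * (M * κ ^ n) :=
          mul_le_mul_of_nonneg_right h1 (hX n).1
      _ = _ := by rw [mul_pow, mul_pow]; ring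

lemma tendsto_series_bound (hκ : 0 ≤ κ) (hM : 0 ≤ M) {t : ℝ} (ht : κ * |t| < 1) :
    Tendsto (fun s : ℝ => ∑' n : ℕ, |s ^ n - t ^ n| * (M * κ ^ n)) (𝓝 t) (𝓝 0) := by
  obtain ⟨b, hb1, hb2⟩ := exists_larger_radius hκ ht
  have hb0 : 0 ≤ b := (abs_nonneg t).trans hb1.le
  have g := ((summable_geometric_of_lt_one (mul_nonneg hκ hb0) hb2).mul_left (2 * M))
  have h := tendsto_tsum_of_dominated_convergence (𝓕 := 𝓝 t)
    (f := fun (s : ℝ) (n : ℕ) => |s ^ n - t ^ n| * (M * κ ^ n)) (g := fun _ => 0) g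
    (fun n => by
      have : Continuous fun s : ℝ => |s ^ n - t ^ n| * (M * κ ^ n) := by fun_prop
      simpa using this.tendsto t)
    (by
      have hnhds : Metric.ball (0 : ℝ) b ∈ 𝓝 t :=
        Metric.isOpen_ball.mem_nhds (by rw [mem_ball_zero_iff, Real.norm_eq_abs]; exact hb1)
      filter_upwards [hnhds] with s hs n
      rw [mem_ball_zero_iff, Real.norm_eq_abs] at hs
      rw [Real.norm_of_nonneg (by positivity)]
      have h1 : |s ^ n - t ^ n| ≤ b ^ n + b ^ n := by
        refine (abs_sub _ _).trans ?_
        rw [abs_pow, abs_pow]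
        gcongr
      calc |s ^ n - t ^ n| * (M * κ ^ n) ≤ (b ^ n + b ^ n) * (M * κ ^ n) := by gcongr
        _ = _ := by rw [mul_pow]; ring)
  simpa using h

lemma herm_series (hX : ∀ n, Herm (X n)) (t : ℝ) : Herm (series t X) := fun k => by
  simp only [series, Complex.conj_tsum]
  exact tsum_congr fun n => by rw [map_mul, map_pow, Complex.conj_ofReal, hX n k]

lemma series_zero (X : ℕ → Coeffs) : series 0 X = X 0 := by
  ext k
  rw [series, tsum_eq_single 0 fun n hn => by simp [hn]]
  simp

/-- The real function with coefficients `series t X`. -/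
def seriesFun (X : ℕ → Coeffs) (t : ℝ) (x : T3) : ℝ := (synth (series t X) x).re

lemma hasCoeff_seriesFun (hδ : 1 ≤ δ) (hκ : 0 ≤ κ) (hX : ∀ n, Bd δ (X n) (M * κ ^ n))
    (hh : ∀ n, Herm (X n)) {t : ℝ} (ht : κ * |t| < 1) :
    HasCoeff δ (seriesFun X t) (series t X) :=
  HasCoeff.of_herm hδ (conv_of_geometric hδ hκ hX ht).ne_top (herm_series hh t)

lemma continuousInB_seriesFun (hδ : 1 ≤ δ) (hκ : 0 ≤ κ) (hX : ∀ n, Bd δ (X n) (M * κ ^ n))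
    (hh : ∀ n, Herm (X n)) {T : ℝ} (hT : κ * T ≤ 1) : ContinuousInB T δ (seriesFun X) := by
  have hM : 0 ≤ M := by simpa using (hX 0).1
  have key : ∀ t ∈ Ico 0 T, κ * |t| < 1 ∨ κ = 0 := fun t ht => by
    rcases hκ.eq_or_lt with h | h
    · exact Or.inr h.symm
    · left
      rw [abs_of_nonneg ht.1]
      exact lt_of_lt_of_le (by gcongr; exact ht.2) hT
  have key' : ∀ t ∈ Ico 0 T, κ * |t| < 1 := fun t ht => (key t ht).elim id fun h => by simp [h]
  have hc := fun t ht => hasCoeff_seriesFun hδ hκ hX hh (key' t ht)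
  refine ⟨fun t ht => (hc t ht).memB, fun t ht => ?_⟩
  refine squeeze_zero' (Eventually.of_forall fun s => ?_) ?_
    ((tendsto_series_bound hκ hM (key' t ht)).mono_left nhdsWithin_le_nhds)
  · rw [normB_eq_toReal (by linarith)]
    exact ENNReal.toReal_nonneg
  · filter_upwards [self_mem_nhdsWithin] with s hs
    rw [normB_eq_toReal (by linarith), ((hc s hs).sub (hc t ht)).fourierC_eq]
    have hb := bd_series_sub hδ hκ hX (key' s hs) (key' t ht)
    exact ENNReal.toReal_le_of_le_ofReal hb.1 hb.2

end geometric

/-! ### Strong solutions -/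

/-- Continuity in norm bounds the solution near each time, and compactness of [0, T'] makes the
bound uniform. -/
lemma ContinuousInB.exists_bd {T T' δ : ℝ} {u : ℝ → T3 → ℝ} (hδ : 1 ≤ δ)
    (h : ContinuousInB T δ u) (hT : T' < T) :
    ∃ R, ∀ t ∈ Icc 0 T', Bd δ (fourierC (u t)) R := by
  have hsub : Icc 0 T' ⊆ Ico 0 T := fun t ht => ⟨ht.1, ht.2.trans_lt hT⟩
  have hc : ∀ t ∈ Ico 0 T, HasCoeff δ (u t) (fourierC (u t)) := fun t ht => (h.1 t ht).hasCoeff hδ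
  have htri : ∀ s ∈ Ico 0 T, ∀ t ∈ Ico 0 T,
      normB δ (u s) ≤ normB δ (fun x => u s x - u t x) + normB δ (u t) := fun s hs t ht => by
    have e := ((hc s hs).sub (hc t ht))
    rw [normB_eq_toReal (by linarith), normB_eq_toReal (by linarith), normB_eq_toReal (by linarith),
      ← ENNReal.toReal_add (e.fourierC_eq ▸ e.ne_top) (hc t ht).ne_top]
    refine ENNReal.toReal_mono
      (ENNReal.add_ne_top.mpr ⟨e.fourierC_eq ▸ e.ne_top, (hc t ht).ne_top⟩) ?_
    rw [e.fourierC_eq]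
    refine le_trans (le_of_eq ?_) (wnorm_add_le δ _ _)
    rw [sub_add_cancel]
  have hloc : ∀ t ∈ Icc 0 T', ∃ S ∈ 𝓝[Icc 0 T'] t, ∃ C, ∀ s ∈ S ∩ Ico 0 T, normB δ (u s) ≤ C := by
    intro t ht
    have h1 := (h.2 t (hsub ht)).eventually (Iio_mem_nhds one_pos)
    have h2 := h1.filter_mono (nhdsWithin_mono t hsub)
    refine ⟨_, h2, 1 + normB δ (u t), fun s hs => (htri s hs.2 t (hsub ht)).trans ?_⟩
    have h3 : normB δ (fun x => u s x - u t x) < 1 := hs.1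
    have := h3.le
    gcongr
  obtain ⟨C, hC⟩ : ∃ C, ∀ s ∈ Icc 0 T' ∩ Ico 0 T, normB δ (u s) ≤ C := by
    refine isCompact_Icc.induction_on (p := fun S => ∃ C, ∀ s ∈ S ∩ Ico 0 T, normB δ (u s) ≤ C)
      ⟨0, by simp⟩ ?_ ?_ hloc
    · rintro S S' hS ⟨C, hC⟩
      exact ⟨C, fun s hs => hC s ⟨hS hs.1, hs.2⟩⟩
    · rintro S S' ⟨C, hC⟩ ⟨C', hC'⟩
      refine ⟨max C C', fun s hs => ?_⟩
      rcases hs.1 with h1 | h1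
      · exact (hC s ⟨h1, hs.2⟩).trans (le_max_left _ _)
      · exact (hC' s ⟨h1, hs.2⟩).trans (le_max_right _ _)
  refine ⟨C, fun t ht => (Bd.of_ne_top (hc t (hsub ht)).ne_top).mono ?_⟩
  rw [← normB_eq_toReal (by linarith)]
  exact hC t ⟨ht, hsub ht⟩

/-- Every larger R is allowed, so that two solutions can be given one common bound. -/
lemma exists_regSol {T T' δ : ℝ} {ρ v : ℝ → T3 → ℝ} {q : ℝ → UnitAddCircle → ℝ} (hδ : 1 < δ)
    (hρ : ContinuousInB T δ ρ) (hv : ContinuousInB T δ v)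
    (eq_rho : ∀ t ∈ Ico 0 T, ∀ x : T3, HasDerivWithinAt (fun s => ρ s x)
      (-(driftDiv (ρ t) (ρ t) x + pd 2 (fun y => v t y * ρ t y) x)) (Ico 0 T) t)
    (eq_vel : ∀ t ∈ Ico 0 T, ∀ x : T3, HasDerivWithinAt (fun s => v s x)
      (-(driftDiv (ρ t) (v t) x + v t x * pd 2 (v t) x) - q t (x 2)) (Ico 0 T) t)
    (hT : T' < T) : ∃ R₀, ∀ R ≥ R₀,
      RegSol δ R T' ρ v (fun t => fourierC (ρ t)) (fun t => fourierC (v t)) q := by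
  have hsub : Icc 0 T' ⊆ Ico 0 T := fun t ht => ⟨ht.1, ht.2.trans_lt hT⟩
  obtain ⟨R₁, h₁⟩ := hρ.exists_bd hδ.le hT
  obtain ⟨R₂, h₂⟩ := hv.exists_bd hδ.le hT
  refine ⟨max R₁ R₂, fun R hR => ?_⟩
  exact
    { one_lt := hδ
      rho := fun t ht => (hρ.1 t (hsub ht)).hasCoeff hδ.le
      vel := fun t ht => (hv.1 t (hsub ht)).hasCoeff hδ.le
      bd_rho := fun t ht => (h₁ t ht).mono ((le_max_left _ _).trans hR)
      bd_vel := fun t ht => (h₂ t ht).mono ((le_max_right _ _).trans hR)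
      eq_rho := fun t ht x => (eq_rho t (hsub ht) x).mono hsub
      eq_vel := fun t ht x => (eq_vel t (hsub ht) x).mono hsub }

namespace IsStrongSolution

variable {δ₁ T : ℝ} {ρ₀ v₀ : T3 → ℝ} {ρ v ρ' v' : ℝ → T3 → ℝ} {p p' : ℝ → UnitAddCircle → ℝ}

lemma exists_regSol (h : IsStrongSolution δ₁ T ρ₀ v₀ ρ v p) {δ T' : ℝ} (hδ : 1 < δ) (hδ₁ : δ < δ₁)
    (hT' : 0 < T') (hT : T' < T) : PressureLaw T' ρ v (fun t => dPar (p t)) ∧ ∃ R₀, ∀ R ≥ R₀,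
      RegSol δ R T' ρ v (fun t => fourierC (ρ t)) (fun t => fourierC (v t))
        (fun t => dPar (p t)) := by
  have hsub : Icc 0 T' ⊆ Ico 0 T := fun t ht => ⟨ht.1, ht.2.trans_lt hT⟩
  obtain ⟨R₀, hR₀⟩ := DriftFluid.exists_regSol hδ (h.rho_mem δ hδ hδ₁) (h.v_mem δ hδ hδ₁)
    h.eq_rho h.eq_v hT
  exact ⟨(hR₀ R₀ le_rfl).pressureLaw hT' (fun t ht => h.constraint t (hsub ht))
    (fun t ht => h.p_diff t (hsub ht)) fun _ _ _ => rfl, R₀, hR₀⟩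

lemma pressure (h : IsStrongSolution δ₁ T ρ₀ v₀ ρ v p) (hδ₁ : 1 < δ₁) {t : ℝ} (ht : t ∈ Ico 0 T)
    (z : UnitAddCircle) :
    -dPar (p t) z = dPar (perpMean fun x => ρ t x * v t x ^ 2) z := by
  obtain ⟨δ, hδ, hδlt⟩ := exists_between hδ₁
  obtain ⟨T', hT', hlt⟩ := exists_between ht.2
  exact (h.exists_regSol hδ hδlt (ht.1.trans_lt hT') hlt).1 t ⟨ht.1, hT'.le⟩ z

/-- Uniqueness of strong solutions. -/
theorem unique (h : IsStrongSolution δ₁ T ρ₀ v₀ ρ v p) (h' : IsStrongSolution δ₁ T ρ₀ v₀ ρ' v' p')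
    (hδ₁ : 1 < δ₁) {t : ℝ} (ht : t ∈ Ico 0 T) :
    ρ' t = ρ t ∧ v' t = v t ∧ ∃ c : ℝ, ∀ z, p' t z = p t z + c := by
  obtain ⟨δ, hδ, hδlt⟩ := exists_between hδ₁
  obtain ⟨T', hT', hlt⟩ := exists_between ht.2
  obtain ⟨law, R, hR⟩ := h.exists_regSol hδ hδlt (ht.1.trans_lt hT') hlt
  obtain ⟨law', R', hR'⟩ := h'.exists_regSol hδ hδlt (ht.1.trans_lt hT') hlt
  obtain ⟨e1, e2⟩ := (hR' _ (le_max_right R R')).unique law' (hR _ (le_max_left R R')) law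
    (h'.init_rho.trans h.init_rho.symm) (h'.init_v.trans h.init_v.symm) t ⟨ht.1, hT'.le⟩
  refine ⟨e1, e2, p' t 0 - p t 0, fun z => ?_⟩
  have hd : ∀ z, dPar (p' t) z = dPar (p t) z := fun z => by
    have h1 := h.pressure hδ₁ ht z
    have h2 := h'.pressure hδ₁ ht z
    rw [e1, e2, ← h1] at h2
    linarith
  have h3 : ∀ y : ℝ, HasDerivAt (fun s : ℝ => p' t (s : UnitAddCircle) - p t (s : UnitAddCircle))
      0 y := fun y => by
    refine ((hasDerivAt_dPar (h'.p_diff t ht) y).fun_sub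
      (hasDerivAt_dPar (h.p_diff t ht) y)).congr_deriv ?_
    rw [hd, sub_self]
  obtain ⟨y, rfl⟩ := QuotientAddGroup.mk_surjective z
  have h4 := is_const_of_deriv_eq_zero (fun y => (h3 y).differentiableAt)
    (fun y => (h3 y).deriv) y 0
  have h5 : p' t (y : UnitAddCircle) - p t (y : UnitAddCircle) = p' t 0 - p t 0 := h4
  have h6 : p' t (y : UnitAddCircle) = p t (y : UnitAddCircle) + (p' t 0 - p t 0) := by linarith
  exact h6

end IsStrongSolution

/-- Existence of strong solutions. -/
theorem exists_isStrongSolution {δ₀ : ℝ} (hδ₀ : 1 < δ₀) {ρ₀ v₀ : T3 → ℝ} (hρ₀ : MemB δ₀ ρ₀)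
    (hv₀ : MemB δ₀ v₀) (hmean : ∀ z, perpMean ρ₀ z = 1)
    (hcurrent : ∀ z, dPar (perpMean fun x => ρ₀ x * v₀ x) z = 0) :
    ∃ η : ℝ, 0 < η ∧ ∀ δ₁ : ℝ, 1 < δ₁ → δ₁ < δ₀ → ∃ ρ v p,
      IsStrongSolution δ₁ (η * (δ₀ - δ₁)) ρ₀ v₀ ρ v p := by
  have ca := hρ₀.hasCoeff hδ₀.le
  have cb := hv₀.hasCoeff hδ₀.le
  set a := fourierC ρ₀
  set b := fourierC v₀
  set M := (wnorm δ₀ a).toReal + (wnorm δ₀ b).toReal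
  have ha : Bd δ₀ a M := (Bd.of_ne_top ca.ne_top).mono (le_add_of_nonneg_right ENNReal.toReal_nonneg)
  have hb : Bd δ₀ b M := (Bd.of_ne_top cb.ne_top).mono (le_add_of_nonneg_left ENNReal.toReal_nonneg)
  have hM : 0 ≤ M := ha.1
  have hpi := Real.pi_pos
  -- The summand 1 keeps c positive whatever M is. Only δ₀ and the norms of the data enter, so η =
  -- 1/c does not depend on δ₁.
  set c := 48 * Real.pi * δ₀ * (24 * M + 64 * M ^ 2) + 1 with hcdef
  have hc : 0 < c := by positivity
  refine ⟨1 / c, by positivity, fun δ₁ h1 h2 => ?_⟩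
  have hgap : 0 < δ₀ - δ₁ := by linarith
  set T := 1 / c * (δ₀ - δ₁) with hT
  set κ := c / (δ₀ - δ₁) with hκdef
  have hκ : 0 < κ := by positivity
  -- The majorant is geometric with ratio κt, so T is exactly the time up to which it converges.
  have hκT : κ * T = 1 := by rw [hκdef, hT]; field_simp
  set X := taylorRho a b
  set W := taylorVel a b
  have dom := fun n => dom_taylor hδ₀ hM hc (by linarith : _ ≤ c) ha hb n
  have geo : ∀ {Y : ℕ → Coeffs} {A : ℝ}, 0 ≤ A → (∀ n, Dom δ₀ c n Y A) →
      ∀ n, Bd δ₁ (Y n) (A * κ ^ n) := fun {Y A} hA hY n => by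
    refine (hY n n le_rfl δ₁ h1.le h2).mono ?_
    refine mul_le_of_le_one_right (by positivity) ?_
    rw [div_le_one (by positivity)]
    have : (0 : ℝ) ≤ n := Nat.cast_nonneg n
    nlinarith
  have hX := geo hM fun n => (dom n).1
  have hW := geo hM fun n => (dom n).2
  have hWW := geo (by positivity) fun n => Dom.cauchy hM hM hc.le (dom n).2 (dom n).2
  have hermX := fun n => (herm_taylor ca.herm cb.herm n).1
  have hermW := fun n => (herm_taylor ca.herm cb.herm n).2
  have small : ∀ t ∈ Ico 0 T, κ * |t| < 1 := fun t ht => by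
    rw [abs_of_nonneg ht.1, ← hκT]
    gcongr
    exact ht.2
  have hCX := fun t ht => hasCoeff_seriesFun h1.le hκ.le hX hermX (small t ht)
  have hCW := fun t ht => hasCoeff_seriesFun h1.le hκ.le hW hermW (small t ht)
  set ρ := seriesFun X
  set v := seriesFun W
  have re_deriv : ∀ {Y Z : ℕ → Coeffs} {F : T3 → ℝ} {s : Coeffs} {t : ℝ},
      (∀ n, Bd δ₁ (Y n) (M * κ ^ n)) → (∀ n, Y (n + 1) = ((1 / (n + 1) : ℝ) : ℂ) • Z n) →
      t ∈ Ico 0 T → SeriesAt t Z s → HasCoeff 1 F s → ∀ x,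
      HasDerivAt (fun τ => seriesFun Y τ x) (F x) t := fun {Y Z F s t} hY hZ ht hs hF x => by
    have hd := hasDerivAt_synth_series h1.le hκ.le hY (Z := Z) (fun n => by
      rw [hZ, smul_smul]
      have h0 : ((n : ℂ) + 1) ≠ 0 := by exact_mod_cast Nat.succ_ne_zero n
      have : ((n : ℂ) + 1) * ((1 / (n + 1) : ℝ) : ℂ) = 1 := by
        push_cast
        field_simp
      rw [this, one_smul]) (small t ht) x
    rw [hs.series_eq, ← hF.eq] at hd
    have := Complex.reCLM.hasFDerivAt.comp_hasDerivAt t hd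
    simpa [Function.comp_def, seriesFun] using this
  have eq_rho : ∀ t ∈ Ico 0 T, ∀ x : T3, HasDerivWithinAt (fun s => ρ s x)
      (-(driftDiv (ρ t) (ρ t) x + pd 2 (fun y => v t y * ρ t y) x)) (Ico 0 T) t :=
    fun t ht x => (re_deriv hX (taylorRho_succ a b) ht
      (seriesAt_stepRho (conv_of_geometric h1.le hκ.le hX (small t ht))
        (conv_of_geometric h1.le hκ.le hW (small t ht)))
      ((hCX t ht).rhsRho le_rfl h1 (hCW t ht)) x).hasDerivWithinAt
  -- The pressure law is satisfied by construction, with the additive constant taken to be 0.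
  let p : ℝ → UnitAddCircle → ℝ := fun t z => -perpMean (fun x => ρ t x * v t x ^ 2) z
  have hp : ∀ t z, dPar (p t) z = -dPar (perpMean fun x => ρ t x * v t x ^ 2) z := fun t z => by
    simp only [dPar, p, deriv.fun_neg]
  have eq_vel : ∀ t ∈ Ico 0 T, ∀ x : T3, HasDerivWithinAt (fun s => v s x)
      (-(driftDiv (ρ t) (v t) x + v t x * pd 2 (v t) x) - dPar (p t) (x 2)) (Ico 0 T) t :=
    fun t ht x => (re_deriv hW (taylorVel_succ a b) ht
      (seriesAt_stepVel (conv_of_geometric h1.le hκ.le hX (small t ht))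
        (conv_of_geometric h1.le hκ.le hW (small t ht))
        (conv_of_geometric h1.le hκ.le hWW (small t ht)))
      ((((hCX t ht).rhsAdv le_rfl h1 (hCW t ht)).add
        ((hCX t ht).rhsPress le_rfl h1 (hCW t ht))).congr
          (ψ := fun x => -(driftDiv (ρ t) (v t) x + v t x * pd 2 (v t) x) - dPar (p t) (x 2))
          (fun x => by rw [hp, sub_neg_eq_add]) rfl) x).hasDerivWithinAt
  have h0T : (0 : ℝ) ∈ Ico 0 T := ⟨le_rfl, by positivity⟩
  have init_rho : ρ 0 = ρ₀ := by
    have := hCX 0 h0T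
    rw [series_zero, taylorRho_zero] at this
    exact this.ext ca
  have init_v : v 0 = v₀ := by
    have := hCW 0 h0T
    rw [series_zero, taylorVel_zero] at this
    exact this.ext cb
  -- The series is continuous even at radius δ₁ itself, so the constraint can be propagated with δ₁
  -- as the reference radius.
  have cρ : ContinuousInB T δ₁ ρ := continuousInB_seriesFun h1.le hκ.le hX hermX hκT.le
  have cv : ContinuousInB T δ₁ v := continuousInB_seriesFun h1.le hκ.le hW hermW hκT.le
  have lower : ∀ {Y : ℕ → Coeffs}, (∀ n, Bd δ₁ (Y n) (M * κ ^ n)) → (∀ n, Herm (Y n)) →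
      ∀ δ, 1 < δ → δ < δ₁ → ContinuousInB T δ (seriesFun Y) := fun hY hH δ hδ hlt =>
    continuousInB_seriesFun hδ.le hκ.le (fun n => (hY n).mono_radius hδ.le hlt.le) hH hκT.le
  refine ⟨ρ, v, p,
    { rho_mem := lower hX hermX
      v_mem := lower hW hermW
      p_diff := fun t ht s =>
        (hasDerivAt_perpMean h1 ((hCX t ht).flux (hCW t ht)) s).neg.differentiableAt
      init_rho := init_rho
      init_v := init_v
      eq_rho := eq_rho
      eq_v := eq_vel
      constraint := fun t ht => ?_ }⟩
  -- Uniform bounds are available only on compact intervals, so the constraint is proved on some [0,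
  -- T'] that contains t.
  obtain ⟨T', hT', hlt⟩ := exists_between ht.2
  obtain ⟨R, hR⟩ := exists_regSol h1 cρ cv eq_rho eq_vel hlt
  exact (hR R le_rfl).perpMean_eq_one (fun s _ z => by simp only [hp, neg_neg])
    (by rw [init_rho]; exact hmean) (by rw [init_rho, init_v]; exact hcurrent) t ⟨ht.1, hT'.le⟩

end DriftFluid

end

theorem mainTheorem3 (δ₀ : ℝ) (hδ₀ : 1 < δ₀) (ρ₀ v₀ : DriftFluid.T3 → ℝ)
    (hρ₀ : DriftFluid.MemB δ₀ ρ₀) (hv₀ : DriftFluid.MemB δ₀ v₀)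
    (hpos : ∀ x, 0 ≤ ρ₀ x)
    (hmean : ∀ z, DriftFluid.perpMean ρ₀ z = 1)
    (hcurrent : ∀ z, DriftFluid.dPar (DriftFluid.perpMean fun x => ρ₀ x * v₀ x) z = 0) :
    ∃ η : ℝ, 0 < η ∧ ∀ δ₁ : ℝ, 1 < δ₁ → δ₁ < δ₀ →
      ∃ (ρ v : ℝ → DriftFluid.T3 → ℝ) (p : ℝ → UnitAddCircle → ℝ),
        DriftFluid.IsStrongSolution δ₁ (η * (δ₀ - δ₁)) ρ₀ v₀ ρ v p ∧
        (∀ t ∈ Set.Ico 0 (η * (δ₀ - δ₁)), ∀ z,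
          -DriftFluid.dPar (p t) z =
            DriftFluid.dPar (DriftFluid.perpMean fun x => ρ t x * v t x ^ 2) z) ∧
        ∀ (ρ' v' : ℝ → DriftFluid.T3 → ℝ) (p' : ℝ → UnitAddCircle → ℝ),
          DriftFluid.IsStrongSolution δ₁ (η * (δ₀ - δ₁)) ρ₀ v₀ ρ' v' p' →
          ∀ t ∈ Set.Ico 0 (η * (δ₀ - δ₁)),
            ρ' t = ρ t ∧ v' t = v t ∧ ∃ c : ℝ, ∀ z, p' t z = p t z + c := by
  obtain ⟨η, hη, h⟩ := DriftFluid.exists_isStrongSolution hδ₀ hρ₀ hv₀ hmean hcurrent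
  refine ⟨η, hη, fun δ₁ h1 h2 => ?_⟩
  obtain ⟨ρ, v, p, hs⟩ := h δ₁ h1 h2
  exact ⟨ρ, v, p, hs, fun t ht z => hs.pressure h1 ht z,
    fun ρ' v' p' hs' t ht => hs.unique hs' h1 ht⟩
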